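/- **Conventions.** A *prederivator* is a 2-functor $\mathscr D\colon \mathrm{Cat}^{op}\to\mathrm{CAT}$ (1-cells reversed, 2-cells not), $A\mapsto\mathscr D(A)$, $(u\colon A\to B)\mapsto (u^*\colon\mathscr D(B)\to\mathscr D(A))$; morphisms are pseudonatural transformations and 2-cells are modifications, and equivalences, adjunctions and isomorphisms of morphisms are understood in this 2-category. Let $e$ be the terminal category. A *derivator* is a prederivator such that (Der1) $\mathscr D(\coprod A_i)\to\prod\mathscr D(A_i)$ is an equivalence for every small family; (Der2) a morphism $f$ of $\mathscr D(A)$ is invertible iff $f_a:=a^*f$ is invertible in $\mathscr D(e)$ for all $a\in A$; (Der3) every $u^*$ has a left adjoint $u_!$ and a right adjoint $u_*$ (Kan extensions); (Der4) Kan extensions are computed pointwise: the canonical maps between (co)limits over the slice categories $(u/b)$, $(b/u)$ and the values at $b$ of Kan extensions along $u$ are isomorphisms. Let $\square=[1]\times[1]$. A square $X\in\mathscr D(\square)$ is *cocartesian* (*cartesian*) if it lies in the essential image of the left (right) Kan extension along the inclusion into $\square$ of the full subposet without the terminal (initial) object. A derivator is *stable* if $\mathscr D(e)$ has a zero object and a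 square is cartesian iff it is cocartesian. A morphism of stable derivators is *exact* if it preserves initial and terminal objects of $\mathscr D(e)$ and cocartesian and cartesian squares. For a small category $B$ put $\mathscr D^B(A)=\mathscr D(B\times A)$. A functor $u$ is a *homotopical epimorphism* if $u^*\colon\mathscr D(B)\to\mathscr D(A)$ is fully faithful for every derivator $\mathscr D$. A *full subprederivator* $\mathscr D'\subseteq\mathscr D$ consists of full subcategories $\mathscr D'(A)\subseteq\mathscr D(A)$ stable under all $u^*$; it is a *strict full subderivator* if it satisfies (Der1) and (Der3) and its left and right Kan extensions are, up to the canonical comparison maps, those of $\mathscr D$. For $n\ge 3$ let $\tilde A(n,2)$ be the set of the pairs $(0,0)$, $(n-2,n-2)$ and $(i,i+1)$, $(i+1,i)$ for $0\le i\le n-3$, with the order induced by the product order on $\mathbb N\times\mathbb N$, and let $\mathscr D^{A(n,2)}\subseteq\mathscr D^{\tilde A(n,2)}$ be the full subprederivator of the diagrams which vanish at the positions $(i,i+1)$, $0\le i\le n-3$: $X\in\mathscr D(\tilde A(n,2)\times A)$ belongs to it iff $X_{((i,i+1),a)}$ is a zero object for all such $i$ and all $a\in A$. Let $A_n$ also denote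 the free category on the linearly oriented quiver $A_n$, i.e. the poset $0<1<\dots<n-1$. **Theorem.** Let $n\ge 3$. (a) For every stable derivator $\mathscr D$, $\mathscr D^{A(n,2)}$ is a strict full subderivator of $\mathscr D^{\tilde A(n,2)}$, and $\mathscr D^{A(n,2)}$ and $\mathscr D^{A_n}$ are stable derivators. (b) There is an equivalence of stable derivators $$i^n\colon \mathscr D^{A(n,2)}\rightleftarrows\mathscr D^{A_n}\colon G^n$$ for every stable derivator $\mathscr D$, natural with respect to exact morphisms; that is, the 2-functors $\mathscr D\mapsto\mathscr D^{A(n,2)}$ and $\mathscr D\mapsto\mathscr D^{A_n}$ from the 2-category of stable derivators, exact morphisms and modifications to the 2-category of prederivators are pseudonaturally equivalent. (c) The equivalence in (b) can be chosen so that $i^n$ and $G^n$ are composites of Kan extensions and restrictions. Precisely, there are two finite sequences of operations, independent of $\mathscr D$, which lead from diagrams of shape $\tilde A(n,2)$ to diagrams of shape $A_n$ and vice versa; each operation is a restriction $u^*$ or a Kan extension $u_!$ or $u_*$ along a functor $u$ of small categories which is fully faithful or a homotopical epimorphism; and for every stable derivator $\mathscr D$, if $F\colon\mathscr D^{\tilde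 A(n,2)}\to\mathscr D^{A_n}$ and $G\colon\mathscr D^{A_n}\to\mathscr D^{\tilde A(n,2)}$ are their composites, then $i^n$ is isomorphic to the restriction of $F$ to $\mathscr D^{A(n,2)}$, and $G^n$ followed by the inclusion into $\mathscr D^{\tilde A(n,2)}$ is isomorphic to $G$. -/

import Mathlib

open CategoryTheory Bicategory Opposite
open scoped Pseudofunctor.StrongTrans

universe w v u

set_option linter.checkUnivs false in
/-- A prederivator: a 2-functor from `Catᵒᵖ` (the 2-category of small categories with reversed
1-cells) to the 2-category of large categories. The bicategory structure on prederivators is the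
one whose 1-cells are pseudonatural transformations and whose 2-cells are modifications. -/
abbrev Prederivator := Pseudofunctor (Cat.{w, w})ᵒᵖ Cat.{v, u}

namespace Prederivator

section Auxiliary
variable {C : Type u} [Category.{v} C]
lemma aux_six {X Y : C} (m : X ⟶ Y) {x : Y ⟶ Y} (h : x = 𝟙 Y) :
    𝟙 X ≫ m = m ≫ 𝟙 Y ≫ 𝟙 Y ≫ 𝟙 Y ≫ x ≫ 𝟙 Y := by
  simp [h]
lemma aux_cancel {X Y Z W : C} {M : X ⟶ Z} {c : X ⟶ W} {r : W ⟶ Y} (i : Z ≅ Y)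
    (h : M = c ≫ r ≫ i.inv) : M ≫ i.hom = c ≫ r := by
  simp [h]
lemma aux_unit {X Y : C} {a : X ⟶ Y} (i : X ≅ Y) (h : 𝟙 X = a ≫ i.inv ≫ 𝟙 X) : a = i.hom := by
  rw [Category.comp_id, Iso.eq_comp_inv, Category.id_comp] at h
  exact h.symm
lemma aux_assoc {X Y Z W : C} {a : X ⟶ Y} {b : Y ⟶ Z} (i : W ≅ Z) (j : X ≅ W)
    (h : 𝟙 X = a ≫ b ≫ 𝟙 Z ≫ i.inv ≫ j.inv) : j.hom ≫ i.hom = a ≫ b := by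
  have := congrArg (fun t => t ≫ j.hom ≫ i.hom) h
  simpa using this

lemma aux_natural {W X Y Y' Z Z' : C} {T : W ⟶ X} (c₁ : W ≅ Y) (c₁' : X ≅ Y') {c₂ : W ⟶ Z}
    {c₂' : X ⟶ Z'} {M : Y ⟶ Y'} {N : Z ⟶ Z'} (h₁ : T ≫ c₁'.hom = c₁.hom ≫ M)
    (h₂ : T ≫ c₂' = c₂ ≫ N) : M ≫ c₁'.inv ≫ c₂' = (c₁.inv ≫ c₂) ≫ N := by
  have hM : M = c₁.inv ≫ T ≫ c₁'.hom := by simp [h₁]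
  simp [hM, h₂]
lemma aux_id {X Y Z : C} (c : X ≅ Y) (m : Y ≅ X) {d : X ⟶ Z} (r : Z ≅ X)
    (h₁ : c.hom = m.inv) (h₂ : d = r.inv) :
    (c.inv ≫ d) ≫ r.hom = m.hom ≫ 𝟙 X ≫ 𝟙 X := by
  have : c = m.symm := Iso.ext h₁
  subst this
  simp [h₂]
lemma aux_comp {P Q R S T U V : C} (p : P ≅ Q) (q : Q ≅ R) (r : P ≅ S) {s : S ⟶ R} {t : Q ⟶ T}
    (k : P ≅ U) (m : U ≅ T) {n : P ⟶ V} {W : C} {o : V ⟶ W} {l : U ⟶ W} {z : T ⟶ W}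
    (h₁ : p.hom ≫ q.hom = r.hom ≫ s) (h₂ : p.hom ≫ t = k.hom ≫ m.hom)
    (h₃ : n ≫ o = k.hom ≫ l) (hz : z = m.inv ≫ l) :
    (r.inv ≫ n) ≫ o = s ≫ 𝟙 R ≫ (q.inv ≫ t) ≫ 𝟙 T ≫ z ≫ 𝟙 W := by
  have hs : s = r.inv ≫ p.hom ≫ q.hom := by simp [h₁]
  have ht : t = p.inv ≫ k.hom ≫ m.hom := by simp [← h₂]
  simp [hs, ht, hz, h₃]
lemma aux_square {X : C} {x : X ⟶ X} (h : x = 𝟙 X) : x ≫ 𝟙 X = 𝟙 X ≫ 𝟙 X := by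
  rw [h]
lemma aux_whisker {X Y : C} {a b : X ⟶ Y} (h : a = b) : a = 𝟙 X ≫ b ≫ 𝟙 Y := by
  simp [h]
lemma aux_three {X : C} {m : X ⟶ X} (h : m = 𝟙 X) : 𝟙 X = 𝟙 X ≫ m ≫ 𝟙 X := by
  simp [h]
lemma aux_five {X : C} {m : X ⟶ X} (h : m = 𝟙 X) :
    𝟙 X = 𝟙 X ≫ m ≫ 𝟙 X ≫ 𝟙 X ≫ 𝟙 X := by
  simp [h]
variable {K : Type*} [Bicategory K] {W X Y Z : K}
lemma aux_associator (f : W ⟶ X) (g : X ⟶ Y) (h : Y ⟶ Z) {a : (f ≫ g) ≫ h ⟶ f ≫ g ≫ h}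
    (ha : a = (α_ f g h).hom) :
    a = 𝟙 _ ≫ 𝟙 (f ≫ g) ▷ h ≫ (α_ f g h).hom ≫ f ◁ 𝟙 (g ≫ h) ≫ 𝟙 _ := by
  simp [ha]
lemma aux_leftUnitor (f : W ⟶ X) {a : 𝟙 W ≫ f ⟶ f} (ha : a = (λ_ f).hom) :
    a = 𝟙 _ ≫ 𝟙 (𝟙 W) ▷ f ≫ (λ_ f).hom := by
  simp [ha]
lemma aux_rightUnitor (f : W ⟶ X) {a : f ≫ 𝟙 X ⟶ f} (ha : a = (ρ_ f).hom) :
    a = 𝟙 _ ≫ f ◁ 𝟙 (𝟙 X) ≫ (ρ_ f).hom := by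
  simp [ha]
end Auxiliary

/-- A functor `A ⥤ B`, as a 1-cell `B ⟶ A` of `Catᵒᵖ` (only 1-cells are reversed). -/
abbrev opHom {A B : Cat.{w, w}} (f : A ⥤ B) : op B ⟶ op A := Quiver.Hom.op (Cat.Hom.ofFunctor f)
/-- A natural transformation, as a 2-cell of `Catᵒᵖ`. -/
abbrev opHom₂ {A B : Cat.{w, w}} {f g : A ⥤ B} (α : f ⟶ g) : opHom f ⟶ opHom g :=
  Bicategory.Opposite.Hom2.op2' ⟨α⟩

/-- The category `𝒟(A)` of coherent diagrams of shape `A`. -/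
abbrev Dia (D : Prederivator.{w, v, u}) (A : Cat.{w,w}) : Type u := D.obj (op A)
/-- The restriction functor `f^* : 𝒟(B) ⥤ 𝒟(A)`. -/
abbrev res (D : Prederivator.{w, v, u}) {A B : Cat.{w,w}} (f : A ⥤ B) : D.Dia B ⥤ D.Dia A :=
  (D.map (opHom f)).toFunctor
/-- The natural transformation `α^* : f^* ⟶ g^*`. -/
abbrev resTrans (D : Prederivator.{w, v, u}) {A B : Cat.{w,w}} {f g : A ⥤ B} (α : f ⟶ g) : D.res f ⟶ D.res g :=
  (D.map₂ (opHom₂ α)).toNatTrans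
/-- The structure isomorphism `(gf)^* ≅ f^* g^*`. -/
abbrev resComp (D : Prederivator.{w, v, u}) {A B C : Cat.{w,w}} (f : A ⥤ B) (g : B ⥤ C)  : D.res (f ⋙ g) ≅ D.res g ⋙ D.res f :=
  Cat.Hom.toNatIso (D.mapComp (opHom g) (opHom f))

/-- The functor `id_B × f`. -/
abbrev prodFun (B : Cat.{w,w}) {A A' : Cat.{w,w}} (f : A ⥤ A') :
    Cat.of (B × A) ⥤ Cat.of (B × A') := (𝟭 B).prod f
/-- The natural transformation `id_B × α`. -/
abbrev prodFun₂ (B : Cat.{w,w}) {A A' : Cat.{w,w}} {f g : A ⥤ A'} (α : f ⟶ g) :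
    prodFun B f ⟶ prodFun B g := NatTrans.prod (𝟙 (𝟭 B)) α

lemma prodFun₂_comp (B : Cat.{w,w}) {A A' : Cat.{w,w}} {f g h : A ⥤ A'} (α : f ⟶ g) (β : g ⟶ h) :
    prodFun₂ B (α ≫ β) = prodFun₂ B α ≫ prodFun₂ B β :=
  NatTrans.ext (funext fun _ => Prod.ext (Category.id_comp _).symm rfl)

/-- The structure isomorphism `(id_A)^* ≅ id`. -/
abbrev resId (D : Prederivator.{w, v, u}) (A : Cat.{w,w}) : D.res (𝟭 A) ≅ 𝟭 (D.Dia A) :=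
  Cat.Hom.toNatIso (D.mapId (op A))

lemma resComp_assoc (D : Prederivator.{w, v, u}) {A B C E : Cat.{w,w}} (f : A ⥤ B) (g : B ⥤ C) (h : C ⥤ E)
    (X : D.Dia E) :
    (D.resComp (f ⋙ g) h).hom.app X ≫ (D.resComp f g).hom.app ((D.res h).obj X) =
    (D.resComp f (g ⋙ h)).hom.app X ≫ (D.res f).map ((D.resComp g h).hom.app X) := by
  have := congrArg (fun t => t.toNatTrans.app X) (D.map₂_associator (opHom h) (opHom g) (opHom f))
  have e : D.map₂ (α_ (opHom h) (opHom g) (opHom f)).hom = 𝟙 (D.map (opHom ((f ⋙ g) ⋙ h))) := D.map₂_id _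
  rw [e] at this
  change 𝟙 _ = (D.resComp f (g ⋙ h)).hom.app X ≫ (D.res f).map ((D.resComp g h).hom.app X) ≫ 𝟙 _ ≫
    (D.resComp f g).inv.app ((D.res h).obj X) ≫ (D.resComp (f ⋙ g) h).inv.app X at this
  exact aux_assoc ((D.resComp f g).app ((D.res h).obj X)) ((D.resComp (f ⋙ g) h).app X) this

lemma resComp_natLeft (D : Prederivator.{w, v, u}) {A B C : Cat.{w,w}} {f f' : A ⥤ B} (α : f ⟶ f') (g : B ⥤ C)
    (X : D.Dia C) :
    (D.resTrans (Functor.whiskerRight α g)).app X ≫ (D.resComp f' g).hom.app X =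
      (D.resComp f g).hom.app X ≫ (D.resTrans α).app ((D.res g).obj X) := by
  have := congrArg (fun t => t.toNatTrans.app X) (D.map₂_whisker_left (opHom g) (opHom₂ α))
  change _ = (D.resComp f g).hom.app X ≫ (D.resTrans α).app ((D.res g).obj X) ≫
    (D.resComp f' g).inv.app X at this
  exact aux_cancel ((D.resComp f' g).app X) this

lemma resComp_natRight (D : Prederivator.{w, v, u}) {A B C : Cat.{w,w}} (f : A ⥤ B) {g g' : B ⥤ C}
    (α : g ⟶ g') (X : D.Dia C) :
    (D.resTrans (Functor.whiskerLeft f α)).app X ≫ (D.resComp f g').hom.app X =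
      (D.resComp f g).hom.app X ≫ (D.res f).map ((D.resTrans α).app X) := by
  have := congrArg (fun t => t.toNatTrans.app X) (D.map₂_whisker_right (opHom₂ α) (opHom f))
  change _ = (D.resComp f g).hom.app X ≫ (D.res f).map ((D.resTrans α).app X) ≫
    (D.resComp f g').inv.app X at this
  exact aux_cancel ((D.resComp f g').app X) this

lemma resComp_id_left (D : Prederivator.{w, v, u}) {A B : Cat.{w,w}} (f : A ⥤ B) (X : D.Dia B) :
    (D.resComp (𝟭 A) f).hom.app X = (D.resId A).inv.app ((D.res f).obj X) := by
  have := congrArg (fun t => t.toNatTrans.app X) (D.map₂_right_unitor (opHom f))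
  have e : D.map₂ (ρ_ (opHom f)).hom = 𝟙 (D.map (opHom f)) := D.map₂_id _
  rw [e] at this
  change 𝟙 _ = (D.resComp (𝟭 A) f).hom.app X ≫ (D.resId A).hom.app ((D.res f).obj X) ≫ 𝟙 _ at this
  exact aux_unit ((D.resId A).symm.app ((D.res f).obj X)) this

lemma resComp_id_right (D : Prederivator.{w, v, u}) {A B : Cat.{w,w}} (f : A ⥤ B) (X : D.Dia B) :
    (D.resComp f (𝟭 B)).hom.app X = (D.res f).map ((D.resId B).inv.app X) := by
  have := congrArg (fun t => t.toNatTrans.app X) (D.map₂_left_unitor (opHom f))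
  have e : D.map₂ (λ_ (opHom f)).hom = 𝟙 (D.map (opHom f)) := D.map₂_id _
  rw [e] at this
  change 𝟙 _ = (D.resComp f (𝟭 B)).hom.app X ≫ (D.res f).map ((D.resId B).hom.app X) ≫ 𝟙 _ at this
  exact aux_unit ((D.res f).mapIso ((D.resId B).symm.app X)) this

/-! ### Derivators -/

/-- The terminal category `e`. -/
abbrev pt : Cat.{w, w} := Cat.of (Discrete PUnit.{w + 1})

/-- The functor `a : e ⥤ A` given by an object `a` of `A`. -/
abbrev ptAt {A : Cat.{w, w}} (a : A) : pt.{w} ⥤ A := Functor.fromPUnit a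

/-- The unique functor `A ⥤ e`. -/
abbrev toPt (A : Cat.{w, w}) : A ⥤ pt.{w} := (Functor.const A).obj ⟨PUnit.unit⟩

/-- Evaluation `a^* : 𝒟(A) ⥤ 𝒟(e)` at an object `a`. -/
abbrev eval (D : Prederivator.{w, v, u}) {A : Cat.{w, w}} (a : A) : D.Dia A ⥤ D.Dia pt.{w} :=
  D.res (ptAt a)

/-- The transformation `p^* u^* ⟶ q^* v^*` (composition from right to left) induced by a square
of functors which commutes up to `α : u p ⟶ v q`. -/
abbrev resSquare (D : Prederivator.{w, v, u}) {X A B C : Cat.{w, w}} {p : X ⥤ A} {q : X ⥤ B}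
    {u' : A ⥤ C} {v' : B ⥤ C} (α : p ⋙ u' ⟶ q ⋙ v') :
    D.res u' ⋙ D.res p ⟶ D.res v' ⋙ D.res q :=
  (D.resComp p u').inv ≫ D.resTrans α ≫ (D.resComp q v').hom

/-- The square `α : u p ⟶ v q` is `𝒟`-exact: the canonical mates `q_! p^* ⟶ v^* u_!` and
`u^* v_* ⟶ p_* q^*` are isomorphisms (for any choice of the adjoints). -/
def IsExactSquare (D : Prederivator.{w, v, u}) {X A B C : Cat.{w, w}} {p : X ⥤ A} {q : X ⥤ B}
    {u' : A ⥤ C} {v' : B ⥤ C} (α : p ⋙ u' ⟶ q ⋙ v') : Prop :=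
  (∀ (uL : D.Dia A ⥤ D.Dia C) (hu : uL ⊣ D.res u') (qL : D.Dia X ⥤ D.Dia B) (hq : qL ⊣ D.res q),
    IsIso ((mateEquiv hu hq).symm (.mk _ _ _ _ (D.resSquare α))).natTrans) ∧
  (∀ (vR : D.Dia B ⥤ D.Dia C) (hv : D.res v' ⊣ vR) (pR : D.Dia X ⥤ D.Dia A) (hp : D.res p ⊣ pR),
    IsIso (mateEquiv hv hp (.mk _ _ _ _ (D.resSquare α))).natTrans)

/-- The slice category `(f/b)`, of pairs `(a, f a ⟶ b)`. -/
abbrev sliceOver {A B : Cat.{w, w}} (f : A ⥤ B) (b : B) : Cat.{w, w} :=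
  Cat.of (CostructuredArrow f b)

/-- The slice category `(b/f)`, of pairs `(a, b ⟶ f a)`. -/
abbrev sliceUnder {A B : Cat.{w, w}} (f : A ⥤ B) (b : B) : Cat.{w, w} :=
  Cat.of (StructuredArrow b f)

/-- The canonical transformation `f p ⟶ b π` of the slice square of `(f/b)`. -/
def sliceOverTrans {A B : Cat.{w, w}} (f : A ⥤ B) (b : B) :
    CostructuredArrow.proj f b ⋙ f ⟶ toPt (sliceOver f b) ⋙ ptAt b where
  app X := X.hom
  naturality _ _ g := (CostructuredArrow.w g).trans (Category.comp_id _).symm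

/-- The canonical transformation `b π ⟶ f q` of the slice square of `(b/f)`. -/
def sliceUnderTrans {A B : Cat.{w, w}} (f : A ⥤ B) (b : B) :
    toPt (sliceUnder f b) ⋙ ptAt b ⟶ StructuredArrow.proj b f ⋙ f where
  app X := X.hom
  naturality _ _ g := (Category.id_comp _).trans (StructuredArrow.w g).symm

/-- (Der1): the canonical functor `𝒟(∐ Aᵢ) ⥤ ∏ 𝒟(Aᵢ)` is an equivalence. -/
def Der1 (D : Prederivator.{w, v, u}) : Prop :=
  ∀ (ι : Type w) (A : ι → Cat.{w, w}),
    (Functor.pi' (fun i => D.res (A := A i) (B := Cat.of (Σ i, A i)) 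
      (Sigma.incl (C := fun i => (A i : Type w)) i))).IsEquivalence

/-- (Der2): isomorphisms of coherent diagrams are detected pointwise. -/
def Der2 (D : Prederivator.{w, v, u}) : Prop :=
  ∀ (A : Cat.{w, w}) (X Y : D.Dia A) (f : X ⟶ Y),
    IsIso f ↔ ∀ a : A, IsIso ((D.eval a).map f)

/-- (Der3): all restriction functors have left and right adjoints (Kan extensions). -/
def Der3 (D : Prederivator.{w, v, u}) : Prop :=
  ∀ (A B : Cat.{w, w}) (f : A ⥤ B), (D.res f).IsRightAdjoint ∧ (D.res f).IsLeftAdjoint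

/-- (Der4): the slice squares are exact. -/
def Der4 (D : Prederivator.{w, v, u}) : Prop :=
  ∀ (A B : Cat.{w, w}) (f : A ⥤ B) (b : B),
    D.IsExactSquare (X := sliceOver f b) (sliceOverTrans f b) ∧
    D.IsExactSquare (X := sliceUnder f b) (sliceUnderTrans f b)

/-- Derivators. -/
structure IsDerivator (D : Prederivator.{w, v, u}) : Prop where
  der1 : D.Der1
  der2 : D.Der2
  der3 : D.Der3
  der4 : D.Der4

/-- `X` lies in the essential image of the left Kan extension along `f`. -/
def EssImLan (D : Prederivator.{w, v, u}) {A B : Cat.{w, w}} (f : A ⥤ B) (X : D.Dia B) : Prop :=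
  ∃ L : D.Dia A ⥤ D.Dia B, Nonempty (L ⊣ D.res f) ∧ L.essImage X

/-- `X` lies in the essential image of the right Kan extension along `f`. -/
def EssImRan (D : Prederivator.{w, v, u}) {A B : Cat.{w, w}} (f : A ⥤ B) (X : D.Dia B) : Prop :=
  ∃ R : D.Dia A ⥤ D.Dia B, Nonempty (D.res f ⊣ R) ∧ R.essImage X

/-- A (possibly infinite) preorder in `Type` as a small category in the universe `w`. -/
abbrev poset (α : Type) [Preorder α] : Cat.{w, w} := Cat.of (AsSmall.{w} α)

/-- The functor between preorders given by a monotone map. -/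
abbrev posetFunctor {α β : Type} [Preorder α] [Preorder β] (f : α →o β) :
    poset.{w} α ⥤ poset.{w} β :=
  AsSmall.down ⋙ f.monotone.functor ⋙ AsSmall.up

/-- The inclusion of the sub-poset of the square `[1] × [1]` without its terminal object. -/
abbrev inclLL : poset.{w} {p : Fin 2 × Fin 2 // p ≠ (1, 1)} ⥤ poset.{w} (Fin 2 × Fin 2) :=
  posetFunctor (OrderHom.Subtype.val _)

/-- The inclusion of the sub-poset of the square `[1] × [1]` without its initial object. -/
abbrev inclUR : poset.{w} {p : Fin 2 × Fin 2 // p ≠ (0, 0)} ⥤ poset.{w} (Fin 2 × Fin 2) :=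
  posetFunctor (OrderHom.Subtype.val _)

/-- Cocartesian squares. -/
def IsCocartesian (D : Prederivator.{w, v, u}) (X : D.Dia (poset.{w} (Fin 2 × Fin 2))) : Prop :=
  D.EssImLan inclLL X

/-- Cartesian squares. -/
def IsCartesian (D : Prederivator.{w, v, u}) (X : D.Dia (poset.{w} (Fin 2 × Fin 2))) : Prop :=
  D.EssImRan inclUR X

/-- Stable derivators: pointed derivators in which cartesian and cocartesian squares coincide. -/
structure IsStableDerivator (D : Prederivator.{w, v, u}) : Prop where
  isDerivator : D.IsDerivator
  pointed : Limits.HasZeroObject (D.Dia pt.{w})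
  cocartesian_iff : ∀ X, D.IsCocartesian X ↔ D.IsCartesian X

/-- A morphism is right exact if it preserves initial objects and pushouts. -/
structure IsRightExact {D E : Prederivator.{w, v, u}} (F : D ⟶ E) : Prop where
  initial : ∀ X : D.Dia pt.{w}, Nonempty (Limits.IsInitial X) →
    Nonempty (Limits.IsInitial ((F.app (op pt.{w})).toFunctor.obj X))
  pushout : ∀ X, D.IsCocartesian X → E.IsCocartesian ((F.app (op _)).toFunctor.obj X)

/-- A morphism is left exact if it preserves terminal objects and pullbacks. -/
structure IsLeftExact {D E : Prederivator.{w, v, u}} (F : D ⟶ E) : Prop where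
  terminal : ∀ X : D.Dia pt.{w}, Nonempty (Limits.IsTerminal X) →
    Nonempty (Limits.IsTerminal ((F.app (op pt.{w})).toFunctor.obj X))
  pullback : ∀ X, D.IsCartesian X → E.IsCartesian ((F.app (op _)).toFunctor.obj X)

/-- Exact morphisms. -/
structure IsExact {D E : Prederivator.{w, v, u}} (F : D ⟶ E) : Prop where
  right : IsRightExact F
  left : IsLeftExact F

lemma IsExact.id (D : Prederivator.{w, v, u}) : IsExact (𝟙 D) where
  right := ⟨fun _ h => h, fun _ h => h⟩
  left := ⟨fun _ h => h, fun _ h => h⟩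

lemma IsExact.comp {D E K : Prederivator.{w, v, u}} {F : D ⟶ E} {G : E ⟶ K} (hF : IsExact F)
    (hG : IsExact G) : IsExact (F ≫ G) where
  right := ⟨fun _ h => hG.right.initial _ (hF.right.initial _ h),
    fun _ h => hG.right.pushout _ (hF.right.pushout _ h)⟩
  left := ⟨fun _ h => hG.left.terminal _ (hF.left.terminal _ h),
    fun _ h => hG.left.pullback _ (hF.left.pullback _ h)⟩

/-- `u` is a homotopical epimorphism: `u^*` is fully faithful for every derivator. -/
def IsHomotopicalEpi {A B : Cat.{w, w}} (f : A ⥤ B) : Prop :=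
  ∀ D : Prederivator.{w, v, u}, D.IsDerivator → (D.res f).Full ∧ (D.res f).Faithful

/-- The shifted prederivator `𝒟^B : A ↦ 𝒟(B × A)`. -/
abbrev shift (B : Cat.{w,w}) (D : Prederivator.{w, v, u}) : Prederivator.{w, v, u} where
  obj A := D.obj (op (Cat.of (B × A.unop)))
  map f := D.map (opHom (prodFun B f.unop.toFunctor))
  map₂ α := D.map₂ (opHom₂ (prodFun₂ B α.unop2.toNatTrans))
  map₂_id f := D.map₂_id _
  map₂_comp α β := by
    rw [← D.map₂_comp]
    exact congrArg (fun x => D.map₂ (opHom₂ x)) (prodFun₂_comp B α.unop2.toNatTrans β.unop2.toNatTrans)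
  mapId A := D.mapId _
  mapComp f g := D.mapComp (opHom (prodFun B f.unop.toFunctor)) (opHom (prodFun B g.unop.toFunctor))
  map₂_whisker_left f _ _ η :=
    D.map₂_whisker_left (opHom (prodFun B f.unop.toFunctor))
      (opHom₂ (prodFun₂ B η.unop2.toNatTrans))
  map₂_whisker_right η h :=
    D.map₂_whisker_right (opHom₂ (prodFun₂ B η.unop2.toNatTrans))
      (opHom (prodFun B h.unop.toFunctor))
  map₂_associator f g h := D.map₂_associator (opHom (prodFun B f.unop.toFunctor)) (opHom (prodFun B g.unop.toFunctor)) (opHom (prodFun B h.unop.toFunctor))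
  map₂_left_unitor f := D.map₂_left_unitor (opHom (prodFun B f.unop.toFunctor))
  map₂_right_unitor f := D.map₂_right_unitor (opHom (prodFun B f.unop.toFunctor))


/-- The morphism `F^B : 𝒟^B ⟶ ℰ^B` induced by `F : 𝒟 ⟶ ℰ`. -/
abbrev shiftMap (B : Cat.{w,w}) {D E : Prederivator.{w, v, u}} (F : D ⟶ E) : shift B D ⟶ shift B E where
  app A := F.app (op (Cat.of (B × A.unop)))
  naturality f := F.naturality (opHom (prodFun B f.unop.toFunctor))
  naturality_naturality α := F.naturality_naturality (opHom₂ (prodFun₂ B α.unop2.toNatTrans))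
  naturality_id A := F.naturality_id (op (Cat.of (B × A.unop)))
  naturality_comp f g := F.naturality_comp (opHom (prodFun B f.unop.toFunctor)) (opHom (prodFun B g.unop.toFunctor))

/-- The modification `F^B ⟶ G^B` induced by a modification `F ⟶ G`. -/
abbrev shiftMap₂ (B : Cat.{w,w}) {D E : Prederivator.{w, v, u}} {F G : D ⟶ E} (θ : F ⟶ G) :
    shiftMap B F ⟶ shiftMap B G where
  as :=
  { app A := θ.as.app (op (Cat.of (B × A.unop)))
    naturality f := θ.as.naturality (opHom (prodFun B f.unop.toFunctor)) }

/-- The restriction morphism `h^* : 𝒟^B ⟶ 𝒟^A` of prederivators along `h : A ⥤ B`; its component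
at `I` is restriction along `h × id_I`. -/
def shiftRes {A B : Cat.{w,w}} (h : A ⥤ B) (D : Prederivator.{w, v, u}) : shift B D ⟶ shift A D where
  app I := D.map (opHom (A := Cat.of (A × I.unop)) (B := Cat.of (B × I.unop)) (h.prod (𝟭 I.unop)))
  naturality {I J} f :=
    Cat.Hom.isoMk
      ((D.resComp (A := Cat.of (A × J.unop)) (B := Cat.of (B × J.unop)) (C := Cat.of (B × I.unop))
        (h.prod (𝟭 J.unop)) (prodFun B f.unop.toFunctor)).symm ≪≫
      D.resComp (A := Cat.of (A × J.unop)) (B := Cat.of (A × I.unop)) (C := Cat.of (B × I.unop))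
        (prodFun A f.unop.toFunctor) (h.prod (𝟭 I.unop)))
  naturality_naturality {I J f g} α := by
    ext X
    have e : Functor.whiskerLeft (h.prod (𝟭 J.unop)) (prodFun₂ B α.unop2.toNatTrans) =
        Functor.whiskerRight (prodFun₂ A α.unop2.toNatTrans) (h.prod (𝟭 I.unop)) :=
      NatTrans.ext (funext fun x => Prod.ext (h.map_id x.1).symm rfl)
    have h₁ := D.resComp_natRight (A := Cat.of (A × J.unop)) (h.prod (𝟭 J.unop))
      (prodFun₂ B α.unop2.toNatTrans) X
    have h₂ := D.resComp_natLeft (C := Cat.of (B × I.unop)) (prodFun₂ A α.unop2.toNatTrans)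
      (h.prod (𝟭 I.unop)) X
    have h₃ := congrArg (fun t => (D.resTrans (A := Cat.of (A × J.unop))
      (B := Cat.of (B × I.unop)) t).app X ≫ (D.resComp (A := Cat.of (A × J.unop))
      (C := Cat.of (B × I.unop)) (prodFun A g.unop.toFunctor) (h.prod (𝟭 I.unop))).hom.app X) e
    exact aux_natural ((D.resComp _ _).app X) ((D.resComp _ _).app X) h₁ (h₃.trans h₂)
  naturality_id I := by
    ext X
    exact aux_id ((D.resComp _ _).app X)
      ((D.res (A := Cat.of (A × I.unop)) (B := Cat.of (B × I.unop)) (h.prod (𝟭 I.unop))).mapIso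
        ((D.resId _).app X))
      ((D.resId _).app _)
      (D.resComp_id_right (A := Cat.of (A × I.unop)) (B := Cat.of (B × I.unop))
        (h.prod (𝟭 I.unop)) X)
      (D.resComp_id_left (A := Cat.of (A × I.unop)) (B := Cat.of (B × I.unop))
        (h.prod (𝟭 I.unop)) X)
  naturality_comp {I J K} f g := by
    ext X
    exact aux_comp
      ((D.resComp (A := Cat.of (A × K.unop)) (B := Cat.of (B × J.unop)) (C := Cat.of (B × I.unop))
        ((h.prod (𝟭 K.unop)) ⋙ prodFun B g.unop.toFunctor) (prodFun B f.unop.toFunctor)).app X)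
      ((D.resComp (A := Cat.of (A × K.unop)) (B := Cat.of (B × K.unop)) (C := Cat.of (B × J.unop))
        (h.prod (𝟭 K.unop)) (prodFun B g.unop.toFunctor)).app _)
      ((D.resComp (A := Cat.of (A × K.unop)) (B := Cat.of (B × K.unop)) (C := Cat.of (B × I.unop))
        (h.prod (𝟭 K.unop)) (prodFun B g.unop.toFunctor ⋙ prodFun B f.unop.toFunctor)).app X)
      ((D.resComp (A := Cat.of (A × K.unop)) (B := Cat.of (A × J.unop)) (C := Cat.of (B × I.unop))
        (prodFun A g.unop.toFunctor) (h.prod (𝟭 J.unop) ⋙ prodFun B f.unop.toFunctor)).app X)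
      ((D.res (prodFun A g.unop.toFunctor)).mapIso
        ((D.resComp (A := Cat.of (A × J.unop)) (B := Cat.of (B × J.unop))
          (C := Cat.of (B × I.unop)) (h.prod (𝟭 J.unop)) (prodFun B f.unop.toFunctor)).app X))
      (D.resComp_assoc (A := Cat.of (A × K.unop)) (B := Cat.of (B × K.unop))
        (h.prod (𝟭 K.unop)) (prodFun B g.unop.toFunctor) (prodFun B f.unop.toFunctor) X)
      (D.resComp_assoc (prodFun A g.unop.toFunctor) (C := Cat.of (B × J.unop))
        (h.prod (𝟭 J.unop)) (prodFun B f.unop.toFunctor) X)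
      (D.resComp_assoc (prodFun A g.unop.toFunctor) (prodFun A f.unop.toFunctor)
        (E := Cat.of (B × I.unop)) (h.prod (𝟭 I.unop)) X)
      (CategoryTheory.Functor.map_comp _ _ _)

/-- A full subprederivator of `𝒟`: full subcategories `𝒟'(A) ⊆ 𝒟(A)`, closed under restriction. -/
structure FullSub (D : Prederivator.{w, v, u}) where
  prop (A : Cat.{w, w}) : ObjectProperty (D.Dia A)
  res_mem {A B : Cat.{w, w}} (f : A ⥤ B) (X : D.Dia B) (hX : prop B X) :
    prop A ((D.res f).obj X)

namespace FullSub
variable {D : Prederivator.{w, v, u}} (P : FullSub D)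

/-- The restriction functor `𝒟'(B) ⥤ 𝒟'(A)`. -/
abbrev resFunctor {A B : Cat.{w, w}} (f : A ⥤ B) :
    (P.prop B).FullSubcategory ⥤ (P.prop A).FullSubcategory :=
  (P.prop A).lift ((P.prop B).ι ⋙ D.res f) (fun X => P.res_mem f _ X.property)

/-- The prederivator underlying a full subprederivator. -/
abbrev toPre : Prederivator.{w, v, u} where
  obj A := Cat.of (P.prop A.unop).FullSubcategory
  map f := (P.resFunctor f.unop.toFunctor).toCatHom
  map₂ α := NatTrans.toCatHom₂
    { app X := ObjectProperty.homMk ((D.resTrans α.unop2.toNatTrans).app X.obj)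
      naturality X Y g := by
        ext
        exact (D.resTrans α.unop2.toNatTrans).naturality g.hom }
  map₂_id f := by
    ext X
    exact ObjectProperty.hom_ext _ (congrArg (fun t => t.toNatTrans.app X.obj) (D.map₂_id f))
  map₂_comp α β := by
    ext X
    exact ObjectProperty.hom_ext _ (congrArg (fun t => t.toNatTrans.app X.obj) (D.map₂_comp α β))
  mapId A := Cat.Hom.isoMk (NatIso.ofComponents (fun X => ObjectProperty.isoMk _
    ((Cat.Hom.toNatIso (D.mapId A)).app X.obj)) (fun g => by
      ext; exact (D.mapId A).hom.toNatTrans.naturality g.hom))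
  mapComp f g := Cat.Hom.isoMk (NatIso.ofComponents (fun X => ObjectProperty.isoMk _
    ((Cat.Hom.toNatIso (D.mapComp f g)).app X.obj)) (fun h => by
      ext; exact (D.mapComp f g).hom.toNatTrans.naturality h.hom))
  map₂_whisker_left f _ _ η := by
    ext X
    exact ObjectProperty.hom_ext _ (congrArg (fun t => t.toNatTrans.app X.obj) (D.map₂_whisker_left f η))
  map₂_whisker_right η h := by
    ext X
    exact ObjectProperty.hom_ext _ (congrArg (fun t => t.toNatTrans.app X.obj) (D.map₂_whisker_right η h))
  map₂_associator f g h := by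
    ext X
    exact ObjectProperty.hom_ext _ (congrArg (fun t => t.toNatTrans.app X.obj) (D.map₂_associator f g h))
  map₂_left_unitor f := by
    ext X
    exact ObjectProperty.hom_ext _ (congrArg (fun t => t.toNatTrans.app X.obj) (D.map₂_left_unitor f))
  map₂_right_unitor f := by
    ext X
    exact ObjectProperty.hom_ext _ (congrArg (fun t => t.toNatTrans.app X.obj) (D.map₂_right_unitor f))

/-- The inclusion of a full subprederivator, as a morphism of prederivators. -/
abbrev incl : P.toPre ⟶ D where
  app A := Cat.Hom.ofFunctor (P.prop A.unop).ι
  naturality f := Cat.Hom.isoMk (Iso.refl (P.resFunctor f.unop.toFunctor ⋙ (P.prop _).ι))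
  naturality_naturality α := by
    ext X; exact (Category.comp_id _).trans (Category.id_comp _).symm
  naturality_id A := by
    ext X
    exact (Category.id_comp _).trans
      ((congrArg _ (Category.comp_id _)).trans (Category.comp_id _)).symm
  naturality_comp f g := by
    ext X
    have h : (D.map g).toFunctor.map (𝟙 ((D.map f).toFunctor.obj X.obj)) = 𝟙 _ :=
      CategoryTheory.Functor.map_id _ _
    exact aux_six ((D.mapComp f g).hom.toNatTrans.app X.obj) h

variable {E : Prederivator.{w, v, u}} {P} {Q : FullSub E}

/-- A morphism `F : 𝒟 ⟶ ℰ` which maps `𝒟'` into `ℰ'` restricts to `𝒟' ⟶ ℰ'`. -/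
abbrev mapOfMem (F : D ⟶ E) (h : ∀ A X, P.prop A X → Q.prop A ((F.app (op A)).toFunctor.obj X)) :
    P.toPre ⟶ Q.toPre where
  app A := Cat.Hom.ofFunctor ((Q.prop A.unop).lift ((P.prop A.unop).ι ⋙ (F.app A).toFunctor) (fun X => h _ _ X.property))
  naturality {A B} f := Cat.Hom.isoMk (NatIso.ofComponents (fun X => ObjectProperty.isoMk _
    ((Cat.Hom.toNatIso (F.naturality f)).app X.obj)) (fun g => by
      apply ObjectProperty.hom_ext; exact (F.naturality f).hom.toNatTrans.naturality g.hom))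
  naturality_naturality α := by
    ext X
    exact ObjectProperty.hom_ext _ (congrArg (fun t => t.toNatTrans.app X.obj) (F.naturality_naturality α))
  naturality_id A := by
    ext X
    exact ObjectProperty.hom_ext _ (congrArg (fun t => t.toNatTrans.app X.obj) (F.naturality_id A))
  naturality_comp f g := by
    ext X
    exact ObjectProperty.hom_ext _ (congrArg (fun t => t.toNatTrans.app X.obj) (F.naturality_comp f g))

/-- The restriction of a modification to full subprederivators. -/
abbrev map₂OfMem {F G : D ⟶ E} (hF : ∀ A X, P.prop A X → Q.prop A ((F.app (op A)).toFunctor.obj X))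
   (hG : ∀ A X, P.prop A X → Q.prop A ((G.app (op A)).toFunctor.obj X)) (θ : F ⟶ G) :
    mapOfMem F hF ⟶ mapOfMem G hG where
  as :=
  { app A := NatTrans.toCatHom₂
     { app X := ObjectProperty.homMk ((θ.as.app A).toNatTrans.app X.obj)
       naturality X Y g := by
        ext
        exact (θ.as.app A).toNatTrans.naturality g.hom }
    naturality f := by
      ext X
      exact ObjectProperty.hom_ext _ (congrArg (fun t => t.toNatTrans.app X.obj) (θ.as.naturality f)) }
end FullSub

namespace FullSub
variable {D : Prederivator.{w, v, u}} (P : FullSub D)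

/-- `𝒟'` is a strict full subderivator of `𝒟`: it satisfies (Der1) and (Der3), and the left and
right Kan extensions of `𝒟'` are those of `𝒟`, i.e. the canonical comparison transformations
`f_! ∘ incl ⟶ incl ∘ f'_!` and `incl ∘ f'_* ⟶ f_* ∘ incl` are isomorphisms. -/
structure IsStrict : Prop where
  der1 : P.toPre.Der1
  der3 : P.toPre.Der3
  lan : ∀ (A B : Cat.{w, w}) (f : A ⥤ B) (L : D.Dia A ⥤ D.Dia B) (adj : L ⊣ D.res f)
    (L' : (P.prop A).FullSubcategory ⥤ (P.prop B).FullSubcategory) (adj' : L' ⊣ P.resFunctor f),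
    IsIso ((mateEquiv adj' adj).symm
      (.mk _ (P.prop B).ι (P.prop A).ι _ (𝟙 ((P.prop B).ι ⋙ D.res f)))).natTrans
  ran : ∀ (A B : Cat.{w, w}) (f : A ⥤ B) (R : D.Dia A ⥤ D.Dia B) (adj : D.res f ⊣ R)
    (R' : (P.prop A).FullSubcategory ⥤ (P.prop B).FullSubcategory) (adj' : P.resFunctor f ⊣ R'),
    IsIso (mateEquiv adj' adj
      (.mk (P.prop B).ι _ _ (P.prop A).ι (𝟙 ((P.prop B).ι ⋙ D.res f)))).natTrans

end FullSub

/-! ### Vanishing conditions -/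

/-- The isomorphism `f^* ≅ g^*` induced by `f ≅ g`. -/
abbrev resIso (D : Prederivator.{w, v, u}) {A B : Cat.{w, w}} {f g : A ⥤ B} (e : f ≅ g) :
    D.res f ≅ D.res g :=
  Cat.Hom.toNatIso (D.map₂Iso (f := opHom f) (g := opHom g)
    { hom := opHom₂ e.hom
      inv := opHom₂ e.inv
      hom_inv_id := congrArg opHom₂ e.hom_inv_id
      inv_hom_id := congrArg opHom₂ e.inv_hom_id })

/-- The identity, as an isomorphism between two descriptions of the functor `(b, f a)`. -/
abbrev ptAtProdIso {A A' B : Cat.{w, w}} (f : A ⥤ A') (b : B) (a : A) :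
    ptAt (A := Cat.of (B × A)) (b, a) ⋙ prodFun B f ≅ ptAt (A := Cat.of (B × A')) (b, f.obj a) :=
  NatIso.ofComponents (fun _ => Iso.refl (C := B × A') (b, f.obj a)) (fun g =>
    aux_square (C := B × A') (x := (ptAt (A := Cat.of (B × A)) (b, a) ⋙ prodFun B f).map g)
      (Prod.ext rfl (f.map_id a)))

/-- The full subprederivator of `𝒟^B` of the diagrams which vanish at the objects in `S`: those
`X ∈ 𝒟(B × A)` such that `X_{(b, a)}` is a zero object for all `b ∈ S` and all `a`. -/
abbrev vanishing (B : Cat.{w, w}) (S : Set B) (D : Prederivator.{w, v, u}) :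
    FullSub (shift B D) where
  prop A X := ∀ b ∈ S, ∀ a : A, Limits.IsZero ((D.eval (A := Cat.of (B × A)) (b, a)).obj X)
  res_mem {A A'} f X hX b hb a := by
    refine (hX b hb (f.obj a)).of_iso ?_
    exact ((D.resComp (ptAt (A := Cat.of (B × A)) (b, a)) (prodFun B f)).symm.app X).trans
      ((D.resIso (f := ptAt (A := Cat.of (B × A)) (b, a) ⋙ prodFun B f)
        (g := ptAt (A := Cat.of (B × A')) (b, f.obj a))
        (ptAtProdIso f b a)).app X)

lemma vanishing_map {D E : Prederivator.{w, v, u}} {F : D ⟶ E} (hF : IsRightExact F)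
    (hE : Limits.HasZeroObject (E.Dia pt.{w})) (B : Cat.{w, w}) (S : Set B) (A : Cat.{w, w})
    (X : (shift B D).Dia A) (hX : (vanishing B S D).prop A X) :
    (vanishing B S E).prop A (((shiftMap B F).app (op A)).toFunctor.obj X) := by
  intro b hb a
  have h := hX b hb a
  obtain ⟨Z, hZ⟩ := hE
  obtain ⟨i⟩ := hF.initial _ ⟨h.isInitial⟩
  refine (hZ.of_iso (i.uniqueUpToIso hZ.isInitial)).of_iso ?_
  exact ((Cat.Hom.toNatIso (F.naturality (opHom (ptAt (A := Cat.of (B × A)) (b, a))))).app X).symm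


end Prederivator

open Prederivator

set_option linter.checkUnivs false in
/-- A stable derivator. -/
structure StableDerivator where
  toPre : Prederivator.{w, v, u}
  isStable : toPre.IsStableDerivator

namespace StableDerivator

/-- An exact morphism of stable derivators. -/
structure ExactHom (D E : StableDerivator.{w, v, u}) where
  mor : D.toPre ⟶ E.toPre
  isExact : IsExact mor

instance : CategoryStruct StableDerivator.{w, v, u} where
  Hom D E := ExactHom D E
  id D := ⟨𝟙 D.toPre, IsExact.id _⟩
  comp F G := ⟨F.mor ≫ G.mor, F.isExact.comp G.isExact⟩

instance (D E : StableDerivator.{w, v, u}) : Category (D ⟶ E) where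
  Hom F G := F.mor ⟶ G.mor
  id F := 𝟙 F.mor
  comp θ κ := CategoryStruct.comp (obj := D.toPre ⟶ E.toPre) θ κ
  id_comp θ := Category.id_comp (obj := D.toPre ⟶ E.toPre) θ
  comp_id θ := Category.comp_id (obj := D.toPre ⟶ E.toPre) θ
  assoc θ κ μ := Category.assoc (obj := D.toPre ⟶ E.toPre) θ κ μ

/-- Isomorphisms between exact morphisms are isomorphisms of the underlying morphisms. -/
abbrev mkIso {D E : StableDerivator.{w, v, u}} {F G : D ⟶ E} (e : F.mor ≅ G.mor) : F ≅ G where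
  hom := e.hom
  inv := e.inv
  hom_inv_id := e.hom_inv_id
  inv_hom_id := e.inv_hom_id

/-- The 2-category of stable derivators, exact morphisms and modifications. -/
instance : Bicategory StableDerivator.{w, v, u} where
  homCategory := inferInstance
  whiskerLeft F _ _ θ := Bicategory.whiskerLeft (B := Prederivator.{w, v, u}) F.mor θ
  whiskerRight θ F := Bicategory.whiskerRight (B := Prederivator.{w, v, u}) θ F.mor
  associator F G H := mkIso (Bicategory.associator F.mor G.mor H.mor)
  leftUnitor F := mkIso (Bicategory.leftUnitor F.mor)
  rightUnitor F := mkIso (Bicategory.rightUnitor F.mor)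
  whiskerLeft_id F G := Bicategory.whiskerLeft_id F.mor G.mor
  whiskerLeft_comp F _ _ _ θ κ :=
    Bicategory.whiskerLeft_comp (B := Prederivator.{w, v, u}) F.mor θ κ
  id_whiskerLeft θ := Bicategory.id_whiskerLeft (B := Prederivator.{w, v, u}) θ
  comp_whiskerLeft F G _ _ θ :=
    Bicategory.comp_whiskerLeft (B := Prederivator.{w, v, u}) F.mor G.mor θ
  id_whiskerRight F G := Bicategory.id_whiskerRight F.mor G.mor
  comp_whiskerRight θ κ F :=
    Bicategory.comp_whiskerRight (B := Prederivator.{w, v, u}) θ κ F.mor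
  whiskerRight_id θ := Bicategory.whiskerRight_id (B := Prederivator.{w, v, u}) θ
  whiskerRight_comp θ F G :=
    Bicategory.whiskerRight_comp (B := Prederivator.{w, v, u}) θ F.mor G.mor
  whisker_assoc F _ _ θ G :=
    Bicategory.whisker_assoc (B := Prederivator.{w, v, u}) F.mor θ G.mor
  whisker_exchange θ κ := Bicategory.whisker_exchange (B := Prederivator.{w, v, u}) θ κ
  pentagon F G H K := Bicategory.pentagon F.mor G.mor H.mor K.mor
  triangle F G := Bicategory.triangle F.mor G.mor

/-- The 2-functor `𝒟 ↦ 𝒟^B` on stable derivators and exact morphisms. -/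
abbrev shiftFunctor (B : Cat.{w, w}) :
    Pseudofunctor StableDerivator.{w, v, u} Prederivator.{w, v, u} where
  obj D := shift B D.toPre
  map F := shiftMap B F.mor
  map₂ θ := shiftMap₂ B θ
  mapId D := Iso.refl (shiftMap B (𝟙 D.toPre))
  mapComp F G := Iso.refl (shiftMap B (F.mor ≫ G.mor))
  map₂_id _ := rfl
  map₂_comp _ _ := rfl
  map₂_whisker_left _ _ _ _ := aux_whisker rfl
  map₂_whisker_right _ _ := aux_whisker rfl
  map₂_associator F G H := aux_associator (shiftMap B F.mor) (shiftMap B G.mor) (shiftMap B H.mor) rfl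
  map₂_left_unitor F := aux_leftUnitor (shiftMap B F.mor) rfl
  map₂_right_unitor F := aux_rightUnitor (shiftMap B F.mor) rfl

/-- The restriction of `F^B : 𝒟^B ⟶ ℰ^B` to the diagrams which vanish at the objects in `S`. -/
abbrev vanishingMap (B : Cat.{w, w}) (S : Set B) {D E : StableDerivator.{w, v, u}} (F : D ⟶ E) :
    (vanishing B S D.toPre).toPre ⟶ (vanishing B S E.toPre).toPre :=
  FullSub.mapOfMem (shiftMap B F.mor) (vanishing_map F.isExact.right E.isStable.pointed B S)

/-- The restriction of a modification `F^B ⟶ G^B` to the diagrams which vanish at the objects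
in `S`. -/
abbrev vanishingMap₂ (B : Cat.{w, w}) (S : Set B) {D E : StableDerivator.{w, v, u}} {F G : D ⟶ E}
    (θ : F ⟶ G) : vanishingMap B S F ⟶ vanishingMap B S G :=
  FullSub.map₂OfMem (vanishing_map F.isExact.right E.isStable.pointed B S)
    (vanishing_map G.isExact.right E.isStable.pointed B S) (shiftMap₂ B θ)

/-- The canonical isomorphism (an identity) for composites. -/
abbrev vanishingMapComp (B : Cat.{w, w}) (S : Set B) {D E K : StableDerivator.{w, v, u}}
    (F : D ⟶ E) (G : E ⟶ K) :
    vanishingMap B S (F ≫ G) ≅ vanishingMap B S F ≫ vanishingMap B S G :=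
  Iso.refl _

lemma vanishingMap₂_whiskerLeft (B : Cat.{w, w}) (S : Set B) {D E K : StableDerivator.{w, v, u}}
    (F : D ⟶ E) {G H : E ⟶ K} (θ : G ⟶ H) : vanishingMap₂ B S (F ◁ θ) =
      (vanishingMapComp B S F G).hom ≫ vanishingMap B S F ◁ vanishingMap₂ B S θ ≫
        (vanishingMapComp B S F H).inv :=
  by ext A X; exact ObjectProperty.hom_ext _ (aux_whisker rfl)
lemma vanishingMap₂_whiskerRight (B : Cat.{w, w}) (S : Set B) {D E K : StableDerivator.{w, v, u}}
    {F G : D ⟶ E}  (θ : F ⟶ G) (H : E ⟶ K) : vanishingMap₂ B S (θ ▷ H) =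
      (vanishingMapComp B S F H).hom ≫ vanishingMap₂ B S θ ▷ vanishingMap B S H ≫
        (vanishingMapComp B S G H).inv :=
  by ext A X; exact ObjectProperty.hom_ext _ (aux_whisker rfl)
lemma vanishingMap₂_assoc (B : Cat.{w, w}) (S : Set B) {D E K L : StableDerivator.{w, v, u}}
    (F : D ⟶ E) (G : E ⟶ K) (H : K ⟶ L) : vanishingMap₂ B S (α_ F G H).hom =
      (vanishingMapComp B S (F ≫ G) H).hom ≫
        (vanishingMapComp B S F G).hom ▷ vanishingMap B S H ≫
          (α_ (vanishingMap B S F) (vanishingMap B S G) (vanishingMap B S H)).hom ≫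
            vanishingMap B S F ◁ (vanishingMapComp B S G H).inv ≫
              (vanishingMapComp B S F (G ≫ H)).inv :=
  by
  ext A X
  exact ObjectProperty.hom_ext _ (aux_five
    (CategoryTheory.Functor.map_id ((shiftMap B H.mor).app A).toFunctor _))
lemma vanishingMap₂_lu (B : Cat.{w, w}) (S : Set B) {D E : StableDerivator.{w, v, u}} (F : D ⟶ E) :
    vanishingMap₂ B S (λ_ F).hom = (vanishingMapComp B S (𝟙 D) F).hom ≫
      𝟙 (𝟙 (vanishing B S D.toPre).toPre) ▷ vanishingMap B S F ≫ (λ_ (vanishingMap B S F)).hom :=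
  by
  ext A X
  exact ObjectProperty.hom_ext _ (aux_three
    (CategoryTheory.Functor.map_id ((shiftMap B F.mor).app A).toFunctor _))
lemma vanishingMap₂_ru (B : Cat.{w, w}) (S : Set B) {D E : StableDerivator.{w, v, u}} (F : D ⟶ E) :
    vanishingMap₂ B S (ρ_ F).hom = (vanishingMapComp B S F (𝟙 E)).hom ≫
      vanishingMap B S F ◁ 𝟙 (𝟙 (vanishing B S E.toPre).toPre) ≫ (ρ_ (vanishingMap B S F)).hom :=
  by
  ext A X
  exact ObjectProperty.hom_ext _ (aux_three rfl)

/-- The 2-functor on stable derivators and exact morphisms which sends `𝒟` to the full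
subprederivator of `𝒟^B` of the diagrams which vanish at the objects in `S`. -/
abbrev vanishingFunctor (B : Cat.{w, w}) (S : Set B) :
    Pseudofunctor StableDerivator.{w, v, u} Prederivator.{w, v, u} where
  obj D := (vanishing B S D.toPre).toPre
  map F := vanishingMap B S F
  map₂ θ := vanishingMap₂ B S θ
  mapId D := Iso.refl (𝟙 (vanishing B S D.toPre).toPre)
  mapComp F G := vanishingMapComp B S F G
  map₂_id _ := rfl
  map₂_comp _ _ := rfl
  map₂_whisker_left F _ _ θ := vanishingMap₂_whiskerLeft B S F θ
  map₂_whisker_right θ F := vanishingMap₂_whiskerRight B S θ F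
  map₂_associator F G H := vanishingMap₂_assoc B S F G H
  map₂_left_unitor F := vanishingMap₂_lu B S F
  map₂_right_unitor F := vanishingMap₂_ru B S F

end StableDerivator

/-! ### Composites of restrictions and Kan extensions -/

/-- A restriction, a left Kan extension or a right Kan extension along a functor, regarded as an
operation which turns diagrams of shape `A` into diagrams of shape `B`. -/
inductive KanStep : Cat.{w, w} → Cat.{w, w} → Type (w + 1)
  | restr {A B : Cat.{w, w}} (f : B ⥤ A) : KanStep A B
  | lan {A B : Cat.{w, w}} (f : A ⥤ B) : KanStep A B
  | ran {A B : Cat.{w, w}} (f : A ⥤ B) : KanStep A B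

/-- `F : 𝒟^A ⟶ 𝒟^B` is the restriction along `f`, resp. a left adjoint of it, resp. a right
adjoint of it. -/
def KanStep.IsRealizedBy (D : Prederivator.{w, v, u}) :
    {A B : Cat.{w, w}} → KanStep A B → (shift A D ⟶ shift B D) → Prop
  | _, _, .restr f, F => Nonempty (F ≅ shiftRes f D)
  | _, _, .lan f, F => Nonempty (Bicategory.Adjunction F (shiftRes f D))
  | _, _, .ran f, F => Nonempty (Bicategory.Adjunction (shiftRes f D) F)

/-- The functor along which one restricts or extends is fully faithful or a homotopical
epimorphism. -/
def KanStep.Admissible : {A B : Cat.{w, w}} → KanStep A B → Prop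
  | _, _, .restr f => (f.Full ∧ f.Faithful) ∨ IsHomotopicalEpi.{w, v, u} f
  | _, _, .lan f => (f.Full ∧ f.Faithful) ∨ IsHomotopicalEpi.{w, v, u} f
  | _, _, .ran f => (f.Full ∧ f.Faithful) ∨ IsHomotopicalEpi.{w, v, u} f

/-- A finite sequence of composable restrictions and Kan extensions. -/
inductive KanWord : Cat.{w, w} → Cat.{w, w} → Type (w + 1)
  | nil (A : Cat.{w, w}) : KanWord A A
  | cons {A B C : Cat.{w, w}} (s : KanStep A B) (t : KanWord B C) : KanWord A C

/-- `F : 𝒟^A ⟶ 𝒟^B` is the composite of the given sequence of restrictions and Kan extensions. -/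
def KanWord.IsRealizedBy (D : Prederivator.{w, v, u}) :
    {A B : Cat.{w, w}} → KanWord A B → (shift A D ⟶ shift B D) → Prop
  | _, _, .nil A, F => Nonempty (F ≅ 𝟙 (shift A D))
  | _, _, .cons (A := A) (B := B) (C := C) s t, F =>
      ∃ (G : shift A D ⟶ shift B D) (H : shift B D ⟶ shift C D),
        s.IsRealizedBy D G ∧ t.IsRealizedBy D H ∧ Nonempty (F ≅ G ≫ H)

/-- All functors along which one restricts or extends are fully faithful or homotopical
epimorphisms. -/
def KanWord.Admissible : {A B : Cat.{w, w}} → KanWord A B → Prop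
  | _, _, .nil _ => True
  | _, _, .cons s t => KanStep.Admissible.{w, v, u} s ∧ t.Admissible

/-! ### The shapes `Ã(n,2)` and `A_n` -/

/-- The elements of `Ã(n,2)`: `(0, 0)`, `(n - 2, n - 2)`, and `(i, i + 1)`, `(i + 1, i)` for
`0 ≤ i ≤ n - 3`. -/
def InATilde (n : ℕ) (p : ℕ × ℕ) : Prop :=
  p = (0, 0) ∨ (p.1 + 2 = n ∧ p.2 + 2 = n) ∨ ∃ i, i + 3 ≤ n ∧ (p = (i, i + 1) ∨ p = (i + 1, i))

/-- The poset `Ã(n,2)` (with the order induced by the product order), as a small category. -/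
abbrev aTilde (n : ℕ) : Cat.{w, w} := poset.{w} {p : ℕ × ℕ // InATilde n p}

/-- The positions `(i, i + 1)` of `Ã(n,2)`. -/
def aTildeZeros (n : ℕ) : Set (aTilde.{w} n) := {x | ∃ i : ℕ, (AsSmall.down.obj x).1 = (i, i + 1)}

/-- The free category on the linearly oriented quiver `A_n`, i.e. the poset `0 < ⋯ < n - 1`. -/
abbrev aLin (n : ℕ) : Cat.{w, w} := poset.{w} (Fin n)

/-- The full subprederivator `𝒟^{A(n,2)}` of `𝒟^{Ã(n,2)}` of the diagrams which vanish at the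
positions `(i, i + 1)`. -/
abbrev aTwo (n : ℕ) (D : Prederivator.{w, v, u}) : FullSub (shift (aTilde.{w} n) D) :=
  vanishing (aTilde n) (aTildeZeros n) D

/-- The 2-functor `𝒟 ↦ 𝒟^{A(n,2)}` on stable derivators and exact morphisms. -/
abbrev aTwoFunctor (n : ℕ) : Pseudofunctor StableDerivator.{w, v, u} Prederivator.{w, v, u} :=
  StableDerivator.vanishingFunctor (aTilde n) (aTildeZeros n)

/-- The 2-functor `𝒟 ↦ 𝒟^{A_n}` on stable derivators and exact morphisms. -/
abbrev aLinFunctor (n : ℕ) : Pseudofunctor StableDerivator.{w, v, u} Prederivator.{w, v, u} :=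
  StableDerivator.shiftFunctor (aLin n)

/-- The component `i^n : 𝒟^{A(n,2)} ⟶ 𝒟^{A_n}` at `𝒟` of an equivalence of 2-functors. -/
abbrev iComp {n : ℕ}
    (e : Bicategory.Equivalence (aTwoFunctor.{w, v, u} n) (aLinFunctor.{w, v, u} n))
    (D : StableDerivator.{w, v, u}) : (aTwo n D.toPre).toPre ⟶ shift (aLin n) D.toPre :=
  e.hom.app D

/-- The component `G^n : 𝒟^{A_n} ⟶ 𝒟^{A(n,2)}` at `𝒟` of an equivalence of 2-functors. -/
abbrev gComp {n : ℕ}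
    (e : Bicategory.Equivalence (aTwoFunctor.{w, v, u} n) (aLinFunctor.{w, v, u} n))
    (D : StableDerivator.{w, v, u}) : shift (aLin n) D.toPre ⟶ (aTwo n D.toPre).toPre :=
  e.inv.app D

/-! A diagram of shape `Ã(n,2)` with the prescribed zeros is a string x_0 → x_1 → … → x_{n-1} in
which every composite x_i → x_{i+2} is made to factor through a zero object. These null-homotopies
are removed one at a time. At stage m the zeros over x_0, …, x_{m-1} are gone. The first remaining
zero receives x_0, …, x_m and maps to x_{m+2}. Factoring x_m → x_{m+1} → x_{m+2} through it amounts
to a map from the cofibre of x_m → x_{m+1} to x_{m+2}. Write C_c for the cofibre of x_c → x_{m+1}.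
Replacing x_0 → … → x_{m+1} by x_{m+1} → C_0 → … → C_m gives a string of the same length, now
followed by C_m → x_{m+2}, and the next zero receives C_m and takes over the role of the first one.
No information is lost: in a stable derivator the cofibre squares are also cartesian, so x_c is the
fibre of x_{m+1} → C_c. After n - 2 stages no zero is left and the shape is A_n.

One stage is a zigzag of full inclusions of posets. The missing zeros are inserted by a right Kan
extension (`wordEquiv_of_isLeast`). The cofibres are added by a left Kan extension
(`wordEquiv_of_isCocartesian`). The objects x_0, …, x_m are dropped, which is inverse to a right Kan
extension (`wordEquiv_of_isCartesian`, the place where stability enters). Finally the zeros are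
dropped, which is inverse to a left Kan extension (`wordEquiv_of_forall_not_le`). Every functor that
occurs is fully faithful.

A Kan extension along a fully faithful functor is an equivalence onto its essential image
(`wordEquiv_of_lan`, `wordEquiv_of_ran`). Restriction commutes with every morphism of prederivators,
and a pseudonatural transformation whose components are equivalences is an equivalence
(`equivOfApp`). Naturality in the derivator therefore only requires that exact morphisms preserve
the conditions involved: vanishing at given positions and cocartesianness of given squares.

Kan extensions are handled through universal arrows X → f^* T instead of chosen adjoints. A mate is
invertible iff universal arrows are preserved (`isIso_mate_iff`). The coherence isomorphisms of the
prederivator are absorbed by formal restrictions `St`, on which restriction is strictly functorial.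
By (Der2) and (Der4) universality can be tested pointwise (`isUniv_iff_isUnivAt`), and the slices
may be replaced by small final or initial parts (`IsFinalAt`, `IsInitialAt`). For posets this leaves
inequalities between natural numbers.

For the statements about subderivators, vanishing at b is tested separately for each b, and so are
Kan extensions along id × f. The vanishing diagrams are therefore closed under all Kan extensions
(`IsClosed`) and inherit the structure of the shifted derivator. -/

namespace CategoryTheory.Bicategory

universe w₁ w₂ v₁ v₂ u₁ u₂

/-! ### Mates and adjoint equivalences in a bicategory -/

section Mates

variable {B : Type u₁} [Bicategory.{w₁, v₁} B]
variable {c d e f : B} {g g' : c ⟶ e} {h h' : d ⟶ f} {l₁ : c ⟶ d} {r₁ : d ⟶ c} {l₂ : e ⟶ f}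
  {r₂ : f ⟶ e} (adj₁ : Bicategory.Adjunction l₁ r₁) (adj₂ : Bicategory.Adjunction l₂ r₂)

/-- By the interchange law the unit of `adj₂` slides past `a`. Together with the dual statement
below, this carries the naturality equations of a transformation through `mateEquiv`. -/
lemma mateEquiv_whiskerRight_comp (a : g ⟶ g') (φ : g' ≫ l₂ ⟶ l₁ ≫ h) :
    mateEquiv adj₁ adj₂ (a ▷ l₂ ≫ φ) = r₁ ◁ a ≫ mateEquiv adj₁ adj₂ φ := by
  rw [mateEquiv_apply', mateEquiv_apply']
  calc
    _ = 𝟙 _ ⊗≫ r₁ ◁ (g ◁ adj₂.unit ≫ a ▷ (l₂ ≫ r₂)) ⊗≫ r₁ ◁ φ ▷ r₂ ⊗≫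
        adj₁.counit ▷ h ▷ r₂ ⊗≫ 𝟙 _ := by bicategory
    _ = _ := by rw [whisker_exchange]; bicategory

lemma mateEquiv_comp_whiskerLeft (φ : g ≫ l₂ ⟶ l₁ ≫ h) (b : h ⟶ h') :
    mateEquiv adj₁ adj₂ (φ ≫ l₁ ◁ b) = mateEquiv adj₁ adj₂ φ ≫ b ▷ r₂ := by
  rw [mateEquiv_apply', mateEquiv_apply']
  calc
    _ = 𝟙 _ ⊗≫ r₁ ◁ g ◁ adj₂.unit ⊗≫ r₁ ◁ φ ▷ r₂ ⊗≫
        ((r₁ ≫ l₁) ◁ b ≫ adj₁.counit ▷ h') ▷ r₂ ⊗≫ 𝟙 _ := by bicategory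
    _ = _ := by rw [whisker_exchange]; bicategory

/-- Compatibility of a 2-cell and its mate with the units. -/
lemma unit_comp_mate (φ : g ≫ l₂ ⟶ l₁ ≫ h) :
    g ◁ adj₂.unit ≫ (α_ _ _ _).inv ≫ φ ▷ r₂ =
      (ρ_ _).hom ≫ (λ_ _).inv ≫ adj₁.unit ▷ g ≫ (α_ _ _ _).hom ≫
        l₁ ◁ mateEquiv adj₁ adj₂ φ ≫ (α_ _ _ _).inv := by
  have h := (mateEquiv_eq_iff adj₁ adj₂ φ _).1 rfl
  rw [Adjunction.homEquiv₁_symm_apply, Adjunction.homEquiv₂_apply] at h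
  have h' := congrArg (fun t => (ρ_ _).hom ≫ t ≫ (α_ _ _ _).inv) h
  simpa using h'.symm

/-- Compatibility of a 2-cell and its mate with the counits. -/
lemma mate_comp_counit (φ : g ≫ l₂ ⟶ l₁ ≫ h) :
    r₁ ◁ φ ≫ (α_ _ _ _).inv ≫ adj₁.counit ▷ h =
      (α_ _ _ _).inv ≫ mateEquiv adj₁ adj₂ φ ▷ l₂ ≫ (α_ _ _ _).hom ≫ h ◁ adj₂.counit ≫
        (ρ_ _).hom ≫ (λ_ _).inv := by
  obtain ⟨ψ, rfl⟩ := (mateEquiv adj₁ adj₂).symm.surjective φ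
  rw [Equiv.apply_symm_apply]
  have h : adj₁.homEquiv₁ ((mateEquiv adj₁ adj₂).symm ψ) =
      (α_ _ _ _).inv ≫ adj₂.homEquiv₂.symm (ψ) := by
    rw [← Equiv.eq_symm_apply, mateEquiv_symm_apply']
    rw [Adjunction.homEquiv₁_symm_apply, Adjunction.homEquiv₂_symm_apply]
    bicategory
  rw [Adjunction.homEquiv₁_apply, Adjunction.homEquiv₂_symm_apply] at h
  have h' := congrArg (fun t => t ≫ (λ_ _).inv) h
  simpa using h'

end Mates

section Equivalence

variable {B : Type u₁} [Bicategory.{w₁, v₁} B] {a b c : B}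

/-- The adjunction underlying an adjoint equivalence. -/
abbrev Equivalence.adj (e : Bicategory.Equivalence a b) : Bicategory.Adjunction e.hom e.inv where
  unit := e.unit.hom
  counit := e.counit.hom
  left_triangle := e.left_triangle_hom
  right_triangle := e.right_triangle_hom

/-- The inverse of an equivalence. -/
abbrev Equivalence.symm' (e : Bicategory.Equivalence a b) : Bicategory.Equivalence b a :=
  .mkOfAdjointifyCounit e.counit.symm e.unit.symm

/-- The composite of two equivalences. -/
abbrev Equivalence.trans' (e : Bicategory.Equivalence a b) (e' : Bicategory.Equivalence b c) :
    Bicategory.Equivalence a c :=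
  .mkOfAdjointifyCounit (f := e.hom ≫ e'.hom) (g := e'.inv ≫ e.inv)
    (e.unit ≪≫ whiskerLeftIso e.hom ((λ_ e.inv).symm ≪≫ whiskerRightIso e'.unit e.inv ≪≫
      α_ _ _ _) ≪≫ (α_ _ _ _).symm)
    ((α_ _ _ _) ≪≫ whiskerLeftIso e'.inv ((α_ _ _ _).symm ≪≫ whiskerRightIso e.counit e'.hom ≪≫
      λ_ _) ≪≫ e'.counit)

/-- A mate is a pasting that involves only the counit of the first adjunction and the unit of the
second one. -/
lemma isIso_mateEquiv {c d e f : B} {g : c ⟶ e} {h : d ⟶ f} {l₁ : c ⟶ d} {r₁ : d ⟶ c}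
    {l₂ : e ⟶ f} {r₂ : f ⟶ e} (adj₁ : Bicategory.Adjunction l₁ r₁)
    (adj₂ : Bicategory.Adjunction l₂ r₂) (φ : g ≫ l₂ ⟶ l₁ ≫ h) (_ : IsIso adj₁.counit)
    (_ : IsIso adj₂.unit) (_ : IsIso φ) : IsIso (mateEquiv adj₁ adj₂ φ) := by
  rw [mateEquiv_apply, Adjunction.homEquiv₁_apply, Adjunction.homEquiv₂_apply]
  infer_instance

end Equivalence

end CategoryTheory.Bicategory

/-! ### Adjoints and equivalences of pseudonatural transformations, from their components -/

namespace CategoryTheory.Pseudofunctor.StrongTrans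

universe w₁ w₂ v₁ v₂ u₁ u₂

variable {B : Type u₁} [Bicategory.{w₁, v₁} B] {C : Type u₂} [Bicategory.{w₂, v₂} C]
  {F G : Pseudofunctor B C}

section Left

variable (R : G ⟶ F) (l : ∀ b, F.obj b ⟶ G.obj b)
  (adj : ∀ b, Bicategory.Adjunction (l b) (R.app b))

/-- The mate of an inverse naturality constraint, for a family of left adjoints. -/
abbrev leftMate {a b : B} (f : a ⟶ b) : F.map f ≫ l b ⟶ l a ≫ G.map f :=
  (Bicategory.mateEquiv (adj a) (adj b)).symm (R.naturality f).inv

variable (h : ∀ {a b : B} (f : a ⟶ b), IsIso (leftMate R l adj f))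

/-- The left adjoint of a strong transformation whose components have left adjoints such that the
mates of the naturality constraints are invertible. -/
noncomputable def leftAdjointTrans : F ⟶ G where
  app := l
  naturality f := @asIso _ _ _ _ (leftMate R l adj f) (h f)
  naturality_naturality {a b f g} η := by
    -- Taking mates is injective, and on mates the equation becomes the naturality of `R`. The unit
    -- and composition axioms below are treated in the same way.
    apply (Bicategory.mateEquiv (adj a) (adj b)).injective
    dsimp only [asIso_hom]
    rw [mateEquiv_whiskerRight_comp, mateEquiv_comp_whiskerLeft]
    simp only [Equiv.apply_symm_apply]
    rw [Iso.eq_inv_comp, ← Category.assoc, Iso.comp_inv_eq]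
    exact (R.naturality_naturality η).symm
  naturality_id a := by
    apply (Bicategory.mateEquiv (adj a) (adj a)).injective
    dsimp only [asIso_hom]
    rw [mateEquiv_whiskerRight_comp, mateEquiv_comp_whiskerLeft,
      mateEquiv_leftUnitor_hom_rightUnitor_inv]
    simp only [Equiv.apply_symm_apply]
    rw [Iso.inv_comp_eq, ← Category.assoc, naturality_id]
    simp
  naturality_comp {a b c} f g := by
    apply (Bicategory.mateEquiv (adj a) (adj c)).injective
    dsimp only [asIso_hom]
    rw [mateEquiv_whiskerRight_comp, mateEquiv_comp_whiskerLeft]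
    have := Bicategory.mateEquiv_vcomp (adj a) (adj b) (adj c) (leftMate R l adj f) (leftMate R l adj g)
    rw [leftAdjointSquare.vcomp] at this
    rw [this, rightAdjointSquare.vcomp]
    simp only [Equiv.apply_symm_apply]
    rw [Iso.inv_comp_eq, ← Category.assoc, naturality_comp]
    simp

/-- The adjunction between `leftAdjointTrans` and the given strong transformation. -/
noncomputable def leftAdjointTransAdj :
    Bicategory.Adjunction (leftAdjointTrans R l adj h) R where
  unit := { as :=
    { app b := (adj b).unit
      naturality {a b} f := by
        have := unit_comp_mate (adj a) (adj b) (leftMate R l adj f)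
        simp only [Equiv.apply_symm_apply] at this
        change F.map f ◁ (adj b).unit ≫ (α_ _ _ _).inv ≫ leftMate R l adj f ▷ R.app b ≫
          (α_ _ _ _).hom ≫ l a ◁ (R.naturality f).hom ≫ (α_ _ _ _).inv =
            ((ρ_ _).hom ≫ (λ_ _).inv) ≫ (adj a).unit ▷ F.map f
        rw [reassoc_of% this]
        simp } }
  counit := { as :=
    { app b := (adj b).counit
      naturality {a b} f := by
        have := mate_comp_counit (adj a) (adj b) (leftMate R l adj f)
        simp only [Equiv.apply_symm_apply] at this
        change G.map f ◁ (adj b).counit ≫ (ρ_ _).hom ≫ (λ_ _).inv =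
            ((α_ _ _ _).inv ≫ (R.naturality f).hom ▷ l b ≫ (α_ _ _ _).hom ≫
              R.app a ◁ leftMate R l adj f ≫ (α_ _ _ _).inv) ≫ (adj a).counit ▷ G.map f
        simp only [Category.assoc]
        rw [this]
        simp } }
  left_triangle := by
    ext b
    exact (adj b).left_triangle
  right_triangle := by
    ext b
    exact (adj b).right_triangle

end Left

section Right

variable (L : F ⟶ G) (r : ∀ b, G.obj b ⟶ F.obj b)
  (adj : ∀ b, Bicategory.Adjunction (L.app b) (r b))

/-- The mate of a naturality constraint, for a family of right adjoints. -/
abbrev rightMate {a b : B} (f : a ⟶ b) : r a ≫ F.map f ⟶ G.map f ≫ r b :=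
  Bicategory.mateEquiv (adj a) (adj b) (L.naturality f).hom

variable (h : ∀ {a b : B} (f : a ⟶ b), IsIso (rightMate L r adj f))

/-- The right adjoint of a strong transformation whose components have right adjoints such that the
mates of the naturality constraints are invertible. -/
noncomputable def rightAdjointTrans : G ⟶ F where
  app := r
  naturality f := (@asIso _ _ _ _ (rightMate L r adj f) (h f)).symm
  naturality_naturality {a b f g} η := by
    rw [Iso.symm_hom, Iso.symm_hom, Iso.eq_inv_comp, ← Category.assoc, Iso.comp_inv_eq]
    dsimp only [asIso_hom, rightMate]
    rw [← mateEquiv_whiskerRight_comp, ← mateEquiv_comp_whiskerLeft, naturality_naturality]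
  naturality_id a := by
    rw [Iso.symm_hom, Iso.inv_comp_eq]
    dsimp only [asIso_hom]
    have h₁ := mateEquiv_comp_whiskerLeft (adj a) (adj a) (L.naturality (𝟙 a)).hom (G.mapId a).hom
    rw [L.naturality_id, mateEquiv_whiskerRight_comp, mateEquiv_leftUnitor_hom_rightUnitor_inv]
      at h₁
    rw [← Category.assoc, ← h₁]
    simp
  naturality_comp {a b c} f g := by
    rw [Iso.symm_hom, Iso.inv_comp_eq]
    have h₁ := mateEquiv_comp_whiskerLeft (adj a) (adj c) (L.naturality (f ≫ g)).hom
      (G.mapComp f g).hom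
    have h₂ := Bicategory.mateEquiv_vcomp (adj a) (adj b) (adj c) (L.naturality f).hom (L.naturality g).hom
    rw [leftAdjointSquare.vcomp] at h₂
    rw [L.naturality_comp, mateEquiv_whiskerRight_comp, h₂, rightAdjointSquare.vcomp] at h₁
    dsimp only [asIso_hom]
    rw [← Category.assoc, ← h₁]
    have := h f
    have := h g
    simp

/-- The adjunction between the given strong transformation and `rightAdjointTrans`. -/
noncomputable def rightAdjointTransAdj :
    Bicategory.Adjunction L (rightAdjointTrans L r adj h) where
  unit := { as :=
    { app b := (adj b).unit
      naturality {a b} f := by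
        have := h f
        change F.map f ◁ (adj b).unit ≫ (α_ _ _ _).inv ≫ (L.naturality f).hom ▷ r b ≫
          (α_ _ _ _).hom ≫ L.app a ◁ inv (rightMate L r adj f) ≫ (α_ _ _ _).inv =
            ((ρ_ _).hom ≫ (λ_ _).inv) ≫ (adj a).unit ▷ F.map f
        rw [reassoc_of% unit_comp_mate (adj a) (adj b) (L.naturality f).hom]
        simp [← whiskerLeft_comp_assoc] } }
  counit := { as :=
    { app b := (adj b).counit
      naturality {a b} f := by
        have := h f
        change G.map f ◁ (adj b).counit ≫ (ρ_ _).hom ≫ (λ_ _).inv =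
            ((α_ _ _ _).inv ≫ inv (rightMate L r adj f) ▷ L.app b ≫ (α_ _ _ _).hom ≫
              r a ◁ (L.naturality f).hom ≫ (α_ _ _ _).inv) ≫ (adj a).counit ▷ G.map f
        simp only [Category.assoc]
        rw [mate_comp_counit (adj a) (adj b) (L.naturality f).hom]
        simp [← comp_whiskerRight_assoc] } }
  left_triangle := by
    ext b
    exact (adj b).left_triangle
  right_triangle := by
    ext b
    exact (adj b).right_triangle

/-- A strong transformation whose components are equivalences is an equivalence. -/
noncomputable def equivOfApp (η : ∀ b, 𝟙 (F.obj b) ≅ L.app b ≫ r b)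
    (κ : ∀ b, r b ≫ L.app b ≅ 𝟙 (G.obj b)) : Bicategory.Equivalence F G :=
  let adj (b : B) := (Equivalence.mkOfAdjointifyCounit (η b) (κ b)).adj
  -- Units and counits of adjoint equivalences are invertible, so the Beck–Chevalley condition on
  -- the mates is automatic.
  have h {a b : B} (f : a ⟶ b) : IsIso (rightMate L r adj f) := by
    exact isIso_mateEquiv (adj a) (adj b) (L.naturality f).hom (Iso.isIso_hom _)
      (Iso.isIso_hom _) (Iso.isIso_hom _)
  .mkOfAdjointifyCounit (f := L) (g := rightAdjointTrans L r adj h)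
    (isoMk (fun b => η b) (rightAdjointTransAdj L r adj h).unit.as.naturality)
    (isoMk (fun b => (Equivalence.mkOfAdjointifyCounit (η b) (κ b)).counit)
      (rightAdjointTransAdj L r adj h).counit.as.naturality)

end Right

end CategoryTheory.Pseudofunctor.StrongTrans

/-! ### Universal arrows and mates -/

namespace CategoryTheory.Functor

universe v₁ v₂ v₃ v₄ u₁ u₂ u₃ u₄

variable {C : Type u₁} [Category.{v₁} C] {E : Type u₂} [Category.{v₂} E]

/-- `φ : X ⟶ R T` exhibits `T` as the value at `X` of a left adjoint of `R`. -/
def IsUniv (R : E ⥤ C) {X : C} {T : E} (φ : X ⟶ R.obj T) : Prop :=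
  ∀ Y : E, Function.Bijective (fun f : T ⟶ Y => φ ≫ R.map f)

/-- `φ : L T ⟶ X` exhibits `T` as the value at `X` of a right adjoint of `L`. -/
def IsCouniv (L : E ⥤ C) {X : C} {T : E} (φ : L.obj T ⟶ X) : Prop :=
  ∀ Y : E, Function.Bijective (fun f : Y ⟶ T => L.map f ≫ φ)

section Univ
variable {R : E ⥤ C} {X : C} {T : E} {φ : X ⟶ R.obj T}

lemma IsUniv.hom_ext (h : R.IsUniv φ) {Y : E} {f g : T ⟶ Y} (e : φ ≫ R.map f = φ ≫ R.map g) :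
    f = g := (h Y).1 e

lemma IsUniv.exists_lift (h : R.IsUniv φ) {Y : E} (ψ : X ⟶ R.obj Y) : ∃ f, φ ≫ R.map f = ψ :=
  (h Y).2 ψ

lemma IsUniv.comp_map (h : R.IsUniv φ) {T' : E} (g : T ⟶ T') [IsIso g] :
    R.IsUniv (φ ≫ R.map g) := by
  intro Y
  constructor
  · intro f f' e
    rw [← cancel_epi g]
    apply h.hom_ext
    simpa using e
  · intro ψ
    obtain ⟨f, rfl⟩ := h.exists_lift ψ
    exact ⟨CategoryTheory.inv g ≫ f, by simp⟩

lemma isUniv_comp_map_iff {T' : E} (g : T ⟶ T') [IsIso g] :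
    R.IsUniv (φ ≫ R.map g) ↔ R.IsUniv φ :=
  ⟨fun h => by simpa using h.comp_map (CategoryTheory.inv g), fun h => h.comp_map g⟩

lemma isUniv_precomp_iff {X' : C} (e : X' ⟶ X) [IsIso e] : R.IsUniv (e ≫ φ) ↔ R.IsUniv φ := by
  refine forall_congr' fun Y => ?_
  simp only [Category.assoc]
  rw [← Function.Bijective.of_comp_iff' (f := fun ψ : X ⟶ R.obj Y => e ≫ ψ)]
  · rfl
  · exact ⟨fun a b h => by simpa [cancel_epi] using h, fun ψ => ⟨CategoryTheory.inv e ≫ ψ, by simp⟩⟩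

/-- Two universal arrows out of the same object differ by an isomorphism; this plays the part of the
uniqueness of adjoints. -/
lemma IsUniv.isIso (h : R.IsUniv φ) {T' : E} {g : T ⟶ T'} (h' : R.IsUniv (φ ≫ R.map g)) :
    IsIso g := by
  obtain ⟨f, hf⟩ := h'.exists_lift φ
  refine ⟨f, h.hom_ext (by simpa using hf), h'.hom_ext ?_⟩
  simp [reassoc_of% hf]

lemma isUniv_unit {L : C ⥤ E} (adj : L ⊣ R) (X : C) : R.IsUniv (adj.unit.app X) := fun Y => by
  simpa only [← Adjunction.homEquiv_unit] using! (adj.homEquiv X Y).bijective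

/-- A functor `R` with universal arrows has a left adjoint with these universal arrows as units. -/
lemma exists_adjunction (T : C → E) (φ : ∀ X, X ⟶ R.obj (T X)) (h : ∀ X, R.IsUniv (φ X)) :
    R.IsRightAdjoint :=
  (Adjunction.adjunctionOfEquivLeft (G := R) (F_obj := T)
    (fun X Y => Equiv.ofBijective _ (h X Y)) (fun X Y Y' g f => by simp)).isRightAdjoint

end Univ

section Couniv
variable {R : E ⥤ C} {X : C} {T : E} {φ : R.obj T ⟶ X}

lemma IsCouniv.hom_ext (h : R.IsCouniv φ) {Y : E} {f g : Y ⟶ T} (e : R.map f ≫ φ = R.map g ≫ φ) :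
    f = g := (h Y).1 e

lemma IsCouniv.exists_lift (h : R.IsCouniv φ) {Y : E} (ψ : R.obj Y ⟶ X) : ∃ f, R.map f ≫ φ = ψ :=
  (h Y).2 ψ

lemma IsCouniv.map_comp (h : R.IsCouniv φ) {T' : E} (g : T' ⟶ T) [IsIso g] :
    R.IsCouniv (R.map g ≫ φ) := by
  intro Y
  constructor
  · intro f f' e
    rw [← cancel_mono g]
    apply h.hom_ext
    simpa using e
  · intro ψ
    obtain ⟨f, rfl⟩ := h.exists_lift ψ
    exact ⟨f ≫ CategoryTheory.inv g, by simp⟩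

lemma isCouniv_map_comp_iff {T' : E} (g : T' ⟶ T) [IsIso g] :
    R.IsCouniv (R.map g ≫ φ) ↔ R.IsCouniv φ :=
  ⟨fun h => by simpa using h.map_comp (CategoryTheory.inv g), fun h => h.map_comp g⟩

lemma isCouniv_postcomp_iff {X' : C} (e : X ⟶ X') [IsIso e] :
    R.IsCouniv (φ ≫ e) ↔ R.IsCouniv φ := by
  refine forall_congr' fun Y => ?_
  simp only [← Category.assoc]
  rw [← Function.Bijective.of_comp_iff' (f := fun ψ : R.obj Y ⟶ X => ψ ≫ e)]
  · rfl
  · exact ⟨fun a b h => by simpa [cancel_mono] using h, fun ψ => ⟨ψ ≫ CategoryTheory.inv e, by simp⟩⟩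

lemma IsCouniv.isIso (h : R.IsCouniv φ) {T' : E} {g : T' ⟶ T} (h' : R.IsCouniv (R.map g ≫ φ)) :
    IsIso g := by
  obtain ⟨f, hf⟩ := h'.exists_lift φ
  refine ⟨f, h'.hom_ext ?_, h.hom_ext (by simpa using hf)⟩
  simp [hf]

lemma isCouniv_counit {L : C ⥤ E} (adj : R ⊣ L) (X : C) : R.IsCouniv (adj.counit.app X) :=
  fun Y => by
    simpa only [← Adjunction.homEquiv_counit] using! (adj.homEquiv Y X).symm.bijective

/-- A functor with couniversal arrows has a right adjoint. -/
lemma exists_adjunction' (T : C → E) (φ : ∀ X, R.obj (T X) ⟶ X) (h : ∀ X, R.IsCouniv (φ X)) :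
    R.IsLeftAdjoint :=
  (Adjunction.adjunctionOfEquivRight (F := R) (G_obj := T)
    (fun X Y => (Equiv.ofBijective _ (h Y X)).symm) (fun X' X Y f g => by
      rw [Equiv.symm_apply_eq]
      simp only [Equiv.ofBijective_apply, map_comp, Category.assoc]
      congr 1
      exact ((Equiv.ofBijective _ (h Y X)).apply_symm_apply g).symm)).isLeftAdjoint

end Couniv

section Mates

variable {A : Type u₃} [Category.{v₃} A] {B : Type u₄} [Category.{v₄} B]
  {U : E ⥤ C} {P : C ⥤ A} {V : E ⥤ B} {Q : B ⥤ A} (α : U ⋙ P ⟶ V ⋙ Q)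

/-- The mate of `α` is invertible iff `α` preserves universal arrows. -/
lemma isIso_mate_iff {L : C ⥤ E} (adj : L ⊣ U) {M : A ⥤ B} (adj' : M ⊣ Q) :
    IsIso ((CategoryTheory.mateEquiv adj adj').symm (.mk _ _ _ _ α)).natTrans ↔
      ∀ (X : C) (T : E) (φ : X ⟶ U.obj T), U.IsUniv φ → Q.IsUniv (P.map φ ≫ α.app T) := by
  have key (X : C) := unit_mateEquiv_symm adj adj' (.mk _ _ _ _ α) X
  constructor
  · intro h X T φ hφ
    -- Every universal arrow is a unit followed by an isomorphism, so only units matter, and for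
    -- these `key` identifies the image with the unit of the other adjunction followed by the mate.
    obtain ⟨g, rfl⟩ := (isUniv_unit adj X).exists_lift φ
    have := (isUniv_unit adj X).isIso hφ
    have := (isUniv_unit adj' (P.obj X)).comp_map
      (((CategoryTheory.mateEquiv adj adj').symm (.mk _ _ _ _ α)).natTrans.app X)
    erw [← key] at this
    have h₂ := this.comp_map (V.map g)
    have e : P.map (adj.unit.app X ≫ U.map g) ≫ α.app T =
        (P.map (adj.unit.app X) ≫ α.app (L.obj X)) ≫ Q.map (V.map g) := by
      rw [P.map_comp, Category.assoc, Category.assoc]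
      exact congrArg (P.map (adj.unit.app X) ≫ ·) (α.naturality g)
    rw [e]
    exact h₂
  · intro h
    rw [NatTrans.isIso_iff_isIso_app]
    intro X
    have := h X _ _ (isUniv_unit adj X)
    erw [key] at this
    exact (isUniv_unit adj' (P.obj X)).isIso this

/-- The mate of `α` is invertible iff `α` preserves couniversal arrows. -/
lemma isIso_mate_iff' {L : B ⥤ E} (adj : V ⊣ L) {M : A ⥤ C} (adj' : P ⊣ M) :
    IsIso (CategoryTheory.mateEquiv adj adj' (.mk _ _ _ _ α)).natTrans ↔
      ∀ (X : B) (T : E) (φ : V.obj T ⟶ X), V.IsCouniv φ → P.IsCouniv (α.app T ≫ Q.map φ) := by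
  have key (X : B) := mateEquiv_counit adj adj' (.mk _ _ _ _ α) X
  constructor
  · intro h X T φ hφ
    obtain ⟨g, rfl⟩ := (isCouniv_counit adj X).exists_lift φ
    have := (isCouniv_counit adj X).isIso hφ
    have := (isCouniv_counit adj' (Q.obj X)).map_comp
      ((CategoryTheory.mateEquiv adj adj' (.mk _ _ _ _ α)).natTrans.app X)
    rw [key] at this
    have h₂ := this.map_comp (U.map g)
    have e : α.app T ≫ Q.map (V.map g ≫ adj.counit.app X) =
        P.map (U.map g) ≫ α.app (L.obj X) ≫ Q.map (adj.counit.app X) := by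
      rw [Q.map_comp, ← Category.assoc, ← Category.assoc]
      exact congrArg (· ≫ Q.map (adj.counit.app X)) (α.naturality g).symm
    rw [e]
    exact h₂
  · intro h
    rw [NatTrans.isIso_iff_isIso_app]
    intro X
    have := h X _ _ (isCouniv_counit adj X)
    erw [← key] at this
    exact (isCouniv_counit adj' (Q.obj X)).isIso this

end Mates

end CategoryTheory.Functor

/-! ### Strictification by formal restrictions -/

namespace Prederivator

section
variable {C : Type u} [Category.{v} C]

lemma bijective_comp_right {X Y : C} (e : X ⟶ Y) [IsIso e] (W : C) :
    Function.Bijective (fun ψ : W ⟶ X => ψ ≫ e) :=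
  ⟨fun a b h => by simpa [cancel_mono] using h, fun ψ => ⟨ψ ≫ CategoryTheory.inv e, by simp⟩⟩

lemma bijective_comp_left {X Y : C} (e : X ⟶ Y) [IsIso e] (W : C) :
    Function.Bijective (fun ψ : Y ⟶ W => e ≫ ψ) :=
  ⟨fun a b h => by simpa [cancel_epi] using h, fun ψ => ⟨CategoryTheory.inv e ≫ ψ, by simp⟩⟩

/-- The chase behind `pb_pb`: conjugating twice by composition isomorphisms is conjugating once, by
the associativity coherence in `h` and `h'`. -/
lemma conj_conj_eq {P Q R S P' Q' R' S' : C} {a : P ≅ Q} {s : Q ≅ R} {c : P ≅ S} {d : S ≅ R}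
    {a' : P' ≅ Q'} {s' : Q' ≅ R'} {c' : P' ≅ S'} {d' : S' ≅ R'} {m : R ⟶ R'} {t : S ⟶ S'}
    (h : c.hom ≫ d.hom = a.hom ≫ s.hom) (h' : c'.hom ≫ d'.hom = a'.hom ≫ s'.hom)
    (ht : t ≫ d'.hom = d.hom ≫ m) :
    a.hom ≫ (s.hom ≫ m ≫ s'.inv) ≫ a'.inv = c.hom ≫ t ≫ c'.inv := by
  have h₁ : s'.inv ≫ a'.inv = d'.inv ≫ c'.inv := by
    rw [← Iso.trans_inv, ← Iso.trans_inv]; congr 1; ext; exact h'.symm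
  have h₂ : t = d.hom ≫ m ≫ d'.inv := by simp [← reassoc_of% ht]
  simp [h₁, h₂, ← reassoc_of% h]

lemma conj_id_eq {P Q P' Q' : C} {a : P ≅ Q} {a' : P' ≅ Q'} {r : Q ≅ P} {r' : Q' ≅ P'} {m : Q ⟶ Q'}
    {n : P ⟶ P'} (h : a.hom = r.inv) (h' : a'.hom = r'.inv) (hn : n ≫ r'.inv = r.inv ≫ m) :
    a.hom ≫ m ≫ a'.inv = n := by
  rw [h, ← reassoc_of% hn, ← h']
  simp

lemma conj_naturality_eq {P Q P' Q' R S R' S' : C} {a : P ≅ Q} {a' : P' ≅ Q'} {m : Q ⟶ Q'}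
    {b : R ≅ S} {b' : R' ≅ S'} {n : S ⟶ S'} {t : P ⟶ R} {t' : P' ⟶ R'} {q : Q ⟶ S} {q' : Q' ⟶ S'}
    (h : t ≫ b.hom = a.hom ≫ q) (h' : t' ≫ b'.hom = a'.hom ≫ q') (hn : m ≫ q' = q ≫ n) :
    (a.hom ≫ m ≫ a'.inv) ≫ t' = t ≫ b.hom ≫ n ≫ b'.inv := by
  rw [← cancel_mono b'.hom]
  simp [h', hn, reassoc_of% h]

end

section
variable (D : Prederivator.{w, v, u})

lemma resTrans_id {A B : Cat.{w, w}} (f : A ⥤ B) : D.resTrans (𝟙 f) = 𝟙 (D.res f) :=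
  congrArg (fun t => t.toNatTrans) (D.map₂_id (opHom f))

lemma resTrans_comp {A B : Cat.{w, w}} {f g h : A ⥤ B} (α : f ⟶ g) (β : g ⟶ h) :
    D.resTrans (α ≫ β) = D.resTrans α ≫ D.resTrans β :=
  congrArg (fun t => t.toNatTrans) (D.map₂_comp (opHom₂ α) (opHom₂ β))

/-- Formal restrictions `f^* X`. These strictify the prederivator `D`. -/
structure St (J : Cat.{w, w}) where
  /-- the shape of the diagram which is restricted -/
  base : Cat.{w, w}
  /-- the functor along which one restricts -/
  fn : J ⥤ base
  /-- the diagram which is restricted -/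
  obj : D.Dia base

variable {D}

/-- The restriction `f^* X`. -/
abbrev St.val {J : Cat.{w, w}} (X : D.St J) : D.Dia J := (D.res X.fn).obj X.obj

instance (J : Cat.{w, w}) : Category (D.St J) where
  Hom X Y := X.val ⟶ Y.val
  id X := 𝟙 X.val
  comp f g := CategoryStruct.comp (obj := D.Dia J) f g
  id_comp f := Category.id_comp (obj := D.Dia J) f
  comp_id f := Category.comp_id (obj := D.Dia J) f
  assoc f g h := Category.assoc (obj := D.Dia J) f g h

lemma isIso_st_iff {J : Cat.{w, w}} {X Y : D.St J} (f : X ⟶ Y) :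
    IsIso f ↔ IsIso (C := D.Dia J) f :=
  ⟨fun h => ⟨h.1⟩, fun h => ⟨h.1⟩⟩

/-- The strictly functorial restriction of formal restrictions. -/
def pb {K J : Cat.{w, w}} (h : K ⥤ J) : D.St J ⥤ D.St K where
  obj X := ⟨X.base, h ⋙ X.fn, X.obj⟩
  map {X Y} φ := CategoryStruct.comp (obj := D.Dia K) ((D.resComp h X.fn).hom.app X.obj)
    (CategoryStruct.comp (obj := D.Dia K) ((D.res h).map φ) ((D.resComp h Y.fn).inv.app Y.obj))
  map_id X := by
    change (D.resComp h X.fn).hom.app X.obj ≫ (D.res h).map (𝟙 X.val) ≫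
      (D.resComp h X.fn).inv.app X.obj = 𝟙 _
    simp
  map_comp {X Y Z} φ ψ := by
    change (D.resComp h X.fn).hom.app X.obj ≫ (D.res h).map (CategoryStruct.comp (obj := D.Dia J)
        φ ψ) ≫ (D.resComp h Z.fn).inv.app Z.obj =
      ((D.resComp h X.fn).hom.app X.obj ≫ (D.res h).map φ ≫ (D.resComp h Y.fn).inv.app Y.obj) ≫
      ((D.resComp h Y.fn).hom.app Y.obj ≫ (D.res h).map ψ ≫ (D.resComp h Z.fn).inv.app Z.obj)
    simp

/-- Restriction of formal restrictions is strictly functorial. -/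
lemma pb_pb {L K J : Cat.{w, w}} (k : L ⥤ K) (h : K ⥤ J) {X Y : D.St J} (φ : X ⟶ Y) :
    (pb k).map ((pb h).map φ) = (pb (k ⋙ h)).map φ := by
  change (D.resComp k (h ⋙ X.fn)).hom.app X.obj ≫ (D.res k).map ((D.resComp h X.fn).hom.app X.obj ≫
      (D.res h).map φ ≫ (D.resComp h Y.fn).inv.app Y.obj) ≫
      (D.resComp k (h ⋙ Y.fn)).inv.app Y.obj =
    (D.resComp (k ⋙ h) X.fn).hom.app X.obj ≫ (D.res (k ⋙ h)).map φ ≫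
      (D.resComp (k ⋙ h) Y.fn).inv.app Y.obj
  rw [Functor.map_comp, Functor.map_comp]
  exact conj_conj_eq (a := (D.resComp k (h ⋙ X.fn)).app X.obj)
    (a' := (D.resComp k (h ⋙ Y.fn)).app Y.obj)
    (c := (D.resComp (k ⋙ h) X.fn).app X.obj) (c' := (D.resComp (k ⋙ h) Y.fn).app Y.obj)
    (s := (D.res k).mapIso ((D.resComp h X.fn).app X.obj))
    (s' := (D.res k).mapIso ((D.resComp h Y.fn).app Y.obj))
    (d := (D.resComp k h).app X.val) (d' := (D.resComp k h).app Y.val)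
    (D.resComp_assoc k h X.fn X.obj) (D.resComp_assoc k h Y.fn Y.obj)
    ((D.resComp k h).hom.naturality φ)

lemma pb_id {J : Cat.{w, w}} {X Y : D.St J} (φ : X ⟶ Y) : (pb (𝟭 J)).map φ = φ := by
  change (D.resComp (𝟭 J) X.fn).hom.app X.obj ≫ (D.res (𝟭 J)).map φ ≫
      (D.resComp (𝟭 J) Y.fn).inv.app Y.obj = (show X.val ⟶ Y.val from φ)
  exact conj_id_eq (a := (D.resComp (𝟭 J) X.fn).app X.obj)
    (a' := (D.resComp (𝟭 J) Y.fn).app Y.obj) (r := (D.resId J).app X.val)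
    (r' := (D.resId J).app Y.val) (D.resComp_id_left X.fn X.obj) (D.resComp_id_left Y.fn Y.obj)
    ((D.resId J).inv.naturality φ)

/-- The transformation of restriction functors induced by a natural transformation. -/
def tr {K J : Cat.{w, w}} {h h' : K ⥤ J} (α : h ⟶ h') (X : D.St J) :
    (pb h).obj X ⟶ (pb h').obj X :=
  (D.resTrans (Functor.whiskerRight α X.fn)).app X.obj

lemma tr_naturality {K J : Cat.{w, w}} {h h' : K ⥤ J} (α : h ⟶ h') {X Y : D.St J} (φ : X ⟶ Y) :
    (pb h).map φ ≫ tr α Y = tr α X ≫ (pb h').map φ := by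
  change ((D.resComp h X.fn).hom.app X.obj ≫ (D.res h).map φ ≫ (D.resComp h Y.fn).inv.app Y.obj) ≫
      (D.resTrans (Functor.whiskerRight α Y.fn)).app Y.obj =
    (D.resTrans (Functor.whiskerRight α X.fn)).app X.obj ≫
      ((D.resComp h' X.fn).hom.app X.obj ≫ (D.res h').map φ ≫ (D.resComp h' Y.fn).inv.app Y.obj)
  exact conj_naturality_eq (a := (D.resComp h X.fn).app X.obj) (a' := (D.resComp h Y.fn).app Y.obj)
    (b := (D.resComp h' X.fn).app X.obj) (b' := (D.resComp h' Y.fn).app Y.obj)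
    (D.resComp_natLeft α X.fn X.obj) (D.resComp_natLeft α Y.fn Y.obj) ((D.resTrans α).naturality φ)

lemma tr_id {K J : Cat.{w, w}} (h : K ⥤ J) (X : D.St J) : tr (𝟙 h) X = 𝟙 ((pb h).obj X) := by
  change (D.resTrans (Functor.whiskerRight (𝟙 h) X.fn)).app X.obj = 𝟙 _
  rw [Functor.whiskerRight_id', resTrans_id]
  rfl

lemma tr_comp {K J : Cat.{w, w}} {h h' h'' : K ⥤ J} (α : h ⟶ h') (β : h' ⟶ h'') (X : D.St J) :
    tr (α ≫ β) X = tr α X ≫ tr β X := by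
  change (D.resTrans (Functor.whiskerRight (α ≫ β) X.fn)).app X.obj =
    (D.resTrans (Functor.whiskerRight α X.fn)).app X.obj ≫
    (D.resTrans (Functor.whiskerRight β X.fn)).app X.obj
  rw [Functor.whiskerRight_comp, resTrans_comp]
  rfl

lemma pb_tr {L K J : Cat.{w, w}} (k : L ⥤ K) {h h' : K ⥤ J} (α : h ⟶ h') (X : D.St J) :
    (pb k).map (tr α X) = tr (Functor.whiskerLeft k α) X := by
  change (D.resComp k (h ⋙ X.fn)).hom.app X.obj ≫
    (D.res k).map ((D.resTrans (Functor.whiskerRight α X.fn)).app X.obj) ≫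
      (D.resComp k (h' ⋙ X.fn)).inv.app X.obj =
    (D.resTrans (Functor.whiskerLeft k (Functor.whiskerRight α X.fn))).app X.obj
  have := D.resComp_natRight k (Functor.whiskerRight α X.fn) X.obj
  rw [← cancel_mono ((D.resComp k (h' ⋙ X.fn)).hom.app X.obj), this]
  simp

/-- Definitional, because restricting a formal restriction merely composes functors. This strictness
is the purpose of `St`. -/
lemma tr_pb {L K J : Cat.{w, w}} {k k' : L ⥤ K} (α : k ⟶ k') (h : K ⥤ J) (X : D.St J) :
    tr α ((pb h).obj X) = tr (Functor.whiskerRight α h) X := rfl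

lemma isIso_tr {K J : Cat.{w, w}} {h h' : K ⥤ J} (α : h ⟶ h') [IsIso α] (X : D.St J) :
    IsIso (tr α X) :=
  ⟨tr (CategoryTheory.inv α) X, by rw [← tr_comp, IsIso.hom_inv_id, tr_id],
    by rw [← tr_comp, IsIso.inv_hom_id, tr_id]⟩

/-- A diagram, as a formal restriction. -/
def ofDia {J : Cat.{w, w}} (X : D.Dia J) : D.St J := ⟨J, 𝟭 J, X⟩

/-- The canonical isomorphism. -/
def ofDiaValIso {J : Cat.{w, w}} (X : D.Dia J) : (ofDia X).val ≅ X := (D.resId J).app X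

lemma isIso_pb_map_iff {K J : Cat.{w, w}} (h : K ⥤ J) {X Y : D.St J} (φ : X ⟶ Y) :
    IsIso ((pb h).map φ) ↔ IsIso ((D.res h).map (show X.val ⟶ Y.val from φ)) := by
  rw [isIso_st_iff]
  change IsIso ((D.resComp h X.fn).hom.app X.obj ≫ (D.res h).map φ ≫
    (D.resComp h Y.fn).inv.app Y.obj) ↔ _
  rw [isIso_comp_left_iff, isIso_comp_right_iff]

/-- Kan extensions of formal restrictions and of diagrams correspond. -/
lemma isUniv_pb_iff {K J : Cat.{w, w}} (h : K ⥤ J) {X : D.St K} {T : D.St J}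
    (φ : X ⟶ (pb h).obj T) : (pb h).IsUniv φ ↔
      (D.res h).IsUniv ((show X.val ⟶ ((pb h).obj T).val from φ) ≫
        (D.resComp h T.fn).hom.app T.obj) := by
  have key (Y : D.St J) : Function.Bijective (fun f : T ⟶ Y => φ ≫ (pb h).map f) ↔
      Function.Bijective (fun f : T.val ⟶ Y.val => ((show X.val ⟶ ((pb h).obj T).val from φ) ≫
        (D.resComp h T.fn).hom.app T.obj) ≫ (D.res h).map f) := by
    rw [← Function.Bijective.of_comp_iff'
      (bijective_comp_right ((D.resComp h Y.fn).inv.app Y.obj) X.val)]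
    refine iff_of_eq (congrArg _ (funext fun f => ?_))
    change (show X.val ⟶ ((pb h).obj T).val from φ) ≫ (D.resComp h T.fn).hom.app T.obj ≫
      (D.res h).map f ≫ (D.resComp h Y.fn).inv.app Y.obj = _
    simp only [Function.comp_apply, Category.assoc]
    exact (Category.assoc (obj := D.Dia K) _ _ _).symm
  constructor
  · intro H Y
    -- Universality in `St` only tests formal restrictions; an arbitrary diagram `Y` is reached
    -- through `ofDia Y`, whose value is isomorphic to it.
    have := (key (ofDia Y)).1 (H _)
    rw [← Function.Bijective.of_comp_iff'
      (bijective_comp_right ((D.res h).map (ofDiaValIso Y).hom) X.val)] at this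
    rw [← Function.Bijective.of_comp_iff _ (bijective_comp_right (ofDiaValIso Y).hom T.val)]
    convert this using 1
    funext f
    simp only [Function.comp_apply, Category.assoc, Functor.map_comp]
  · intro H Y
    exact (key Y).2 (H _)

/-- Kan extensions of formal restrictions and of diagrams correspond. -/
lemma isCouniv_pb_iff {K J : Cat.{w, w}} (h : K ⥤ J) {X : D.St K} {T : D.St J}
    (φ : (pb h).obj T ⟶ X) : (pb h).IsCouniv φ ↔
      (D.res h).IsCouniv ((D.resComp h T.fn).inv.app T.obj ≫
        (show ((pb h).obj T).val ⟶ X.val from φ)) := by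
  have key (Y : D.St J) : Function.Bijective (fun f : Y ⟶ T => (pb h).map f ≫ φ) ↔
      Function.Bijective (fun f : Y.val ⟶ T.val => (D.res h).map f ≫
        ((D.resComp h T.fn).inv.app T.obj ≫ (show ((pb h).obj T).val ⟶ X.val from φ))) := by
    rw [← Function.Bijective.of_comp_iff'
      (bijective_comp_left ((D.resComp h Y.fn).hom.app Y.obj) X.val)]
    refine iff_of_eq (congrArg _ (funext fun f => ?_))
    change CategoryStruct.comp (obj := D.Dia K) ((D.resComp h Y.fn).hom.app Y.obj ≫
      (D.res h).map f ≫ (D.resComp h T.fn).inv.app T.obj)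
      (show ((pb h).obj T).val ⟶ X.val from φ) = _
    dsimp only [Function.comp_apply]
    exact (Category.assoc (obj := D.Dia K) _ _ _).trans
      (congrArg _ (Category.assoc (obj := D.Dia K) _ _ _))
  constructor
  · intro H Y
    have := (key (ofDia Y)).1 (H _)
    rw [← Function.Bijective.of_comp_iff'
      (bijective_comp_left ((D.res h).map (ofDiaValIso Y).inv) X.val)] at this
    rw [← Function.Bijective.of_comp_iff _ (bijective_comp_left (ofDiaValIso Y).inv T.val)]
    convert this using 1
    funext f
    simp only [Function.comp_apply, Category.assoc, Functor.map_comp]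
  · intro H Y
    exact (key Y).2 (H _)

end

end Prederivator

/-! ### Pointwise isomorphisms and the two forms of a base change transformation -/

namespace Prederivator

variable {D : Prederivator.{w, v, u}}

section Basic

section
variable {C₁ : Type*} [Category C₁]

lemma comp_comp_eq_of_sq {P Q R S U : C₁} {a : P ⟶ Q} {b b' : Q ⟶ R} {c : R ⟶ S} {d : Q ⟶ U}
    {e e' : U ⟶ S} (h : b = b') (h' : b' ≫ c = d ≫ e) (h'' : e' = e) :
    (a ≫ b) ≫ c = (a ≫ d) ≫ e' := by
  subst h h''; simp [h']

lemma comp_four_eq {P Q R S U V W : C₁} {a : P ⟶ Q} {b : Q ⟶ R} {i : R ⟶ S} {t : S ⟶ U}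
    {r : U ⟶ V} {s : V ⟶ W} {X : C₁} {m : R ⟶ X} {k : X ⟶ W} {c : Q ⟶ X}
    (h : i ≫ t ≫ r ≫ s = m ≫ k) (hc : c = b ≫ m) :
    (((a ≫ b ≫ i) ≫ t) ≫ r) ≫ s = a ≫ c ≫ k := by
  subst hc; simp [h]

lemma map_comp_comp_eq {C₂ : Type*} [Category C₂] (F : C₁ ⥤ C₂) {P Q R S : C₁} {i : P ⟶ Q}
    {φ : Q ⟶ R} {m : R ⟶ S} {U V : C₂} {s' : F.obj S ⟶ V} {s : F.obj R ⟶ U} {k : U ⟶ V}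
    (h : F.map m ≫ s' = s ≫ k) :
    F.map (i ≫ φ ≫ m) ≫ s' = F.map i ≫ (F.map φ ≫ s) ≫ k := by
  simp [h]

end

lemma isIso_of_eval (hD : D.IsDerivator) {J : Cat.{w, w}} {X Y : D.St J} (φ : X ⟶ Y)
    (h : ∀ a : J, IsIso ((pb (ptAt a)).map φ)) : IsIso φ := by
  rw [isIso_st_iff]
  exact (hD.der2 J _ _ _).2 fun a => (isIso_pb_map_iff (ptAt a) φ).1 (h a)

lemma pt_hom_eq {K : Cat.{w, w}} {f g : K ⥤ pt.{w}} (α β : f ⟶ g) : α = β := by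
  ext x; exact @Subsingleton.elim (Discrete.mk PUnit.unit ⟶ Discrete.mk PUnit.unit) _ _ _

variable {X₀ A B C : Cat.{w, w}} {p : X₀ ⥤ A} {q : X₀ ⥤ B} {f : A ⥤ C} {g : B ⥤ C}

/-- For formal restrictions the transformation attached to a square is a single `tr`; for diagrams
it is `resSquare`. This coherence identity matches them, so that exactness of squares can be carried
over to `St`. -/
lemma resSquare_comp (α : p ⋙ f ⟶ q ⋙ g) (T : D.St C) :
    (D.resComp p (f ⋙ T.fn)).inv.app T.obj ≫ (D.resTrans (Functor.whiskerRight α T.fn)).app T.obj ≫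
      (D.resComp q (g ⋙ T.fn)).hom.app T.obj ≫ (D.res q).map ((D.resComp g T.fn).hom.app T.obj) =
    (D.res p).map ((D.resComp f T.fn).hom.app T.obj) ≫ (D.resSquare α).app T.val := by
  have h₁ := D.resComp_assoc p f T.fn T.obj
  have h₂ := D.resComp_assoc q g T.fn T.obj
  have h₃ := D.resComp_natLeft α T.fn T.obj
  have h₄ : (D.resComp p (f ⋙ T.fn)).inv.app T.obj ≫ (D.resComp (p ⋙ f) T.fn).hom.app T.obj =
      (D.res p).map ((D.resComp f T.fn).hom.app T.obj) ≫ (D.resComp p f).inv.app T.val := by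
    rw [← cancel_mono ((D.resComp p f).hom.app T.val)]
    simp only [Category.assoc, Iso.inv_hom_id_app]
    erw [h₁, Category.comp_id]
    simp
  erw [← h₂]
  rw [reassoc_of% h₃]
  rw [reassoc_of% h₄]
  rfl

end Basic

/-! ### Base change of Kan extensions -/

section Left

section BaseChange
variable {X₀ A B C : Cat.{w, w}} {p : X₀ ⥤ A} {q : X₀ ⥤ B} {f : A ⥤ C} {g : B ⥤ C}

/-- The base change of `φ : X ⟶ f^* T` along a square. -/
def bc (α : p ⋙ f ⟶ q ⋙ g) {X : D.St A} {T : D.St C} (φ : X ⟶ (pb f).obj T) :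
    (pb p).obj X ⟶ (pb q).obj ((pb g).obj T) :=
  (pb p).map φ ≫ tr α T

lemma bc_comp (α : p ⋙ f ⟶ q ⋙ g) {X : D.St A} {T T' : D.St C} (φ : X ⟶ (pb f).obj T)
    (m : T ⟶ T') : bc α (φ ≫ (pb f).map m) = bc α φ ≫ (pb q).map ((pb g).map m) := by
  exact (congrArg (· ≫ tr α T') ((pb p).map_comp φ _)).trans
    (comp_comp_eq_of_sq (C₁ := D.St X₀) (pb_pb p f m) (tr_naturality α m) (pb_pb q g m))

/-- Isomorphic squares have isomorphic base changes. This is needed where two descriptions of a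
functor agree only up to isomorphism. -/
lemma isUniv_bc_congr {p' : X₀ ⥤ A} {g' : B ⥤ C} (α : p ⋙ f ⟶ q ⋙ g) (α' : p' ⋙ f ⟶ q ⋙ g')
    (e : p ≅ p') (e' : g ≅ g')
    (h : ∀ x, α.app x ≫ e'.hom.app (q.obj x) = f.map (e.hom.app x) ≫ α'.app x)
    {X : D.St A} {T : D.St C} (φ : X ⟶ (pb f).obj T) :
    (pb q).IsUniv (bc α φ) ↔ (pb q).IsUniv (bc α' φ) := by
  have h' : α ≫ Functor.whiskerLeft q e'.hom = Functor.whiskerRight e.hom f ≫ α' := by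
    ext x; exact h x
  have := isIso_tr e.hom X
  have := isIso_tr e'.hom T
  rw [← Functor.isUniv_comp_map_iff (tr e'.hom T), ← Functor.isUniv_precomp_iff (tr e.hom X)
    (φ := bc α' φ)]
  have : bc α φ ≫ (pb q).map (tr e'.hom T) = tr e.hom X ≫ bc α' φ := by
    have h₁ := tr_naturality e.hom φ
    rw [bc, bc, pb_tr]
    erw [Category.assoc, ← tr_comp]
    rw [h', tr_comp]
    erw [← Category.assoc, ← Category.assoc, ← h₁, tr_pb]
    rfl
  rw [this]

/-- Exactness of squares, in terms of formal restrictions. -/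
lemma leftExact_iff (α : p ⋙ f ⟶ q ⋙ g) :
    (∀ (X : D.Dia A) (T : D.Dia C) (φ : X ⟶ (D.res f).obj T), (D.res f).IsUniv φ →
      (D.res q).IsUniv ((D.res p).map φ ≫ (D.resSquare α).app T)) ↔
    (∀ (X : D.St A) (T : D.St C) (φ : X ⟶ (pb f).obj T), (pb f).IsUniv φ →
      (pb q).IsUniv (bc α φ)) := by
  have key (X : D.St A) (T : D.St C) (φ : X ⟶ (pb f).obj T) : (pb q).IsUniv (bc α φ) ↔
      (D.res q).IsUniv ((D.res p).map ((show X.val ⟶ (D.res (f ⋙ T.fn)).obj T.obj from φ) ≫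
        (D.resComp f T.fn).hom.app T.obj) ≫ (D.resSquare α).app T.val) := by
    refine (isUniv_pb_iff q (T := (pb g).obj T) (bc α φ)).trans ?_
    refine (Functor.isUniv_comp_map_iff (R := D.res q)
      ((D.resComp g T.fn).hom.app T.obj)).symm.trans ?_
    refine Iff.trans (iff_of_eq (congrArg (Functor.IsUniv (D.res q) (T := (D.res g).obj T.val)) ?_))
      (Functor.isUniv_precomp_iff (R := D.res q) (T := (D.res g).obj T.val)
        ((D.resComp p X.fn).hom.app X.obj))
    exact comp_four_eq (C₁ := D.Dia X₀) (resSquare_comp α T) ((D.res p).map_comp _ _)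
  constructor
  · intro H X T φ hφ
    rw [key]
    exact H _ _ _ ((isUniv_pb_iff f φ).1 hφ)
  · intro H X T φ hφ
    let φ' : ofDia X ⟶ (pb f).obj (ofDia T) := CategoryStruct.comp (obj := D.Dia A) (ofDiaValIso X).hom φ
    have e : (show (ofDia X).val ⟶ (D.res (f ⋙ 𝟭 C)).obj T from φ') ≫
        (D.resComp f (𝟭 C)).hom.app T =
        (ofDiaValIso X).hom ≫ φ ≫ (D.res f).map (ofDiaValIso T).inv := by
      rw [resComp_id_right]
      exact Category.assoc _ _ _
    have h₁ : (D.res f).IsUniv (T := (ofDia T).val)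
        ((ofDiaValIso X).hom ≫ φ ≫ (D.res f).map (ofDiaValIso T).inv) :=
      (Functor.isUniv_precomp_iff _).2 ((Functor.isUniv_comp_map_iff _).2 hφ)
    have h₂ := (key _ _ φ').1 (H _ _ φ' ((isUniv_pb_iff f φ').2
      (Eq.mpr (congrArg (Functor.IsUniv (D.res f)) e) h₁)))
    have h₃ : (D.res q).IsUniv (T := (D.res g).obj (ofDia T).val)
        ((D.res p).map (ofDiaValIso X).hom ≫ ((D.res p).map φ ≫ (D.resSquare α).app T) ≫
          (D.res q).map ((D.res g).map (ofDiaValIso T).inv)) := by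
      refine Eq.mp (congrArg (Functor.IsUniv (D.res q) (T := (D.res g).obj (ofDia T).val)) ?_) h₂
      exact (congrArg (fun t => (D.res p).map t ≫ (D.resSquare α).app (ofDia T).val) e).trans
        (map_comp_comp_eq (D.res p) ((D.resSquare α).naturality (ofDiaValIso T).inv))
    exact (Functor.isUniv_comp_map_iff _).1 ((Functor.isUniv_precomp_iff _).1 h₃)

end BaseChange

lemma exists_isUniv (hD : D.IsDerivator) {A B : Cat.{w, w}} (f : A ⥤ B) (X : D.St A) :
    ∃ (T : D.St B) (φ : X ⟶ (pb f).obj T), (pb f).IsUniv φ := by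
  have := (hD.der3 A B f).1
  let adj := Adjunction.ofIsRightAdjoint (D.res f)
  refine ⟨ofDia ((D.res f).leftAdjoint.obj X.val), adj.unit.app X.val, ?_⟩
  apply (isUniv_pb_iff f (T := ofDia _) (adj.unit.app X.val)).2
  change (D.res f).IsUniv (adj.unit.app X.val ≫ (D.resComp f (𝟭 B)).hom.app _)
  rw [resComp_id_right]
  exact (Functor.isUniv_unit adj X.val).comp_map (ofDiaValIso _).inv

lemma IsDerivator.isExact_left (hD : D.IsDerivator) {X₀ A B C : Cat.{w, w}} {p : X₀ ⥤ A}
    {q : X₀ ⥤ B} {f : A ⥤ C} {g : B ⥤ C} (α : p ⋙ f ⟶ q ⋙ g) (h : D.IsExactSquare α)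
    {X : D.St A} {T : D.St C} (φ : X ⟶ (pb f).obj T) (hφ : (pb f).IsUniv φ) :
    (pb q).IsUniv (bc α φ) := by
  have := (hD.der3 _ _ f).1
  have := (hD.der3 _ _ q).1
  exact (leftExact_iff α).1 ((Functor.isIso_mate_iff (D.resSquare α)
    (Adjunction.ofIsRightAdjoint (D.res f)) (Adjunction.ofIsRightAdjoint (D.res q))).1
      (h.1 _ _ _ _)) _ _ _ hφ

/-- Final functors preserve colimits. -/
lemma isUniv_toPt_iff {K J : Cat.{w, w}} (κ : K ⥤ J) [κ.IsRightAdjoint] {Z : D.St J}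
    {T : D.St pt.{w}} (ψ : Z ⟶ (pb (toPt J)).obj T) :
    (pb (toPt J)).IsUniv ψ ↔ (pb (toPt K)).IsUniv (T := T) ((pb κ).map ψ) := by
  let l : J ⥤ K := κ.leftAdjoint
  let adj : l ⊣ κ := Adjunction.ofIsRightAdjoint κ
  refine forall_congr' fun Y => ?_
  -- Maps from `Z` to a constant diagram are the same as maps from `κ^* Z` to it. The inverse
  -- restricts along the left adjoint `l` and precomposes with the unit; on constant diagrams the
  -- unit and the counit act as identities by `pt_hom_eq`.
  have hb : Function.Bijective (fun m : Z ⟶ (pb (toPt J)).obj Y =>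
      (show (pb κ).obj Z ⟶ (pb (toPt K)).obj Y from (pb κ).map m)) := by
    rw [Function.bijective_iff_has_inverse]
    refine ⟨fun n => tr adj.unit Z ≫ (show (pb (l ⋙ κ)).obj Z ⟶ (pb (toPt J)).obj Y from
      (pb l).map n), fun m => ?_, fun n => ?_⟩
    · dsimp only
      have h₁ := tr_naturality adj.unit m
      rw [pb_id, tr_pb, pt_hom_eq (Functor.whiskerRight adj.unit (toPt J)) (𝟙 (toPt J))] at h₁
      erw [tr_id, Category.comp_id] at h₁
      refine Eq.trans ?_ h₁.symm
      exact congrArg (tr adj.unit Z ≫ ·) (pb_pb l κ m)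
    · dsimp only
      have h₁ := tr_naturality adj.counit n
      rw [pb_id, tr_pb, pt_hom_eq (Functor.whiskerRight adj.counit (toPt K)) (𝟙 (toPt K))] at h₁
      erw [tr_id, Category.comp_id] at h₁
      erw [Functor.map_comp, pb_tr, pb_pb κ l n, h₁, tr_pb, ← Category.assoc, ← tr_comp]
      have h₂ : Functor.whiskerLeft κ adj.unit ≫ Functor.whiskerRight adj.counit κ = 𝟙 κ := by
        ext x; exact adj.right_triangle_components x
      erw [h₂, tr_id, Category.id_comp]
  rw [← Function.Bijective.of_comp_iff' hb]
  refine iff_of_eq (congrArg _ (funext fun m => ?_))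
  exact ((pb κ).map_comp ψ ((pb (toPt J)).map m)).trans
    (congrArg (fun t => (pb κ).map ψ ≫ t) (pb_pb κ (toPt J) m))

end Left

end Prederivator

/-! ### Base change of right Kan extensions, dual to the above -/

namespace Prederivator

variable {D : Prederivator.{w, v, u}}

section Right

section
variable {C₁ : Type*} [Category C₁]

lemma comp_comp_eq_of_sq' {P Q R S U : C₁} {a : S ⟶ P} {b b' : R ⟶ S} {c : Q ⟶ R} {d : U ⟶ S}
    {e e' : Q ⟶ U} (h : b = b') (h' : c ≫ b' = e ≫ d) (h'' : e' = e) :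
    c ≫ b ≫ a = e' ≫ d ≫ a := by
  subst h h''; simp [reassoc_of% h']

lemma comp_four_eq' {P Q R S U V W X : C₁} {a : P ⟶ Q} {b : R ⟶ P} {i : S ⟶ R} {t : U ⟶ S}
    {r : V ⟶ U} {s : W ⟶ V} {m : X ⟶ R} {k : W ⟶ X} {c : X ⟶ P}
    (h : s ≫ r ≫ t ≫ i = k ≫ m) (hc : c = m ≫ b) :
    s ≫ r ≫ t ≫ i ≫ b ≫ a = k ≫ c ≫ a := by
  subst hc; simp [reassoc_of% h]

lemma comp_map_comp_eq {C₂ : Type*} [Category C₂] (F : C₁ ⥤ C₂) {P Q R S : C₁} {i : Q ⟶ P}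
    {φ : R ⟶ Q} {m : S ⟶ R} {U V : C₂} {s' : V ⟶ F.obj S} {s : U ⟶ F.obj R} {k : V ⟶ U}
    (h : k ≫ s = s' ≫ F.map m) :
    s' ≫ F.map (m ≫ φ ≫ i) = k ≫ (s ≫ F.map φ) ≫ F.map i := by
  simp [reassoc_of% h]

lemma comp_eq_of_comp_eq_id {P Q R : C₁} {a a' : P ⟶ R} {n : P ⟶ Q} {t : Q ⟶ R} {b b' : R ⟶ Q}
    (h : a = a') (ha : n ≫ t = a') (hb : b = b') (h' : t ≫ b' = 𝟙 Q) : a ≫ b = n := by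
  subst h hb; simp [← ha, h']

end

section BaseChange
variable {X₀ A B C : Cat.{w, w}} {p : X₀ ⥤ A} {q : X₀ ⥤ B} {f : A ⥤ C} {g : B ⥤ C}

/-- The base change of `φ : g^* T ⟶ X` along a square. -/
def cobc (α : p ⋙ f ⟶ q ⋙ g) {X : D.St B} {T : D.St C} (φ : (pb g).obj T ⟶ X) :
    (pb p).obj ((pb f).obj T) ⟶ (pb q).obj X :=
  tr α T ≫ (pb q).map φ

lemma cobc_comp (α : p ⋙ f ⟶ q ⋙ g) {X : D.St B} {T T' : D.St C} (φ : (pb g).obj T ⟶ X)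
    (m : T' ⟶ T) : cobc α ((pb g).map m ≫ φ) = (pb p).map ((pb f).map m) ≫ cobc α φ :=
  (congrArg (tr α T' ≫ ·) ((pb q).map_comp _ φ)).trans
    (comp_comp_eq_of_sq' (C₁ := D.St X₀) (pb_pb q g m) (tr_naturality α m).symm (pb_pb p f m))

lemma isCouniv_cobc_congr {q' : X₀ ⥤ B} {f' : A ⥤ C} (α : p ⋙ f ⟶ q ⋙ g) (α' : p ⋙ f' ⟶ q' ⋙ g)
    (e : q ≅ q') (e' : f ≅ f')
    (h : ∀ x, α.app x ≫ g.map (e.hom.app x) = e'.hom.app (p.obj x) ≫ α'.app x)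
    {X : D.St B} {T : D.St C} (φ : (pb g).obj T ⟶ X) :
    (pb p).IsCouniv (cobc α φ) ↔ (pb p).IsCouniv (cobc α' φ) := by
  have h' : α ≫ Functor.whiskerRight e.hom g = Functor.whiskerLeft p e'.hom ≫ α' := by
    ext x; exact h x
  have := isIso_tr e.hom X
  have := isIso_tr e'.hom T
  rw [← Functor.isCouniv_map_comp_iff (tr e'.hom T) (φ := cobc α' φ),
    ← Functor.isCouniv_postcomp_iff (tr e.hom X) (φ := cobc α φ)]
  have : cobc α φ ≫ tr e.hom X = (pb p).map (tr e'.hom T) ≫ cobc α' φ := by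
    have h₁ := tr_naturality e.hom φ
    rw [cobc, cobc, pb_tr]
    erw [Category.assoc, h₁, ← Category.assoc, tr_pb, ← tr_comp, h', tr_comp, Category.assoc]
    rfl
  rw [this]

lemma resSquare_comp' (α : p ⋙ f ⟶ q ⋙ g) (T : D.St C) :
    (D.res p).map ((D.resComp f T.fn).inv.app T.obj) ≫ (D.resComp p (f ⋙ T.fn)).inv.app T.obj ≫
      (D.resTrans (Functor.whiskerRight α T.fn)).app T.obj ≫
      (D.resComp q (g ⋙ T.fn)).hom.app T.obj =
    (D.resSquare α).app T.val ≫ (D.res q).map ((D.resComp g T.fn).inv.app T.obj) := by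
  have h := resSquare_comp α T
  have h₁ := (D.res p).congr_map ((D.resComp f T.fn).inv_hom_id_app T.obj)
  have h₂ := (D.res q).congr_map ((D.resComp g T.fn).inv_hom_id_app T.obj)
  rw [CategoryTheory.Functor.map_comp] at h₁ h₂
  rw [CategoryTheory.Functor.map_id] at h₁ h₂
  rw [← cancel_mono ((D.res q).map ((D.resComp g T.fn).hom.app T.obj)), Category.assoc,
    Category.assoc, Category.assoc, Category.assoc, h₂]
  erw [h, Category.comp_id, ← Category.assoc, h₁, Category.id_comp]

/-- Exactness of squares, in terms of formal restrictions. -/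
lemma rightExact_iff (α : p ⋙ f ⟶ q ⋙ g) :
    (∀ (X : D.Dia B) (T : D.Dia C) (φ : (D.res g).obj T ⟶ X), (D.res g).IsCouniv φ →
      (D.res p).IsCouniv ((D.resSquare α).app T ≫ (D.res q).map φ)) ↔
    (∀ (X : D.St B) (T : D.St C) (φ : (pb g).obj T ⟶ X), (pb g).IsCouniv φ →
      (pb p).IsCouniv (cobc α φ)) := by
  have key (X : D.St B) (T : D.St C) (φ : (pb g).obj T ⟶ X) : (pb p).IsCouniv (cobc α φ) ↔
      (D.res p).IsCouniv ((D.resSquare α).app T.val ≫ (D.res q).map ((D.resComp g T.fn).inv.app T.obj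
        ≫ (show (D.res (g ⋙ T.fn)).obj T.obj ⟶ X.val from φ))) := by
    refine (isCouniv_pb_iff p (T := (pb f).obj T) (cobc α φ)).trans ?_
    refine (Functor.isCouniv_map_comp_iff (R := D.res p)
      ((D.resComp f T.fn).inv.app T.obj)).symm.trans ?_
    refine Iff.trans (iff_of_eq (congrArg (Functor.IsCouniv (D.res p) (T := (D.res f).obj T.val)) ?_))
      (Functor.isCouniv_postcomp_iff (R := D.res p) (T := (D.res f).obj T.val)
        ((D.resComp q X.fn).inv.app X.obj))
    exact (comp_four_eq' (C₁ := D.Dia X₀) (resSquare_comp' α T) ((D.res q).map_comp _ _)).trans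
      (Category.assoc (obj := D.Dia X₀) _ _ _).symm
  constructor
  · intro H X T φ hφ
    rw [key]
    exact H _ _ _ ((isCouniv_pb_iff g φ).1 hφ)
  · intro H X T φ hφ
    let φ' : (pb g).obj (ofDia T) ⟶ ofDia X :=
      CategoryStruct.comp (obj := D.Dia B) ((D.resComp g (𝟭 C)).hom.app T)
        (CategoryStruct.comp (obj := D.Dia B) ((D.res g).map (ofDiaValIso T).hom)
        (CategoryStruct.comp (obj := D.Dia B) φ (ofDiaValIso X).inv))
    have e : (D.resComp g (𝟭 C)).inv.app T ≫ (show (D.res (g ⋙ 𝟭 C)).obj T ⟶ (ofDia X).val from φ')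
        = (D.res g).map (ofDiaValIso T).hom ≫ φ ≫ (ofDiaValIso X).inv :=
      ((D.resComp g (𝟭 C)).app T).inv_hom_id_assoc _
    have h₁ : (D.res g).IsCouniv (T := (ofDia T).val)
        ((D.res g).map (ofDiaValIso T).hom ≫ φ ≫ (ofDiaValIso X).inv) :=
      (Functor.isCouniv_map_comp_iff _).2 ((Functor.isCouniv_postcomp_iff _).2 hφ)
    have h₂ := (key _ _ φ').1 (H _ _ φ' ((isCouniv_pb_iff g φ').2
      (Eq.mpr (congrArg (Functor.IsCouniv (D.res g)) e) h₁)))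
    have h₃ : (D.res p).IsCouniv (T := (D.res f).obj (ofDia T).val)
        ((D.res p).map ((D.res f).map (ofDiaValIso T).hom) ≫
          ((D.resSquare α).app T ≫ (D.res q).map φ) ≫ (D.res q).map (ofDiaValIso X).inv) := by
      refine Eq.mp (congrArg (Functor.IsCouniv (D.res p) (T := (D.res f).obj (ofDia T).val)) ?_) h₂
      exact (congrArg (fun t => (D.resSquare α).app (ofDia T).val ≫ (D.res q).map t) e).trans
        (comp_map_comp_eq (D.res q) ((D.resSquare α).naturality (ofDiaValIso T).hom))
    exact (Functor.isCouniv_postcomp_iff _).1 ((Functor.isCouniv_map_comp_iff _).1 h₃)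

end BaseChange

lemma exists_isCouniv (hD : D.IsDerivator) {A B : Cat.{w, w}} (f : A ⥤ B) (X : D.St A) :
    ∃ (T : D.St B) (φ : (pb f).obj T ⟶ X), (pb f).IsCouniv φ := by
  have := (hD.der3 A B f).2
  let adj := Adjunction.ofIsLeftAdjoint (D.res f)
  let T := (D.res f).rightAdjoint.obj X.val
  let φ : (pb f).obj (ofDia T) ⟶ X := CategoryStruct.comp (obj := D.Dia A)
    ((D.resComp f (𝟭 B)).hom.app T) (CategoryStruct.comp (obj := D.Dia A)
      ((D.res f).map (ofDiaValIso T).hom) (adj.counit.app X.val))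
  refine ⟨ofDia T, φ, (isCouniv_pb_iff f φ).2 ?_⟩
  have e : (D.resComp f (𝟭 B)).inv.app T ≫ (show (D.res (f ⋙ 𝟭 B)).obj T ⟶ X.val from φ)
      = (D.res f).map (ofDiaValIso T).hom ≫ adj.counit.app X.val :=
    ((D.resComp f (𝟭 B)).app T).inv_hom_id_assoc _
  exact Eq.mpr (congrArg (Functor.IsCouniv (D.res f) (T := (ofDia T).val)) e)
    ((Functor.isCouniv_counit adj X.val).map_comp (ofDiaValIso _).hom)

lemma IsDerivator.isExact_right (hD : D.IsDerivator) {X₀ A B C : Cat.{w, w}} {p : X₀ ⥤ A}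
    {q : X₀ ⥤ B} {f : A ⥤ C} {g : B ⥤ C} (α : p ⋙ f ⟶ q ⋙ g) (h : D.IsExactSquare α)
    {X : D.St B} {T : D.St C} (φ : (pb g).obj T ⟶ X) (hφ : (pb g).IsCouniv φ) :
    (pb p).IsCouniv (cobc α φ) := by
  have := (hD.der3 _ _ g).2
  have := (hD.der3 _ _ p).2
  exact (rightExact_iff α).1 ((Functor.isIso_mate_iff' (D.resSquare α)
    (Adjunction.ofIsLeftAdjoint (D.res g)) (Adjunction.ofIsLeftAdjoint (D.res p))).1
      (h.2 _ _ _ _)) _ _ _ hφ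

/-- Initial functors preserve limits. -/
lemma isCouniv_toPt_iff {K J : Cat.{w, w}} (κ : K ⥤ J) [κ.IsLeftAdjoint] {Z : D.St J}
    {T : D.St pt.{w}} (ψ : (pb (toPt J)).obj T ⟶ Z) :
    (pb (toPt J)).IsCouniv ψ ↔ (pb (toPt K)).IsCouniv (T := T) ((pb κ).map ψ) := by
  let r : J ⥤ K := κ.rightAdjoint
  let adj : κ ⊣ r := Adjunction.ofIsLeftAdjoint κ
  refine forall_congr' fun Y => ?_
  -- Dually, the inverse restricts along the right adjoint `r` and composes with the counit.
  have hb : Function.Bijective (fun m : (pb (toPt J)).obj Y ⟶ Z =>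
      (show (pb (toPt K)).obj Y ⟶ (pb κ).obj Z from (pb κ).map m)) := by
    rw [Function.bijective_iff_has_inverse]
    refine ⟨fun n => (show (pb (toPt J)).obj Y ⟶ (pb (r ⋙ κ)).obj Z from (pb r).map n) ≫
      tr adj.counit Z, fun m => ?_, fun n => ?_⟩
    · dsimp only
      have h₁ := tr_naturality adj.counit m
      rw [pb_id, tr_pb, pt_hom_eq (Functor.whiskerRight adj.counit (toPt J)) (𝟙 (toPt J))] at h₁
      erw [tr_id, Category.id_comp] at h₁
      refine Eq.trans ?_ h₁
      exact congrArg (· ≫ tr adj.counit Z) (pb_pb r κ m)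
    · dsimp only
      have e : tr adj.unit ((pb (toPt K)).obj Y) = 𝟙 _ := (congrArg (fun t => tr t Y)
        (pt_hom_eq (Functor.whiskerRight adj.unit (toPt K)) (𝟙 (toPt K)))).trans (tr_id (toPt K) Y)
      have h₁ : n ≫ tr (Functor.whiskerRight adj.unit κ) Z = (pb (κ ⋙ r)).map n :=
        (congrArg (· ≫ tr adj.unit ((pb κ).obj Z)) (pb_id n)).symm.trans
          ((tr_naturality adj.unit n).trans ((congrArg (· ≫ (pb (κ ⋙ r)).map n) e).trans
            (Category.id_comp _)))
      have h₂ : Functor.whiskerRight adj.unit κ ≫ Functor.whiskerLeft κ adj.counit = 𝟙 κ := by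
        ext x; exact adj.left_triangle_components x
      exact ((pb κ).map_comp ((pb r).map n) (tr adj.counit Z)).trans
        (comp_eq_of_comp_eq_id (C₁ := D.St K) (pb_pb κ r n) h₁ (pb_tr κ adj.counit Z)
          ((tr_comp _ _ Z).symm.trans ((congrArg (fun t => tr t Z) h₂).trans (tr_id κ Z))))
  rw [← Function.Bijective.of_comp_iff' hb]
  refine iff_of_eq (congrArg _ (funext fun m => ?_))
  exact ((pb κ).map_comp ((pb (toPt J)).map m) ψ).trans
    (congrArg (fun t => t ≫ (pb κ).map ψ) (pb_pb κ (toPt J) m))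

end Right

end Prederivator

namespace Prederivator

variable {D : Prederivator.{w, v, u}}

/-! ### Kan extensions are computed pointwise -/

/-- The projection from the slice category. -/
def projOver {A C : Cat.{w, w}} (f : A ⥤ C) (c : C) : sliceOver f c ⥤ A :=
  CostructuredArrow.proj f c

/-- The projection from the slice category. -/
def projUnder {A C : Cat.{w, w}} (f : A ⥤ C) (c : C) : sliceUnder f c ⥤ A :=
  StructuredArrow.proj c f

/-- The transformation of the slice square of `(f/c)`. -/
def overTrans {A C : Cat.{w, w}} (f : A ⥤ C) (c : C) :
    projOver f c ⋙ f ⟶ toPt (sliceOver f c) ⋙ ptAt c :=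
  sliceOverTrans f c

/-- The transformation of the slice square of `(c/f)`. -/
def underTrans {A C : Cat.{w, w}} (f : A ⥤ C) (c : C) :
    toPt (sliceUnder f c) ⋙ ptAt c ⟶ projUnder f c ⋙ f :=
  sliceUnderTrans f c

/-- The functor `f × id`. -/
def prodId {A C : Cat.{w, w}} (f : A ⥤ C) (I : Cat.{w, w}) : Cat.of (A × I) ⥤ Cat.of (C × I) :=
  f.prod (𝟭 I)

/-- The functor `a ↦ (a, i)`. -/
def sectL (A : Cat.{w, w}) {I : Cat.{w, w}} (i : I) : A ⥤ Cat.of (A × I) := Prod.sectL A i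

/-- The functor `a ↦ (i, a)`. -/
def sectR (A : Cat.{w, w}) {I : Cat.{w, w}} (i : I) : A ⥤ Cat.of (I × A) := Prod.sectR i A

section Left

/-- The values `X_a`, for the pairs `(a, f a ⟶ c)`, are computed on the subcategory of the pairs
`(q k, γ k)`. -/
def IsFinalAt {A C K : Cat.{w, w}} (f : A ⥤ C) (c : C) (q : K ⥤ A)
    (γ : q ⋙ f ⟶ toPt K ⋙ ptAt c) : Prop :=
  ∀ (a : A) (h : f.obj a ⟶ c), ∃ (k : K) (e : a ⟶ q.obj k), f.map e ≫ γ.app k = h ∧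
    ∀ (k' : K) (e' : a ⟶ q.obj k'), f.map e' ≫ γ.app k' = h → ∃! m : k ⟶ k', e ≫ q.map m = e'

/-- The functor to the slice category induced by a square. -/
def sliceLift {A C K : Cat.{w, w}} {f : A ⥤ C} {c : C} (q : K ⥤ A)
    (γ : q ⋙ f ⟶ toPt K ⋙ ptAt c) : K ⥤ sliceOver f c where
  obj k := CostructuredArrow.mk (γ.app k)
  map m := CostructuredArrow.homMk (q.map m) ((γ.naturality m).trans (Category.comp_id _))
  map_id k := CostructuredArrow.hom_ext _ _ (q.map_id k)
  map_comp m n := CostructuredArrow.hom_ext _ _ (q.map_comp m n)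

/-- The condition provides, for each object `(a, h)` of the slice, an initial arrow from it to
`sliceLift q γ`; this is the value of a left adjoint at `(a, h)`. -/
lemma IsFinalAt.isRightAdjoint {A C K : Cat.{w, w}} {f : A ⥤ C} {c : C} {q : K ⥤ A}
    {γ : q ⋙ f ⟶ toPt K ⋙ ptAt c} (h : IsFinalAt f c q γ) : (sliceLift q γ).IsRightAdjoint := by
  choose k e he hu using fun X : CostructuredArrow f c => h X.left X.hom
  refine Functor.exists_adjunction k (fun X => CostructuredArrow.homMk (e X) (he X)) fun X Y => ?_
  constructor
  · intro m m' hm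
    have hm' := congrArg CommaMorphism.left hm
    obtain ⟨n, hn, hn'⟩ := hu X Y (e X ≫ q.map m) (by
      have := (γ.naturality m).trans (Category.comp_id (γ.app (k X)))
      exact ((congrArg (· ≫ γ.app Y) (f.map_comp _ _)).trans (Category.assoc _ _ _)).trans
        ((congrArg (f.map (e X) ≫ ·) this).trans (he X)))
    exact (hn' m rfl).trans (hn' m' hm'.symm).symm
  · intro g
    obtain ⟨n, hn, -⟩ := hu X Y g.left (CostructuredArrow.w g)
    exact ⟨n, CostructuredArrow.hom_ext _ _ hn⟩

/-- `φ : X ⟶ f^* T` exhibits `T` as the left Kan extension of `X` at `c`. -/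
def IsUnivAt {A C : Cat.{w, w}} (f : A ⥤ C) (c : C) {X : D.St A} {T : D.St C}
    (φ : X ⟶ (pb f).obj T) : Prop :=
  (pb (toPt (sliceOver f c))).IsUniv (bc (overTrans f c) φ)

lemma subsingleton_pt_hom (x y : pt.{w}) : Subsingleton (x ⟶ y) :=
  inferInstanceAs (Subsingleton ((show Discrete PUnit from x) ⟶ (show Discrete PUnit from y)))

lemma comp_congr {C₁ : Type*} [Category C₁] {P Q R : C₁} {a a' : P ⟶ Q} {b b' : Q ⟶ R}
    (h : a = a') (h' : b = b') : a ≫ b = a' ≫ b' := by rw [h, h']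

lemma comp_assoc_eq_of_eq_id {C₁ : Type*} [Category C₁] {P Q : C₁} {a : P ⟶ Q} {b : Q ⟶ P}
    (h : a ≫ b = 𝟙 P) : a ≫ b ≫ a = a ≫ 𝟙 Q := by simp [reassoc_of% h]

/-- `sliceLift q γ` has a left adjoint, so colimits over the slice can be computed after restriction
along it, and the slice square restricts to the square of `γ`. -/
lemma isUnivAt_iff {A C K : Cat.{w, w}} {f : A ⥤ C} {c : C} {q : K ⥤ A}
    {γ : q ⋙ f ⟶ toPt K ⋙ ptAt c} (h : IsFinalAt f c q γ) {X : D.St A} {T : D.St C}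
    (φ : X ⟶ (pb f).obj T) : IsUnivAt f c φ ↔ (pb (toPt K)).IsUniv (bc γ φ) := by
  have := h.isRightAdjoint
  refine (isUniv_toPt_iff (sliceLift q γ) _).trans (iff_of_eq (congrArg _ ?_))
  exact ((pb (sliceLift q γ)).map_comp ((pb (projOver f c)).map φ)
    (tr (overTrans f c) T)).trans (comp_congr (C₁ := D.St K)
      (pb_pb (sliceLift q γ) (projOver f c) φ)
      (pb_tr (sliceLift q γ) (overTrans f c) T))

/-- One direction is (Der4). For the other, `φ` is compared with an actual Kan extension: at every
`c` both are universal, so the comparison map is pointwise invertible and (Der2) applies. -/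
lemma isUniv_iff_isUnivAt (hD : D.IsDerivator) {A C : Cat.{w, w}} (f : A ⥤ C) {X : D.St A}
    {T : D.St C} (φ : X ⟶ (pb f).obj T) : (pb f).IsUniv φ ↔ ∀ c, IsUnivAt f c φ := by
  constructor
  · intro h c
    exact hD.isExact_left _ (hD.der4 A C f c).1 φ h
  · intro h
    obtain ⟨T', φ', hφ'⟩ := exists_isUniv hD f X
    obtain ⟨m, hm⟩ := hφ'.exists_lift φ
    have : IsIso m := by
      refine isIso_of_eval hD m fun c => ?_
      have h₁ := hD.isExact_left _ (hD.der4 A C f c).1 φ' hφ'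
      have h₂ := h c
      rw [← hm] at h₂
      exact h₁.isIso (Eq.mp (congrArg (Functor.IsUniv _) (bc_comp (overTrans f c) φ' m)) h₂)
    rw [← hm]
    exact hφ'.comp_map m

lemma isUniv_toPt_pt_iff {X T : D.St pt.{w}} (φ : X ⟶ (pb (toPt pt)).obj T) :
    (pb (toPt pt)).IsUniv φ ↔ IsIso φ := by
  have e (Y : D.St pt.{w}) : (fun f : T ⟶ Y => φ ≫ (pb (toPt pt)).map f) =
    (fun f : T ⟶ Y => CategoryStruct.comp (obj := D.St pt) (Y := T) φ f) :=
      funext fun f => congrArg (fun t => CategoryStruct.comp (obj := D.St pt) (Y := T) φ t) (pb_id f)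
  constructor
  · intro h
    obtain ⟨g, hg⟩ := (e X ▸ h X).2 (𝟙 X)
    have h' := h T
    rw [e] at h'
    refine ⟨g, hg, h'.1 ?_⟩
    exact comp_assoc_eq_of_eq_id (C₁ := D.St pt) (Q := T) hg
  · intro h Y
    have h' : IsIso (C := D.St pt) (Y := T) φ := h
    rw [e]
    exact bijective_comp_left (Y := T) φ Y

/-- For fully faithful `f` the slice over `f a` has the terminal object `(a, 𝟙)`, so the colimit
over it is the value at `a`. -/
lemma isUnivAt_obj_iff {A C : Cat.{w, w}} (f : A ⥤ C) [f.Full] [f.Faithful] (a : A) {X : D.St A}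
    {T : D.St C} (φ : X ⟶ (pb f).obj T) :
    IsUnivAt f (f.obj a) φ ↔ IsIso ((pb (ptAt a)).map φ) := by
  let γ : ptAt a ⋙ f ≅ toPt pt ⋙ ptAt (f.obj a) :=
    NatIso.ofComponents (fun _ => Iso.refl (f.obj a))
      (fun _ => (Category.comp_id _).trans ((f.map_id a).trans (Category.id_comp (𝟙 (f.obj a))).symm))
  have hf : IsFinalAt f (f.obj a) (ptAt a) γ.hom := by
    intro a' h
    refine ⟨⟨PUnit.unit⟩, f.preimage h, (Category.comp_id _).trans (f.map_preimage h),
      fun k' e' h' => ⟨𝟙 _, ?_, fun _ _ => (subsingleton_pt_hom _ _).elim _ _⟩⟩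
    exact (Category.comp_id _).trans
      (f.map_injective ((f.map_preimage h).trans (h'.symm.trans (Category.comp_id _))))
  have hi := isIso_tr γ.hom T
  rw [isUnivAt_iff hf, isUniv_toPt_pt_iff]
  exact @isIso_comp_right_iff (D.St pt) _ _ _ _ _ _ hi

/-- Kan extensions along fully faithful functors are extensions. -/
lemma IsUniv.isIso_of_fullyFaithful (hD : D.IsDerivator) {A C : Cat.{w, w}} (f : A ⥤ C) [f.Full]
    [f.Faithful] {X : D.St A} {T : D.St C} {φ : X ⟶ (pb f).obj T} (h : (pb f).IsUniv φ) :
    IsIso φ :=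
  isIso_of_eval hD φ fun a => (isUnivAt_obj_iff f a φ).1 ((isUniv_iff_isUnivAt hD f φ).1 h _)

/-- At the objects of the image, pointwise universality only says that `φ` is invertible; the
content lies outside the image. -/
lemma isUniv_iff_of_fullyFaithful (hD : D.IsDerivator) {A C : Cat.{w, w}} (f : A ⥤ C) [f.Full]
    [f.Faithful] {X : D.St A} {T : D.St C} (φ : X ⟶ (pb f).obj T) : (pb f).IsUniv φ ↔
      IsIso φ ∧ ∀ c ∉ Set.range f.obj, IsUnivAt f c φ := by
  refine ⟨fun h => ⟨IsUniv.isIso_of_fullyFaithful hD f h, fun c _ =>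
    (isUniv_iff_isUnivAt hD f φ).1 h c⟩, fun h => (isUniv_iff_isUnivAt hD f φ).2 fun c => ?_⟩
  by_cases hc : c ∈ Set.range f.obj
  · obtain ⟨a, rfl⟩ := hc
    have := h.1
    exact (isUnivAt_obj_iff f a φ).2 inferInstance
  · exact h.2 c hc

/-- The slice of `f × id` over `(c, i)` is the product of `(f/c)` with the slice `I/i`. The latter
has the terminal object `𝟙 i`, so the copy of `(f/c)` at `i` is final. -/
lemma IsFinalAt.prod_id {A C K I : Cat.{w, w}} {f : A ⥤ C} {c : C} {q : K ⥤ A}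
    {γ : q ⋙ f ⟶ toPt K ⋙ ptAt c} (h : IsFinalAt f c q γ) (i : I) :
    IsFinalAt (prodId f I) (c, i)
      (q ⋙ sectL A i) (Functor.whiskerRight γ (sectL C i)) := by
  rintro ⟨a, j⟩ ⟨h₁, h₂⟩
  obtain ⟨k, e, he, hu⟩ := h a h₁
  refine ⟨k, (e, h₂), Prod.ext he (Category.comp_id h₂), ?_⟩
  rintro k' ⟨e', j'⟩ h'
  obtain ⟨m, hm, hm'⟩ := hu k' e' (congrArg Prod.fst h')
  have hj : h₂ = j' := ((Category.comp_id j').symm.trans (congrArg Prod.snd h')).symm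
  exact ⟨m, Prod.ext hm ((Category.comp_id h₂).trans hj), fun n hn => hm' n (congrArg Prod.fst hn)⟩

lemma IsFinalAt.id_prod {A C K I : Cat.{w, w}} {f : A ⥤ C} {c : C} {q : K ⥤ A}
    {γ : q ⋙ f ⟶ toPt K ⋙ ptAt c} (h : IsFinalAt f c q γ) (i : I) :
    IsFinalAt (prodFun I f) (i, c)
      (q ⋙ sectR A i) (Functor.whiskerRight γ (sectR C i)) := by
  rintro ⟨j, a⟩ ⟨h₂, h₁⟩
  obtain ⟨k, e, he, hu⟩ := h a h₁
  refine ⟨k, (h₂, e), Prod.ext (Category.comp_id h₂) he, ?_⟩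
  rintro k' ⟨j', e'⟩ h'
  obtain ⟨m, hm, hm'⟩ := hu k' e' (congrArg Prod.snd h')
  have hj : h₂ = j' := ((Category.comp_id j').symm.trans (congrArg Prod.fst h')).symm
  exact ⟨m, Prod.ext ((Category.comp_id h₂).trans hj) hm, fun n hn => hm' n (congrArg Prod.snd hn)⟩

lemma isFinalAt_slice {A C : Cat.{w, w}} (f : A ⥤ C) (c : C) :
    IsFinalAt f c (projOver f c) (overTrans f c) := by
  intro a h
  refine ⟨CostructuredArrow.mk h, 𝟙 a, (congrArg (· ≫ h) (f.map_id a)).trans (Category.id_comp h),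
    fun k' e' h' => ⟨CostructuredArrow.homMk e' h', Category.id_comp _, fun n hn => ?_⟩⟩
  exact CostructuredArrow.hom_ext _ _ ((Category.id_comp _).symm.trans hn)

/-- Kan extensions along `f × id` are computed parameterwise. -/
lemma isUniv_prod_id_iff (hD : D.IsDerivator) {A C I : Cat.{w, w}} (f : A ⥤ C)
    {X : D.St (Cat.of (A × I))} {T : D.St (Cat.of (C × I))}
    (φ : X ⟶ (pb (prodId f I)).obj T) :
    (pb (prodId f I)).IsUniv φ ↔
      ∀ i : I, (pb f).IsUniv (T := (pb (sectL C i)).obj T)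
        ((pb (sectL A i)).map φ) := by
  refine (isUniv_iff_isUnivAt hD _ φ).trans (Iff.trans ?_
    (forall_congr' fun i => isUniv_iff_isUnivAt hD f _).symm)
  have (c : C) (i : I) := (isUnivAt_iff ((isFinalAt_slice f c).prod_id i) φ).trans
    (iff_of_eq (congrArg (fun t => (pb (toPt _)).IsUniv (T := (pb (ptAt c)).obj
      ((pb (sectL C i)).obj T)) t)
      (congrArg (CategoryStruct.comp (obj := D.St _) · (tr (overTrans f c)
        ((pb (sectL C i)).obj T)))
      (pb_pb (projOver f c) (sectL A i) φ)))).symm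
  exact ⟨fun h i c => (this c i).1 (h (c, i)), fun h c => (this c.1 c.2).2 (h c.2 c.1)⟩

/-- Kan extensions along `id × f` are computed parameterwise. -/
lemma isUniv_id_prod_iff (hD : D.IsDerivator) {A C I : Cat.{w, w}} (f : A ⥤ C)
    {X : D.St (Cat.of (I × A))} {T : D.St (Cat.of (I × C))}
    (φ : X ⟶ (pb (prodFun I f)).obj T) :
    (pb (prodFun I f)).IsUniv φ ↔
      ∀ i : I, (pb f).IsUniv (T := (pb (sectR C i)).obj T)
        ((pb (sectR A i)).map φ) := by
  refine (isUniv_iff_isUnivAt hD _ φ).trans (Iff.trans ?_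
    (forall_congr' fun i => isUniv_iff_isUnivAt hD f _).symm)
  have (c : C) (i : I) := (isUnivAt_iff ((isFinalAt_slice f c).id_prod i) φ).trans
    (iff_of_eq (congrArg (fun t => (pb (toPt _)).IsUniv (T := (pb (ptAt c)).obj
      ((pb (sectR C i)).obj T)) t)
      (congrArg (CategoryStruct.comp (obj := D.St _) · (tr (overTrans f c)
        ((pb (sectR C i)).obj T)))
      (pb_pb (projOver f c) (sectR A i) φ)))).symm
  exact ⟨fun h i c => (this c i).1 (h (i, c)), fun h c => (this c.2 c.1).2 (h c.1 c.2)⟩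

end Left

end Prederivator

/-! ### Pointwise right Kan extensions, dual to the above -/

namespace Prederivator

variable {D : Prederivator.{w, v, u}}

section Right

/-- The values `X_a`, for the pairs `(a, c ⟶ f a)`, are computed on the subcategory of the pairs
`(q k, γ k)`. -/
def IsInitialAt {A C K : Cat.{w, w}} (f : A ⥤ C) (c : C) (q : K ⥤ A)
    (γ : toPt K ⋙ ptAt c ⟶ q ⋙ f) : Prop :=
  ∀ (a : A) (h : c ⟶ f.obj a), ∃ (k : K) (e : q.obj k ⟶ a), γ.app k ≫ f.map e = h ∧
    ∀ (k' : K) (e' : q.obj k' ⟶ a), γ.app k' ≫ f.map e' = h → ∃! m : k' ⟶ k, q.map m ≫ e = e'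

/-- The functor to the slice category induced by a square. -/
def sliceLiftUnder {A C K : Cat.{w, w}} {f : A ⥤ C} {c : C} (q : K ⥤ A)
    (γ : toPt K ⋙ ptAt c ⟶ q ⋙ f) : K ⥤ sliceUnder f c where
  obj k := StructuredArrow.mk (γ.app k)
  map m := StructuredArrow.homMk (q.map m) ((γ.naturality m).symm.trans (Category.id_comp _))
  map_id k := StructuredArrow.hom_ext _ _ (q.map_id k)
  map_comp m n := StructuredArrow.hom_ext _ _ (q.map_comp m n)

lemma IsInitialAt.isLeftAdjoint {A C K : Cat.{w, w}} {f : A ⥤ C} {c : C} {q : K ⥤ A}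
    {γ : toPt K ⋙ ptAt c ⟶ q ⋙ f} (h : IsInitialAt f c q γ) :
    (sliceLiftUnder q γ).IsLeftAdjoint := by
  choose k e he hu using fun X : StructuredArrow c f => h X.right X.hom
  refine Functor.exists_adjunction' k (fun X => StructuredArrow.homMk (e X) (he X)) fun X Y => ?_
  constructor
  · intro m m' hm
    have hm' := congrArg CommaMorphism.right hm
    obtain ⟨n, hn, hn'⟩ := hu X Y (q.map m ≫ e X) (by
      have := (γ.naturality m).symm.trans (Category.id_comp (γ.app (k X)))
      exact ((congrArg (γ.app Y ≫ ·) (f.map_comp _ _)).trans (Category.assoc _ _ _).symm).trans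
        ((congrArg (· ≫ f.map (e X)) this).trans (he X)))
    exact (hn' m rfl).trans (hn' m' hm'.symm).symm
  · intro g
    obtain ⟨n, hn, -⟩ := hu X Y g.right (StructuredArrow.w g)
    exact ⟨n, StructuredArrow.hom_ext _ _ hn⟩

/-- `φ : f^* T ⟶ X` exhibits `T` as the right Kan extension of `X` at `c`. -/
def IsCounivAt {A C : Cat.{w, w}} (f : A ⥤ C) (c : C) {X : D.St A} {T : D.St C}
    (φ : (pb f).obj T ⟶ X) : Prop :=
  (pb (toPt (sliceUnder f c))).IsCouniv (cobc (underTrans f c) φ)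

lemma isCounivAt_iff {A C K : Cat.{w, w}} {f : A ⥤ C} {c : C} {q : K ⥤ A}
    {γ : toPt K ⋙ ptAt c ⟶ q ⋙ f} (h : IsInitialAt f c q γ) {X : D.St A} {T : D.St C}
    (φ : (pb f).obj T ⟶ X) : IsCounivAt f c φ ↔ (pb (toPt K)).IsCouniv (cobc γ φ) := by
  have := h.isLeftAdjoint
  refine (isCouniv_toPt_iff (sliceLiftUnder q γ) _).trans (iff_of_eq (congrArg _ ?_))
  exact ((pb (sliceLiftUnder q γ)).map_comp (tr (underTrans f c) T)
    ((pb (projUnder f c)).map φ)).trans (comp_congr (C₁ := D.St K)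
      (pb_tr (sliceLiftUnder q γ) (underTrans f c) T)
      (pb_pb (sliceLiftUnder q γ) (projUnder f c) φ))

/-- As for left Kan extensions: (Der4) in one direction, comparison with an actual right Kan
extension and (Der2) in the other. -/
lemma isCouniv_iff_isCounivAt (hD : D.IsDerivator) {A C : Cat.{w, w}} (f : A ⥤ C) {X : D.St A}
    {T : D.St C} (φ : (pb f).obj T ⟶ X) : (pb f).IsCouniv φ ↔ ∀ c, IsCounivAt f c φ := by
  constructor
  · intro h c
    exact hD.isExact_right _ (hD.der4 A C f c).2 φ h
  · intro h
    obtain ⟨T', φ', hφ'⟩ := exists_isCouniv hD f X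
    obtain ⟨m, hm⟩ := hφ'.exists_lift φ
    have : IsIso m := by
      refine isIso_of_eval hD m fun c => ?_
      have h₁ := hD.isExact_right _ (hD.der4 A C f c).2 φ' hφ'
      have h₂ := h c
      rw [← hm] at h₂
      exact h₁.isIso (Eq.mp (congrArg (Functor.IsCouniv _) (cobc_comp (underTrans f c) φ' m)) h₂)
    rw [← hm]
    exact hφ'.map_comp m

lemma comp_assoc_eq_of_eq_id' {C₁ : Type*} [Category C₁] {P Q : C₁} {a : P ⟶ Q} {b : Q ⟶ P}
    (h : b ≫ a = 𝟙 Q) : (a ≫ b) ≫ a = 𝟙 P ≫ a := by simp [h]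

lemma isCouniv_toPt_pt_iff {X T : D.St pt.{w}} (φ : (pb (toPt pt)).obj T ⟶ X) :
    (pb (toPt pt)).IsCouniv φ ↔ IsIso φ := by
  have e (Y : D.St pt.{w}) : (fun f : Y ⟶ T => (pb (toPt pt)).map f ≫ φ) =
    (fun f : Y ⟶ T => CategoryStruct.comp (obj := D.St pt) (Y := T) f φ) :=
      funext fun f => congrArg (fun t => CategoryStruct.comp (obj := D.St pt) (Y := T) t φ) (pb_id f)
  constructor
  · intro h
    obtain ⟨g, hg⟩ := (e X ▸ h X).2 (𝟙 X)
    have h' := h T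
    rw [e] at h'
    refine ⟨g, h'.1 ?_, hg⟩
    exact comp_assoc_eq_of_eq_id' (C₁ := D.St pt) (P := T) hg
  · intro h Y
    have h' : IsIso (C := D.St pt) (X := T) φ := h
    rw [e]
    exact bijective_comp_right (X := T) φ Y

lemma isCounivAt_obj_iff {A C : Cat.{w, w}} (f : A ⥤ C) [f.Full] [f.Faithful] (a : A) {X : D.St A}
    {T : D.St C} (φ : (pb f).obj T ⟶ X) :
    IsCounivAt f (f.obj a) φ ↔ IsIso ((pb (ptAt a)).map φ) := by
  let γ : toPt pt ⋙ ptAt (f.obj a) ≅ ptAt a ⋙ f :=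
    NatIso.ofComponents (fun _ => Iso.refl (f.obj a))
      (fun _ => (Category.comp_id _).trans ((f.map_id a).symm.trans (Category.id_comp _).symm))
  have hf : IsInitialAt f (f.obj a) (ptAt a) γ.hom := by
    intro a' h
    refine ⟨⟨PUnit.unit⟩, f.preimage h, (Category.id_comp _).trans (f.map_preimage h),
      fun k' e' h' => ⟨𝟙 _, ?_, fun _ _ => (subsingleton_pt_hom _ _).elim _ _⟩⟩
    exact (Category.id_comp _).trans
      (f.map_injective ((f.map_preimage h).trans (h'.symm.trans (Category.id_comp _))))
  have hi := isIso_tr γ.hom T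
  rw [isCounivAt_iff hf, isCouniv_toPt_pt_iff]
  exact @isIso_comp_left_iff (D.St pt) _ _ _ _ _ _ hi

/-- Kan extensions along fully faithful functors are extensions. -/
lemma IsCouniv.isIso_of_fullyFaithful (hD : D.IsDerivator) {A C : Cat.{w, w}} (f : A ⥤ C) [f.Full]
    [f.Faithful] {X : D.St A} {T : D.St C} {φ : (pb f).obj T ⟶ X} (h : (pb f).IsCouniv φ) :
    IsIso φ :=
  isIso_of_eval hD φ fun a => (isCounivAt_obj_iff f a φ).1 ((isCouniv_iff_isCounivAt hD f φ).1 h _)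

lemma isCouniv_iff_of_fullyFaithful (hD : D.IsDerivator) {A C : Cat.{w, w}} (f : A ⥤ C) [f.Full]
    [f.Faithful] {X : D.St A} {T : D.St C} (φ : (pb f).obj T ⟶ X) : (pb f).IsCouniv φ ↔
      IsIso φ ∧ ∀ c ∉ Set.range f.obj, IsCounivAt f c φ := by
  refine ⟨fun h => ⟨IsCouniv.isIso_of_fullyFaithful hD f h, fun c _ =>
    (isCouniv_iff_isCounivAt hD f φ).1 h c⟩,
    fun h => (isCouniv_iff_isCounivAt hD f φ).2 fun c => ?_⟩
  by_cases hc : c ∈ Set.range f.obj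
  · obtain ⟨a, rfl⟩ := hc
    have := h.1
    exact (isCounivAt_obj_iff f a φ).2 inferInstance
  · exact h.2 c hc

lemma IsInitialAt.prod_id {A C K I : Cat.{w, w}} {f : A ⥤ C} {c : C} {q : K ⥤ A}
    {γ : toPt K ⋙ ptAt c ⟶ q ⋙ f} (h : IsInitialAt f c q γ) (i : I) :
    IsInitialAt (prodId f I) (c, i)
      (q ⋙ sectL A i) (Functor.whiskerRight γ (sectL C i)) := by
  rintro ⟨a, j⟩ ⟨h₁, h₂⟩
  obtain ⟨k, e, he, hu⟩ := h a h₁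
  refine ⟨k, (e, h₂), Prod.ext he (Category.id_comp h₂), ?_⟩
  rintro k' ⟨e', j'⟩ h'
  obtain ⟨m, hm, hm'⟩ := hu k' e' (congrArg Prod.fst h')
  have hj : h₂ = j' := ((Category.id_comp j').symm.trans (congrArg Prod.snd h')).symm
  exact ⟨m, Prod.ext hm ((Category.id_comp h₂).trans hj), fun n hn => hm' n (congrArg Prod.fst hn)⟩

lemma IsInitialAt.id_prod {A C K I : Cat.{w, w}} {f : A ⥤ C} {c : C} {q : K ⥤ A}
    {γ : toPt K ⋙ ptAt c ⟶ q ⋙ f} (h : IsInitialAt f c q γ) (i : I) :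
    IsInitialAt (prodFun I f) (i, c)
      (q ⋙ sectR A i) (Functor.whiskerRight γ (sectR C i)) := by
  rintro ⟨j, a⟩ ⟨h₂, h₁⟩
  obtain ⟨k, e, he, hu⟩ := h a h₁
  refine ⟨k, (h₂, e), Prod.ext (Category.id_comp h₂) he, ?_⟩
  rintro k' ⟨j', e'⟩ h'
  obtain ⟨m, hm, hm'⟩ := hu k' e' (congrArg Prod.snd h')
  have hj : h₂ = j' := ((Category.id_comp j').symm.trans (congrArg Prod.fst h')).symm
  exact ⟨m, Prod.ext ((Category.id_comp h₂).trans hj) hm, fun n hn => hm' n (congrArg Prod.snd hn)⟩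

lemma isInitialAt_slice {A C : Cat.{w, w}} (f : A ⥤ C) (c : C) :
    IsInitialAt f c (projUnder f c) (underTrans f c) := by
  intro a h
  refine ⟨StructuredArrow.mk h, 𝟙 a, (congrArg (h ≫ ·) (f.map_id a)).trans (Category.comp_id h),
    fun k' e' h' => ⟨StructuredArrow.homMk e' h', Category.comp_id _, fun n hn => ?_⟩⟩
  exact StructuredArrow.hom_ext _ _ ((Category.comp_id _).symm.trans hn)

/-- Kan extensions along `f × id` are computed parameterwise. -/
lemma isCouniv_prod_id_iff (hD : D.IsDerivator) {A C I : Cat.{w, w}} (f : A ⥤ C)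
    {X : D.St (Cat.of (A × I))} {T : D.St (Cat.of (C × I))}
    (φ : (pb (prodId f I)).obj T ⟶ X) :
    (pb (prodId f I)).IsCouniv φ ↔
      ∀ i : I, (pb f).IsCouniv (T := (pb (sectL C i)).obj T)
        ((pb (sectL A i)).map φ) := by
  refine (isCouniv_iff_isCounivAt hD _ φ).trans (Iff.trans ?_
    (forall_congr' fun i => isCouniv_iff_isCounivAt hD f _).symm)
  have (c : C) (i : I) := (isCounivAt_iff ((isInitialAt_slice f c).prod_id i) φ).trans
    (iff_of_eq (congrArg (fun t => (pb (toPt _)).IsCouniv (T := (pb (ptAt c)).obj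
      ((pb (sectL C i)).obj T)) t)
      (congrArg (CategoryStruct.comp (obj := D.St _) (tr (underTrans f c)
        ((pb (sectL C i)).obj T)) ·)
      (pb_pb (projUnder f c) (sectL A i) φ)))).symm
  exact ⟨fun h i c => (this c i).1 (h (c, i)), fun h c => (this c.1 c.2).2 (h c.2 c.1)⟩

/-- Kan extensions along `id × f` are computed parameterwise. -/
lemma isCouniv_id_prod_iff (hD : D.IsDerivator) {A C I : Cat.{w, w}} (f : A ⥤ C)
    {X : D.St (Cat.of (I × A))} {T : D.St (Cat.of (I × C))}
    (φ : (pb (prodFun I f)).obj T ⟶ X) :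
    (pb (prodFun I f)).IsCouniv φ ↔
      ∀ i : I, (pb f).IsCouniv (T := (pb (sectR C i)).obj T)
        ((pb (sectR A i)).map φ) := by
  refine (isCouniv_iff_isCounivAt hD _ φ).trans (Iff.trans ?_
    (forall_congr' fun i => isCouniv_iff_isCounivAt hD f _).symm)
  have (c : C) (i : I) := (isCounivAt_iff ((isInitialAt_slice f c).id_prod i) φ).trans
    (iff_of_eq (congrArg (fun t => (pb (toPt _)).IsCouniv (T := (pb (ptAt c)).obj
      ((pb (sectR C i)).obj T)) t)
      (congrArg (CategoryStruct.comp (obj := D.St _) (tr (underTrans f c)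
        ((pb (sectR C i)).obj T)) ·)
      (pb_pb (projUnder f c) (sectR A i) φ)))).symm
  exact ⟨fun h i c => (this c i).1 (h (i, c)), fun h c => (this c.2 c.1).2 (h c.1 c.2)⟩

end Right

end Prederivator

/-! ### Universal arrows and zero objects -/

namespace CategoryTheory.Functor

universe v₁ v₂ u₁ u₂

variable {C : Type u₁} [Category.{v₁} C] {E : Type u₂} [Category.{v₂} E] {R : E ⥤ C} {X : C} {T : E}

/-- A left adjoint sends initial objects to initial objects, and in a category with a zero object an
initial object is zero. -/
lemma IsUniv.isZero [Limits.HasZeroObject E] {φ : X ⟶ R.obj T} (h : R.IsUniv φ)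
    (hX : Limits.IsZero X) : Limits.IsZero T := by
  obtain ⟨Z, hZ⟩ := Limits.HasZeroObject.zero (C := E)
  have : hZ.from_ T ≫ hZ.to_ T = 𝟙 T := h.hom_ext (hX.eq_of_src _ _)
  exact hZ.of_iso ⟨hZ.from_ T, hZ.to_ T, this, hZ.eq_of_src _ _⟩

lemma IsCouniv.isZero [Limits.HasZeroObject E] {φ : R.obj T ⟶ X} (h : R.IsCouniv φ)
    (hX : Limits.IsZero X) : Limits.IsZero T := by
  obtain ⟨Z, hZ⟩ := Limits.HasZeroObject.zero (C := E)
  have : hZ.from_ T ≫ hZ.to_ T = 𝟙 T := h.hom_ext (hX.eq_of_tgt _ _)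
  exact hZ.of_iso ⟨hZ.from_ T, hZ.to_ T, this, hZ.eq_of_src _ _⟩

lemma isUniv_of_isZero (φ : X ⟶ R.obj T) (hX : Limits.IsZero X) (hT : Limits.IsZero T) :
    R.IsUniv φ :=
  fun Y => ⟨fun _ _ _ => hT.eq_of_src _ _, fun _ => ⟨hT.to_ Y, hX.eq_of_src _ _⟩⟩

lemma isCouniv_of_isZero (φ : R.obj T ⟶ X) (hX : Limits.IsZero X) (hT : Limits.IsZero T) :
    R.IsCouniv φ :=
  fun Y => ⟨fun _ _ _ => hT.eq_of_tgt _ _, fun _ => ⟨hT.from_ Y, hX.eq_of_tgt _ _⟩⟩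

lemma isZero_map [R.IsLeftAdjoint] [R.IsRightAdjoint] (hT : Limits.IsZero T) :
    Limits.IsZero (R.obj T) where
  unique_to Y := by
    let e := (Adjunction.ofIsLeftAdjoint R).homEquiv T Y
    exact ⟨⟨⟨e.symm (hT.to_ _)⟩, fun f => e.injective (hT.eq_of_src _ _)⟩⟩
  unique_from Y := by
    let e := (Adjunction.ofIsRightAdjoint R).homEquiv Y T
    exact ⟨⟨⟨e (hT.from_ _)⟩, fun f => e.symm.injective (hT.eq_of_tgt _ _)⟩⟩

end CategoryTheory.Functor

namespace Prederivator

variable {D : Prederivator.{w, v, u}}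

/-! ### Zero objects -/

lemma isZero_st_iff {J : Cat.{w, w}} (X : D.St J) : Limits.IsZero X ↔ Limits.IsZero X.val := by
  constructor
  · intro h
    constructor
    · intro Y
      have e : (X ⟶ ofDia Y) ≃ (X.val ⟶ Y) := (Iso.refl X.val).homCongr (ofDiaValIso Y)
      exact ⟨⟨⟨e (h.to_ _)⟩, fun f => e.symm.injective (h.eq_of_src _ _)⟩⟩
    · intro Y
      have e : (ofDia Y ⟶ X) ≃ (Y ⟶ X.val) := (ofDiaValIso Y).homCongr (Iso.refl X.val)
      exact ⟨⟨⟨e (h.from_ _)⟩, fun f => e.symm.injective (h.eq_of_tgt _ _)⟩⟩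
  · intro h
    exact ⟨fun Y => h.unique_to Y.val, fun Y => h.unique_from Y.val⟩

lemma isZero_ofDia_iff {J : Cat.{w, w}} (X : D.Dia J) :
    Limits.IsZero (ofDia X) ↔ Limits.IsZero X :=
  (isZero_st_iff _).trans (ofDiaValIso X).isZero_iff

/-- Isomorphic values. -/
def pbValIso {K J : Cat.{w, w}} (f : K ⥤ J) (X : D.St J) :
    ((pb f).obj X).val ≅ (D.res f).obj X.val := (D.resComp f X.fn).app X.obj

lemma isZero_pb_iff {K J : Cat.{w, w}} (f : K ⥤ J) (X : D.St J) :
    Limits.IsZero ((pb f).obj X) ↔ Limits.IsZero ((D.res f).obj X.val) :=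
  (isZero_st_iff _).trans (pbValIso f X).isZero_iff

lemma isZero_pb_ofDia_iff {K J : Cat.{w, w}} (f : K ⥤ J) (X : D.Dia J) :
    Limits.IsZero ((pb f).obj (ofDia X)) ↔ Limits.IsZero ((D.res f).obj X) :=
  (isZero_pb_iff f _).trans ((D.res f).mapIso (ofDiaValIso X)).isZero_iff

/-- By (Der3), restriction is both a left and a right adjoint, so it preserves initial and terminal
objects. -/
lemma isZero_res (hD : D.IsDerivator) {K J : Cat.{w, w}} (f : K ⥤ J) {X : D.Dia J}
    (hX : Limits.IsZero X) : Limits.IsZero ((D.res f).obj X) :=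
  have := (hD.der3 K J f).1
  have := (hD.der3 K J f).2
  Functor.isZero_map hX

lemma isZero_pb (hD : D.IsDerivator) {K J : Cat.{w, w}} (f : K ⥤ J) {X : D.St J}
    (hX : Limits.IsZero X) : Limits.IsZero ((pb f).obj X) :=
  (isZero_pb_iff f X).2 (isZero_res hD f ((isZero_st_iff X).1 hX))

lemma hasZeroObject_dia (hD : D.IsDerivator) (h : Limits.HasZeroObject (D.Dia pt.{w}))
    (J : Cat.{w, w}) : Limits.HasZeroObject (D.Dia J) :=
  ⟨(D.res (toPt J)).obj h.zero.choose, isZero_res hD _ h.zero.choose_spec⟩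

lemma hasZeroObject_st (hD : D.IsDerivator) (h : Limits.HasZeroObject (D.Dia pt.{w}))
    (J : Cat.{w, w}) : Limits.HasZeroObject (D.St J) := by
  obtain ⟨Z, hZ⟩ := hasZeroObject_dia hD h J
  exact ⟨ofDia Z, (isZero_ofDia_iff Z).2 hZ⟩

/-- A diagram is zero if and only if its values are zero. -/
lemma isZero_iff_eval (hD : D.IsDerivator) (h : Limits.HasZeroObject (D.Dia pt.{w}))
    {J : Cat.{w, w}} (X : D.St J) :
    Limits.IsZero X ↔ ∀ a, Limits.IsZero ((pb (ptAt a)).obj X) := by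
  refine ⟨fun hX a => isZero_pb hD _ hX, fun hX => ?_⟩
  obtain ⟨Z, hZ⟩ := hasZeroObject_st hD h J
  have : IsIso (hZ.from_ X) := by
    refine isIso_of_eval hD _ fun a => ?_
    exact ⟨(isZero_pb hD (ptAt a) hZ).to_ _, (hX a).eq_of_src _ _,
      (isZero_pb hD (ptAt a) hZ).eq_of_src _ _⟩
  exact hZ.of_iso (asIso (hZ.from_ X))

/-! ### Essential images of Kan extensions -/

/-- A morphism of diagrams, as a morphism of formal restrictions. -/
def homToSt {K J : Cat.{w, w}} {f : K ⥤ J} {Z : D.Dia K} {X : D.St J}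
    (ψ : Z ⟶ (D.res f).obj X.val) : ofDia Z ⟶ (pb f).obj X :=
  CategoryStruct.comp (obj := D.Dia K) (ofDiaValIso Z).hom
    (CategoryStruct.comp (obj := D.Dia K) ψ (pbValIso f X).inv)

lemma isUniv_homToSt_iff {K J : Cat.{w, w}} {f : K ⥤ J} {Z : D.Dia K} {X : D.St J}
    (ψ : Z ⟶ (D.res f).obj X.val) : (pb f).IsUniv (homToSt ψ) ↔ (D.res f).IsUniv ψ := by
  rw [isUniv_pb_iff]
  refine Iff.trans (iff_of_eq (congrArg _ ?_))
    (Functor.isUniv_precomp_iff (R := D.res f) (ofDiaValIso Z).hom)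
  exact (Category.assoc (obj := D.Dia K) _ _ _).trans
    (congrArg ((ofDiaValIso Z).hom ≫ ·) (((Category.assoc (obj := D.Dia K) _ _ _)).trans
      ((congrArg (ψ ≫ ·) (pbValIso f X).inv_hom_id).trans (Category.comp_id _))))

/-- A morphism of diagrams, as a morphism of formal restrictions. -/
def homToSt' {K J : Cat.{w, w}} {f : K ⥤ J} {Z : D.Dia K} {X : D.St J}
    (ψ : (D.res f).obj X.val ⟶ Z) : (pb f).obj X ⟶ ofDia Z :=
  CategoryStruct.comp (obj := D.Dia K) (pbValIso f X).hom
    (CategoryStruct.comp (obj := D.Dia K) ψ (ofDiaValIso Z).inv)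

lemma isCouniv_homToSt'_iff {K J : Cat.{w, w}} {f : K ⥤ J} {Z : D.Dia K} {X : D.St J}
    (ψ : (D.res f).obj X.val ⟶ Z) : (pb f).IsCouniv (homToSt' ψ) ↔ (D.res f).IsCouniv ψ := by
  rw [isCouniv_pb_iff]
  refine Iff.trans (iff_of_eq (congrArg _ ?_))
    (Functor.isCouniv_postcomp_iff (R := D.res f) (ofDiaValIso Z).inv)
  exact (pbValIso f X).inv_hom_id_assoc _

/-- The values of a left adjoint are determined up to isomorphism, so the adjoint in the definition
of the essential image is immaterial and only a universal arrow with target `X` matters. -/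
lemma essImLan_iff_exists (hD : D.Der3) {A B : Cat.{w, w}} (f : A ⥤ B) (X : D.Dia B) :
    D.EssImLan f X ↔ ∃ (Z : D.Dia A) (ψ : Z ⟶ (D.res f).obj X), (D.res f).IsUniv ψ := by
  constructor
  · rintro ⟨L, ⟨adj⟩, Z, ⟨e⟩⟩
    exact ⟨Z, _, (Functor.isUniv_unit adj Z).comp_map e.hom⟩
  · rintro ⟨Z, ψ, hψ⟩
    have := (hD A B f).1
    let adj := Adjunction.ofIsRightAdjoint (D.res f)
    obtain ⟨m, hm⟩ := (Functor.isUniv_unit adj Z).exists_lift ψ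
    have : IsIso m := (Functor.isUniv_unit adj Z).isIso (hm ▸ hψ)
    exact ⟨_, ⟨adj⟩, Z, ⟨asIso m⟩⟩

lemma essImRan_iff_exists (hD : D.Der3) {A B : Cat.{w, w}} (f : A ⥤ B) (X : D.Dia B) :
    D.EssImRan f X ↔ ∃ (Z : D.Dia A) (ψ : (D.res f).obj X ⟶ Z), (D.res f).IsCouniv ψ := by
  constructor
  · rintro ⟨L, ⟨adj⟩, Z, ⟨e⟩⟩
    exact ⟨Z, _, (Functor.isCouniv_counit adj Z).map_comp e.inv⟩
  · rintro ⟨Z, ψ, hψ⟩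
    have := (hD A B f).2
    let adj := Adjunction.ofIsLeftAdjoint (D.res f)
    obtain ⟨m, hm⟩ := (Functor.isCouniv_counit adj Z).exists_lift ψ
    have : IsIso m := (Functor.isCouniv_counit adj Z).isIso (hm ▸ hψ)
    exact ⟨_, ⟨adj⟩, Z, ⟨(asIso m).symm⟩⟩

/-- A diagram is a left Kan extension if and only if it is the left Kan extension of its
restriction. -/
lemma essImLan_iff (hD : D.IsDerivator) {A B : Cat.{w, w}} (f : A ⥤ B) [f.Full] [f.Faithful]
    (X : D.St B) : D.EssImLan f X.val ↔ (pb f).IsUniv (𝟙 ((pb f).obj X)) := by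
  rw [essImLan_iff_exists hD.der3]
  constructor
  · rintro ⟨Z, ψ, hψ⟩
    have h := (isUniv_homToSt_iff ψ).2 hψ
    -- Along a fully faithful functor universal arrows are invertible, so this one can be traded for
    -- the identity.
    have := IsUniv.isIso_of_fullyFaithful hD f h
    exact (Functor.isUniv_precomp_iff (homToSt ψ)).1 ((Category.comp_id (homToSt ψ)).symm ▸ h)
  · intro h
    exact ⟨_, _, (isUniv_pb_iff f _).1 h⟩

/-- A diagram is a right Kan extension if and only if it is the right Kan extension of its
restriction. -/
lemma essImRan_iff (hD : D.IsDerivator) {A B : Cat.{w, w}} (f : A ⥤ B) [f.Full] [f.Faithful]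
    (X : D.St B) : D.EssImRan f X.val ↔ (pb f).IsCouniv (𝟙 ((pb f).obj X)) := by
  rw [essImRan_iff_exists hD.der3]
  constructor
  · rintro ⟨Z, ψ, hψ⟩
    have h := (isCouniv_homToSt'_iff ψ).2 hψ
    have := IsCouniv.isIso_of_fullyFaithful hD f h
    exact (Functor.isCouniv_postcomp_iff (homToSt' ψ)).1 ((Category.id_comp (homToSt' ψ)).symm ▸ h)
  · intro h
    exact ⟨_, _, (isCouniv_pb_iff f _).1 h⟩

lemma essImLan_congr {A B : Cat.{w, w}} (f : A ⥤ B) {X Y : D.Dia B} (e : X ≅ Y) :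
    D.EssImLan f X ↔ D.EssImLan f Y :=
  ⟨fun ⟨L, h, Z, ⟨i⟩⟩ => ⟨L, h, Z, ⟨i ≪≫ e⟩⟩, fun ⟨L, h, Z, ⟨i⟩⟩ => ⟨L, h, Z, ⟨i ≪≫ e.symm⟩⟩⟩

lemma essImRan_congr {A B : Cat.{w, w}} (f : A ⥤ B) {X Y : D.Dia B} (e : X ≅ Y) :
    D.EssImRan f X ↔ D.EssImRan f Y :=
  ⟨fun ⟨L, h, Z, ⟨i⟩⟩ => ⟨L, h, Z, ⟨i ≪≫ e⟩⟩, fun ⟨L, h, Z, ⟨i⟩⟩ => ⟨L, h, Z, ⟨i ≪≫ e.symm⟩⟩⟩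

/-- A diagram is a left Kan extension if and only if it is the left Kan extension of its
restriction. -/
lemma essImLan_iff_id (hD : D.IsDerivator) {A B : Cat.{w, w}} (f : A ⥤ B) [f.Full] [f.Faithful]
    (X : D.Dia B) : D.EssImLan f X ↔ (D.res f).IsUniv (𝟙 ((D.res f).obj X)) := by
  refine ⟨fun h => ?_, fun h => (essImLan_iff_exists hD.der3 f X).2 ⟨_, _, h⟩⟩
  have h₁ := (isUniv_pb_iff f _).1 ((essImLan_iff hD f (ofDia X)).1
    ((essImLan_congr f (ofDiaValIso X)).2 h))
  have h₂ := h₁.comp_map (ofDiaValIso X).hom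
  rw [← Functor.isUniv_precomp_iff (T := X)
    ((pbValIso f (ofDia X)).hom ≫ (D.res f).map (ofDiaValIso X).hom)]
  refine Eq.mp (congrArg (Functor.IsUniv (D.res f) (T := X)) ?_) h₂
  exact (congrArg (· ≫ (D.res f).map (ofDiaValIso X).hom)
    (Category.id_comp (obj := D.Dia A) _)).trans (Category.comp_id (obj := D.Dia A) _).symm

/-- A diagram is a right Kan extension if and only if it is the right Kan extension of its
restriction. -/
lemma essImRan_iff_id (hD : D.IsDerivator) {A B : Cat.{w, w}} (f : A ⥤ B) [f.Full] [f.Faithful]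
    (X : D.Dia B) : D.EssImRan f X ↔ (D.res f).IsCouniv (𝟙 ((D.res f).obj X)) := by
  refine ⟨fun h => ?_, fun h => (essImRan_iff_exists hD.der3 f X).2 ⟨_, _, h⟩⟩
  have h₁ := (isCouniv_pb_iff f _).1 ((essImRan_iff hD f (ofDia X)).1
    ((essImRan_congr f (ofDiaValIso X)).2 h))
  have h₂ := h₁.map_comp (ofDiaValIso X).inv
  rw [← Functor.isCouniv_postcomp_iff (T := X)
    ((D.res f).map (ofDiaValIso X).inv ≫ (pbValIso f (ofDia X)).inv)]
  refine Eq.mp (congrArg (Functor.IsCouniv (D.res f) (T := X)) ?_) h₂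
  exact (congrArg ((D.res f).map (ofDiaValIso X).inv ≫ ·)
    (Category.comp_id (obj := D.Dia A) _)).trans (Category.id_comp (obj := D.Dia A) _).symm

end Prederivator

namespace Prederivator

variable {D : Prederivator.{w, v, u}}

/-! ### Shifted derivators -/

/-- By `isIso_mate_iff` and its dual, invertibility of the mates does not depend on the adjoints. In
this form exactness can be tested parameterwise. -/
lemma isExactSquare_iff (hD : D.Der3) {X₀ A B C : Cat.{w, w}} {p : X₀ ⥤ A}
    {q : X₀ ⥤ B} {f : A ⥤ C} {g : B ⥤ C} (α : p ⋙ f ⟶ q ⋙ g) : D.IsExactSquare α ↔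
      (∀ (X : D.St A) (T : D.St C) (φ : X ⟶ (pb f).obj T), (pb f).IsUniv φ →
        (pb q).IsUniv (bc α φ)) ∧
      (∀ (X : D.St B) (T : D.St C) (φ : (pb g).obj T ⟶ X), (pb g).IsCouniv φ →
        (pb p).IsCouniv (cobc α φ)) := by
  rw [← leftExact_iff, ← rightExact_iff]
  have := (hD _ _ f).1
  have := (hD _ _ q).1
  have := (hD _ _ g).2
  have := (hD _ _ p).2
  constructor
  · intro h
    exact ⟨(Functor.isIso_mate_iff (D.resSquare α) (Adjunction.ofIsRightAdjoint (D.res f))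
      (Adjunction.ofIsRightAdjoint (D.res q))).1 (h.1 _ _ _ _),
      (Functor.isIso_mate_iff' (D.resSquare α) (Adjunction.ofIsLeftAdjoint (D.res g))
      (Adjunction.ofIsLeftAdjoint (D.res p))).1 (h.2 _ _ _ _)⟩
  · intro h
    exact ⟨fun _ _ _ _ => (Functor.isIso_mate_iff (D.resSquare α) _ _).2 h.1,
      fun _ _ _ _ => (Functor.isIso_mate_iff' (D.resSquare α) _ _).2 h.2⟩

/-- Universality along `id × f` is tested at each `i`, and restricting the product square to `i`
gives back the original square. -/
lemma IsExactSquare.prodFun (hD : D.IsDerivator) {X₀ A B C : Cat.{w, w}} {p : X₀ ⥤ A}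
    {q : X₀ ⥤ B} {f : A ⥤ C} {g : B ⥤ C} {α : p ⋙ f ⟶ q ⋙ g} (h : D.IsExactSquare α)
    (I : Cat.{w, w}) : D.IsExactSquare (p := prodFun I p) (q := prodFun I q) (u' := prodFun I f)
      (v' := prodFun I g) (prodFun₂ I α) := by
  rw [isExactSquare_iff hD.der3] at h
  refine (isExactSquare_iff hD.der3 (p := Prederivator.prodFun I p)
    (q := Prederivator.prodFun I q) (f := Prederivator.prodFun I f)
    (g := Prederivator.prodFun I g) (prodFun₂ I α)).2 ⟨?_, ?_⟩
  · intro X T φ hφ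
    refine (isUniv_id_prod_iff hD q (T := (pb (Prederivator.prodFun I g)).obj T) _).2 fun i => ?_
    have h₁ := h.1 _ _ _ ((isUniv_id_prod_iff hD f φ).1 hφ i)
    refine Eq.mp (congrArg (Functor.IsUniv (pb q) (T := (pb (sectR B i)).obj
      ((pb (Prederivator.prodFun I g)).obj T))) ?_) h₁
    refine Eq.symm (((pb (sectR X₀ i)).map_comp ((pb (Prederivator.prodFun I p)).map φ)
      (tr (prodFun₂ I α) T)).trans (comp_congr (C₁ := D.St X₀) ?_ ?_))
    · exact (pb_pb (sectR X₀ i) (Prederivator.prodFun I p) φ).trans (pb_pb p (sectR A i) φ).symm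
    · exact pb_tr (sectR X₀ i) (prodFun₂ I α) T
  · intro X T φ hφ
    refine (isCouniv_id_prod_iff hD p (T := (pb (Prederivator.prodFun I f)).obj T) _).2 fun i => ?_
    have h₁ := h.2 _ _ _ ((isCouniv_id_prod_iff hD g φ).1 hφ i)
    refine Eq.mp (congrArg (Functor.IsCouniv (pb p) (T := (pb (sectR A i)).obj
      ((pb (Prederivator.prodFun I f)).obj T))) ?_) h₁
    refine Eq.symm (((pb (sectR X₀ i)).map_comp (tr (prodFun₂ I α) T)
      ((pb (Prederivator.prodFun I q)).map φ)).trans (comp_congr (C₁ := D.St X₀) ?_ ?_))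
    · exact pb_tr (sectR X₀ i) (prodFun₂ I α) T
    · exact (pb_pb (sectR X₀ i) (Prederivator.prodFun I q) φ).trans (pb_pb q (sectR B i) φ).symm

/-- Restriction along an equivalence is an equivalence. -/
lemma isEquivalence_res (D : Prederivator.{w, v, u}) {A B : Cat.{w, w}} (e : CategoryTheory.Equivalence A B) :
    (D.res e.functor).IsEquivalence :=
  (CategoryTheory.Equivalence.mk (D.res e.functor) (D.res e.inverse)
    ((D.resId B).symm ≪≫ D.resIso e.counitIso.symm ≪≫ D.resComp e.inverse e.functor)
    ((D.resComp e.functor e.inverse).symm ≪≫ D.resIso e.unitIso.symm ≪≫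
      D.resId A)).isEquivalence_functor

section Sigma
variable (B : Cat.{w, w}) {ι : Type w} (A : ι → Cat.{w, w})

/-- The coproduct of a family of categories. -/
abbrev sigmaCat : Cat.{w, w} := Cat.of (Σ i, A i)

/-- The inclusion into the coproduct. -/
abbrev sigmaIncl (i : ι) : A i ⥤ sigmaCat A := Sigma.incl (C := fun i => (A i : Type w)) i

/-- The distributivity functor `∐ (B × A i) ⥤ B × ∐ A i`. -/
def sigmaProd : sigmaCat (fun i => Cat.of (B × A i)) ⥤ Cat.of (B × sigmaCat A) :=
  Sigma.desc fun i => prodFun B (sigmaIncl A i)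

instance : (sigmaProd B A).Faithful where
  map_injective := by
    rintro ⟨i, X⟩ ⟨_, Y⟩ ⟨f⟩ ⟨g⟩ h
    have h₁ := congrArg Prod.fst h
    have h₂ := congrArg Prod.snd h
    have h₃ := (inferInstance : (Sigma.incl (C := fun i => (A i : Type w)) i).Faithful).map_injective h₂
    exact congrArg Sigma.SigmaHom.mk (Prod.ext h₁ h₃)

instance : (sigmaProd B A).Full where
  map_surjective := by
    rintro ⟨i, b, a⟩ ⟨j, b', a'⟩ ⟨f, g⟩
    change Sigma.SigmaHom (⟨i, a⟩ : Σ i, A i) ⟨j, a'⟩ at g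
    cases g with
    | mk g => exact ⟨Sigma.SigmaHom.mk (f, g), rfl⟩

instance : (sigmaProd B A).EssSurj where
  mem_essImage := by
    rintro ⟨b, ⟨i, a⟩⟩
    exact ⟨⟨i, (b, a)⟩, ⟨Iso.refl _⟩⟩

instance : (sigmaProd B A).IsEquivalence where

end Sigma

/-- Products distribute over coproducts of categories: (Der1) is applied to the family `B × A i` and
transported along the equivalence `sigmaProd`. -/
lemma der1_shift (hD : D.Der1) (B : Cat.{w, w}) : (shift B D).Der1 := by
  intro ι A
  have h₁ := hD ι (fun i => Cat.of (B × A i))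
  have h₂ := isEquivalence_res D (sigmaProd B A).asEquivalence
  let F := Functor.pi' fun i => (shift B D).res (sigmaIncl A i)
  let G := Functor.pi' fun i => D.res (sigmaIncl (fun i => Cat.of (B × A i)) i)
  let e : D.res (sigmaProd B A) ⋙ G ≅ F :=
    NatIso.ofComponents (fun X => Pi.isoMk fun i => ((D.resComp _ (sigmaProd B A)).app X).symm)
      (fun f => by
        funext i
        exact ((D.resComp (sigmaIncl (fun i => Cat.of (B × A i)) i) (sigmaProd B A)).inv.naturality f))
  have h₁' : G.IsEquivalence := h₁
  have h₂' : (D.res (sigmaProd B A)).IsEquivalence := h₂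
  exact Functor.isEquivalence_of_iso e

/-- Both sides say that `f` is invertible at all pairs `(b, a)`: (Der2) is used on `B × A` and, for
each `a`, on `B × e`. -/
lemma der2_shift (hD : D.Der2) (B : Cat.{w, w}) : (shift B D).Der2 := by
  intro A X Y f
  have key (b : B) (a : A) : IsIso ((D.eval (A := Cat.of (B × A)) (b, a)).map f) ↔
      IsIso ((D.eval (A := Cat.of (B × pt)) (b, ⟨PUnit.unit⟩)).map ((D.res (prodFun B (ptAt a))).map f)) :=
    NatIso.isIso_map_iff (D.resComp (ptAt (A := Cat.of (B × pt)) (b, ⟨PUnit.unit⟩))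
      (prodFun B (ptAt a))) f
  refine (hD (Cat.of (B × A)) X Y f).trans ⟨fun h a => ?_, fun h => ?_⟩
  · refine (hD (Cat.of (B × pt)) _ _ _).2 fun b => ?_
    exact (key b.1 a).1 (h (b.1, a))
  · rintro ⟨b, a⟩
    exact (key b a).2 ((hD (Cat.of (B × pt)) _ _ _).1 (h a) _)

/-- Shifts of derivators are derivators. -/
lemma IsDerivator.shift (hD : D.IsDerivator) (B : Cat.{w, w}) :
    (Prederivator.shift B D).IsDerivator where
  der1 := der1_shift hD.der1 B
  der2 := der2_shift hD.der2 B
  der3 _ _ f := hD.der3 _ _ (prodFun B f)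
  der4 A A' f a := ⟨((hD.der4 A A' f a).1.prodFun hD B :), ((hD.der4 A A' f a).2.prodFun hD B :)⟩

lemma faithful_prodFun (I : Cat.{w, w}) {A B : Cat.{w, w}} (f : A ⥤ B) [f.Faithful] :
    (prodFun I f).Faithful where
  map_injective {x y} _ _ h :=
    Prod.ext (congrArg (fun t : (prodFun I f).obj x ⟶ (prodFun I f).obj y => t.1) h)
      (f.map_injective (congrArg (fun t : (prodFun I f).obj x ⟶ (prodFun I f).obj y => t.2) h))

lemma full_prodFun (I : Cat.{w, w}) {A B : Cat.{w, w}} (f : A ⥤ B) [f.Full] :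
    (prodFun I f).Full where
  map_surjective g := ⟨(g.1, f.preimage g.2), Prod.ext rfl (f.map_preimage g.2)⟩

/-- Being a left Kan extension means universality of an identity, which is tested at each `i`. With
the dual, it shows that a square in a shifted derivator is (co)cartesian iff it is so at each object
of the shift. -/
lemma essImLan_prodFun_iff (hD : D.IsDerivator) (I : Cat.{w, w}) {A B : Cat.{w, w}} (f : A ⥤ B)
    [f.Full] [f.Faithful] (X : D.Dia (Cat.of (I × B))) :
    D.EssImLan (prodFun I f) X ↔ ∀ i : I, D.EssImLan f ((D.res (sectR B i)).obj X) := by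
  have := faithful_prodFun I f
  have := full_prodFun I f
  rw [← essImLan_congr (prodFun I f) (ofDiaValIso X), essImLan_iff hD]
  refine (isUniv_id_prod_iff hD f (T := ofDia X) _).trans (forall_congr' fun i => ?_)
  rw [← essImLan_congr f ((D.res (sectR B i)).mapIso (ofDiaValIso X)),
    ← essImLan_congr f (pbValIso (sectR B i) (ofDia X)), essImLan_iff hD]
  exact iff_of_eq (congrArg _ (CategoryTheory.Functor.map_id (pb (sectR A i)) _))

lemma essImRan_prodFun_iff (hD : D.IsDerivator) (I : Cat.{w, w}) {A B : Cat.{w, w}} (f : A ⥤ B)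
    [f.Full] [f.Faithful] (X : D.Dia (Cat.of (I × B))) :
    D.EssImRan (prodFun I f) X ↔ ∀ i : I, D.EssImRan f ((D.res (sectR B i)).obj X) := by
  have := faithful_prodFun I f
  have := full_prodFun I f
  rw [← essImRan_congr (prodFun I f) (ofDiaValIso X), essImRan_iff hD]
  refine (isCouniv_id_prod_iff hD f (T := ofDia X) _).trans (forall_congr' fun i => ?_)
  rw [← essImRan_congr f ((D.res (sectR B i)).mapIso (ofDiaValIso X)),
    ← essImRan_congr f (pbValIso (sectR B i) (ofDia X)), essImRan_iff hD]
  exact iff_of_eq (congrArg _ (CategoryTheory.Functor.map_id (pb (sectR A i)) _))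

lemma subsingleton_poset_hom {α : Type} [Preorder α] (x y : poset.{w} α) : Subsingleton (x ⟶ y) :=
  inferInstanceAs (Subsingleton (ULift (AsSmall.down.obj x ⟶ AsSmall.down.obj y)))

lemma full_posetFunctor {α β : Type} [Preorder α] [Preorder β] (f : α →o β)
    (h : ∀ x y, f x ≤ f y → x ≤ y) : (posetFunctor.{w} f).Full where
  map_surjective g :=
    ⟨AsSmall.up.map (homOfLE (h _ _ (leOfHom (AsSmall.down.map g)))), (subsingleton_poset_hom _ _).elim _ _⟩

lemma faithful_posetFunctor {α β : Type} [Preorder α] [Preorder β] (f : α →o β) :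
    (posetFunctor.{w} f).Faithful where
  map_injective _ := (subsingleton_poset_hom _ _).elim _ _

instance : (inclLL.{w}).Full := full_posetFunctor _ fun _ _ h => h
instance : (inclLL.{w}).Faithful := faithful_posetFunctor _
instance : (inclUR.{w}).Full := full_posetFunctor _ fun _ _ h => h
instance : (inclUR.{w}).Faithful := faithful_posetFunctor _

/-- Shifts of stable derivators are stable derivators. -/
lemma IsStableDerivator.shift (hD : D.IsStableDerivator) (B : Cat.{w, w}) :
    (Prederivator.shift B D).IsStableDerivator where
  isDerivator := hD.isDerivator.shift B
  pointed := hasZeroObject_dia hD.isDerivator hD.pointed _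
  cocartesian_iff X := ((essImLan_prodFun_iff hD.isDerivator B inclLL X).trans
    (forall_congr' fun _ => hD.cocartesian_iff _)).trans
      (essImRan_prodFun_iff hD.isDerivator B inclUR X).symm

end Prederivator

/-! ### Closed full subprederivators, and the subderivator of vanishing diagrams -/

namespace Prederivator

namespace FullSub

variable {E : Prederivator.{w, v, u}}

/-- Full subprederivators which are closed under isomorphisms and Kan extensions, and contain the
diagrams on coproducts whose restrictions they contain. -/
structure IsClosed (P : FullSub E) : Prop where
  iso {A : Cat.{w, w}} {X Y : E.Dia A} (e : X ≅ Y) (h : P.prop A X) : P.prop A Y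
  sigma {ι : Type w} (A : ι → Cat.{w, w}) (X : E.Dia (sigmaCat A))
    (h : ∀ i, P.prop (A i) ((E.res (sigmaIncl A i)).obj X)) : P.prop (sigmaCat A) X
  lan {A B : Cat.{w, w}} {f : A ⥤ B} {X : E.Dia A} {T : E.Dia B} (φ : X ⟶ (E.res f).obj T)
    (hφ : (E.res f).IsUniv φ) (h : P.prop A X) : P.prop B T
  ran {A B : Cat.{w, w}} {f : A ⥤ B} {X : E.Dia A} {T : E.Dia B} (φ : (E.res f).obj T ⟶ X)
    (hφ : (E.res f).IsCouniv φ) (h : P.prop A X) : P.prop B T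

variable {P : FullSub E}

/-- A full subcategory has the same morphisms and fewer objects to test against. -/
lemma isUniv_of_hom {A B : Cat.{w, w}} {f : A ⥤ B} {X : (P.prop A).FullSubcategory}
    {T : (P.prop B).FullSubcategory} (φ : X ⟶ (P.resFunctor f).obj T)
    (h : (E.res f).IsUniv φ.hom) : (P.resFunctor f).IsUniv φ := by
  intro Y
  refine ⟨fun m m' hm => ?_, fun g => ?_⟩
  · exact ObjectProperty.hom_ext _ (h.hom_ext (congrArg (·.hom) hm))
  · obtain ⟨m, hm⟩ := h.exists_lift g.hom
    exact ⟨ObjectProperty.homMk m, ObjectProperty.hom_ext _ hm⟩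

lemma isCouniv_of_hom {A B : Cat.{w, w}} {f : A ⥤ B} {X : (P.prop A).FullSubcategory}
    {T : (P.prop B).FullSubcategory} (φ : (P.resFunctor f).obj T ⟶ X)
    (h : (E.res f).IsCouniv φ.hom) : (P.resFunctor f).IsCouniv φ := by
  intro Y
  refine ⟨fun m m' hm => ?_, fun g => ?_⟩
  · exact ObjectProperty.hom_ext _ (h.hom_ext (congrArg (·.hom) hm))
  · obtain ⟨m, hm⟩ := h.exists_lift g.hom
    exact ⟨ObjectProperty.homMk m, ObjectProperty.hom_ext _ hm⟩

lemma isIso_hom_iff {A : Cat.{w, w}} {X Y : (P.prop A).FullSubcategory} (f : X ⟶ Y) :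
    IsIso f.hom ↔ IsIso f :=
  isIso_iff_of_reflects_iso f (P.prop A).ι

namespace IsClosed

/-- By closure the Kan extension of `X` in `E` lies in `P`, where it is again universal; by
uniqueness every universal arrow of `P` is isomorphic to it. -/
lemma isUniv_iff (hE : E.IsDerivator) (hP : P.IsClosed) {A B : Cat.{w, w}}
    {f : A ⥤ B} {X : (P.prop A).FullSubcategory}
    {T : (P.prop B).FullSubcategory} (φ : X ⟶ (P.resFunctor f).obj T) :
    (P.resFunctor f).IsUniv φ ↔ (E.res f).IsUniv φ.hom := by
  refine ⟨fun h => ?_, isUniv_of_hom φ⟩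
  have := (hE.der3 A B f).1
  let adj := Adjunction.ofIsRightAdjoint (E.res f)
  have hu := Functor.isUniv_unit adj X.obj
  let L : (P.prop B).FullSubcategory := ⟨_, hP.lan _ hu X.property⟩
  let η : X ⟶ (P.resFunctor f).obj L := ObjectProperty.homMk (adj.unit.app X.obj)
  have hη : (P.resFunctor f).IsUniv η := isUniv_of_hom η hu
  obtain ⟨m, hm⟩ := hη.exists_lift φ
  have : IsIso m := hη.isIso (hm ▸ h)
  have : IsIso m.hom := (isIso_hom_iff m).2 this
  rw [← hm]
  exact hu.comp_map m.hom

lemma isCouniv_iff (hE : E.IsDerivator) (hP : P.IsClosed) {A B : Cat.{w, w}}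
    {f : A ⥤ B} {X : (P.prop A).FullSubcategory}
    {T : (P.prop B).FullSubcategory} (φ : (P.resFunctor f).obj T ⟶ X) :
    (P.resFunctor f).IsCouniv φ ↔ (E.res f).IsCouniv φ.hom := by
  refine ⟨fun h => ?_, isCouniv_of_hom φ⟩
  have := (hE.der3 A B f).2
  let adj := Adjunction.ofIsLeftAdjoint (E.res f)
  have hu := Functor.isCouniv_counit adj X.obj
  let L : (P.prop B).FullSubcategory := ⟨_, hP.ran _ hu X.property⟩
  let η : (P.resFunctor f).obj L ⟶ X := ObjectProperty.homMk (adj.counit.app X.obj)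
  have hη : (P.resFunctor f).IsCouniv η := isCouniv_of_hom η hu
  obtain ⟨m, hm⟩ := hη.exists_lift φ
  have : IsIso m := hη.isIso (hm ▸ h)
  have : IsIso m.hom := (isIso_hom_iff m).2 this
  rw [← hm]
  exact hu.map_comp m.hom

lemma der1 (hE : E.IsDerivator) (hP : P.IsClosed) : P.toPre.Der1 := by
  intro ι A
  have h := hE.der1 ι A
  let F := Functor.pi' fun i => E.res (sigmaIncl A i)
  have hF : F.IsEquivalence := h
  let F' := Functor.pi' fun i => P.toPre.res (sigmaIncl A i)
  have h₁ : F'.Faithful := ⟨fun {X Y f g} hfg => ObjectProperty.hom_ext _ (F.map_injective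
    (funext fun i => congrArg (fun t => (t i).hom) hfg))⟩
  have h₂ : F'.Full := ⟨fun {X Y} g => by
    obtain ⟨f, hf⟩ := F.map_surjective (X := X.obj) (Y := Y.obj) (fun i => (g i).hom)
    exact ⟨ObjectProperty.homMk f, funext fun i => ObjectProperty.hom_ext _ (congrFun hf i)⟩⟩
  have h₃ : F'.EssSurj := ⟨fun Z => by
    let e := F.objObjPreimageIso (fun i => (Z i).obj)
    refine ⟨⟨F.objPreimage (fun i => (Z i).obj), hP.sigma A _ fun i => ?_⟩,
      ⟨Pi.isoMk fun i => ObjectProperty.isoMk _ (Pi.isoApp e i)⟩⟩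
    exact hP.iso (Pi.isoApp e i).symm (Z i).property⟩
  exact { }

lemma der3 (hE : E.IsDerivator) (hP : P.IsClosed) : P.toPre.Der3 := by
  intro A B f
  have := (hE.der3 A B f).1
  have := (hE.der3 A B f).2
  let adj := Adjunction.ofIsRightAdjoint (E.res f)
  let adj' := Adjunction.ofIsLeftAdjoint (E.res f)
  constructor
  · exact Functor.exists_adjunction (R := P.resFunctor f)
      (fun X => ⟨_, hP.lan _ (Functor.isUniv_unit adj X.obj) X.property⟩)
      (fun X => ObjectProperty.homMk (adj.unit.app X.obj))
      (fun X => isUniv_of_hom _ (Functor.isUniv_unit adj X.obj))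
  · exact Functor.exists_adjunction' (R := P.resFunctor f)
      (fun X => ⟨_, hP.ran _ (Functor.isCouniv_counit adj' X.obj) X.property⟩)
      (fun X => ObjectProperty.homMk (adj'.counit.app X.obj))
      (fun X => isCouniv_of_hom _ (Functor.isCouniv_counit adj' X.obj))

/-- The comparison transformations are mates of identities, so they are invertible as soon as the
inclusion preserves universal and couniversal arrows. -/
lemma isStrict (hE : E.IsDerivator) (hP : P.IsClosed) : P.IsStrict where
  der1 := hP.der1 hE
  der3 := hP.der3 hE
  lan A B f L adj L' adj' := by
    refine (Functor.isIso_mate_iff _ adj' adj).2 fun X T φ hφ => ?_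
    exact Eq.mpr (congrArg (Functor.IsUniv (E.res f) (T := T.obj)) (Category.comp_id φ.hom))
      ((hP.isUniv_iff hE φ).1 hφ)
  ran A B f R adj R' adj' := by
    refine (Functor.isIso_mate_iff' _ adj' adj).2 fun X T φ hφ => ?_
    exact Eq.mpr (congrArg (Functor.IsCouniv (E.res f) (T := T.obj)) (Category.id_comp φ.hom))
      ((hP.isCouniv_iff hE φ).1 hφ)

lemma isExactSquare (hE : E.IsDerivator) (hP : P.IsClosed) {X₀ A B C : Cat.{w, w}} {p : X₀ ⥤ A}
    {q : X₀ ⥤ B} {f : A ⥤ C} {g : B ⥤ C} {α : p ⋙ f ⟶ q ⋙ g} (h : E.IsExactSquare α) :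
    P.toPre.IsExactSquare α := by
  constructor
  · intro uL hu qL hq
    have := (hE.der3 _ _ f).1
    have := (hE.der3 _ _ q).1
    have h₁ := (Functor.isIso_mate_iff (E.resSquare α) (Adjunction.ofIsRightAdjoint (E.res f))
      (Adjunction.ofIsRightAdjoint (E.res q))).1 (h.1 _ _ _ _)
    -- A universal arrow of `P` is universal in `E`, is preserved there by the exact square, and
    -- stays universal in the full subprederivator.
    refine (Functor.isIso_mate_iff (P.toPre.resSquare α) hu hq).2 fun X T φ hφ => ?_
    exact isUniv_of_hom _ (h₁ _ _ _ ((hP.isUniv_iff hE φ).1 hφ))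
  · intro uL hu qL hq
    have := (hE.der3 _ _ g).2
    have := (hE.der3 _ _ p).2
    have h₁ := (Functor.isIso_mate_iff' (E.resSquare α) (Adjunction.ofIsLeftAdjoint (E.res g))
      (Adjunction.ofIsLeftAdjoint (E.res p))).1 (h.2 _ _ _ _)
    refine (Functor.isIso_mate_iff' (P.toPre.resSquare α) hu hq).2 fun X T φ hφ => ?_
    exact isCouniv_of_hom _ (h₁ _ _ _ ((hP.isCouniv_iff hE φ).1 hφ))

/-- Closed full subprederivators of derivators are derivators. -/
lemma isDerivator (hE : E.IsDerivator) (hP : P.IsClosed) : P.toPre.IsDerivator where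
  der1 := hP.der1 hE
  der2 A _ _ f := (isIso_hom_iff f).symm.trans ((hE.der2 A _ _ f.hom).trans
    (forall_congr' fun a => isIso_hom_iff ((P.toPre.eval a).map f)))
  der3 := hP.der3 hE
  der4 A B f b := ⟨hP.isExactSquare hE (hE.der4 A B f b).1, hP.isExactSquare hE (hE.der4 A B f b).2⟩

lemma essImLan_iff (hE : E.IsDerivator) (hP : P.IsClosed) {A B : Cat.{w, w}} (f : A ⥤ B) [f.Full] [f.Faithful]
    (X : P.toPre.Dia B) : P.toPre.EssImLan f X ↔ E.EssImLan f X.obj := by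
  rw [essImLan_iff_id hE, essImLan_iff_id (hP.isDerivator hE)]
  exact hP.isUniv_iff hE _

lemma essImRan_iff (hE : E.IsDerivator) (hP : P.IsClosed) {A B : Cat.{w, w}} (f : A ⥤ B) [f.Full] [f.Faithful]
    (X : P.toPre.Dia B) : P.toPre.EssImRan f X ↔ E.EssImRan f X.obj := by
  rw [essImRan_iff_id hE, essImRan_iff_id (hP.isDerivator hE)]
  exact hP.isCouniv_iff hE _

/-- Closed full subprederivators of stable derivators which contain a zero object are stable
derivators. -/
lemma isStableDerivator (hP : P.IsClosed) (hE : E.IsStableDerivator) (Z : E.Dia pt.{w}) (hZ : Limits.IsZero Z)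
    (hZ' : P.prop pt Z) : P.toPre.IsStableDerivator where
  isDerivator := hP.isDerivator hE.isDerivator
  pointed := ⟨⟨Z, hZ'⟩, ⟨fun _ => ⟨⟨⟨ObjectProperty.homMk (hZ.to_ _)⟩,
      fun _ => ObjectProperty.hom_ext _ (hZ.eq_of_src _ _)⟩⟩,
    fun _ => ⟨⟨⟨ObjectProperty.homMk (hZ.from_ _)⟩,
      fun _ => ObjectProperty.hom_ext _ (hZ.eq_of_tgt _ _)⟩⟩⟩⟩
  cocartesian_iff X := ((hP.essImLan_iff hE.isDerivator inclLL X).trans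
    (hE.cocartesian_iff _)).trans (hP.essImRan_iff hE.isDerivator inclUR X).symm

end IsClosed

end FullSub

variable {D : Prederivator.{w, v, u}}

/-- The vanishing condition, in terms of the diagrams `X_b`. -/
lemma vanishing_prop_iff (hD : D.IsDerivator) (h : Limits.HasZeroObject (D.Dia pt.{w}))
    (B : Cat.{w, w}) (S : Set B) {A : Cat.{w, w}} (X : D.Dia (Cat.of (B × A))) :
    (vanishing B S D).prop A X ↔ ∀ b ∈ S, Limits.IsZero ((pb (sectR A b)).obj (ofDia X)) := by
  refine forall_congr' fun b => forall_congr' fun _ => ?_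
  rw [isZero_iff_eval hD h]
  exact forall_congr' fun a => (isZero_pb_ofDia_iff (ptAt (A := Cat.of (B × A)) (b, a)) X).symm

/-- Kan extensions along `id_B × f` are computed separately at each `b`, and Kan extensions of zero
diagrams are zero. -/
lemma vanishing_isClosed (hD : D.IsDerivator) (h : Limits.HasZeroObject (D.Dia pt.{w}))
    (B : Cat.{w, w}) (S : Set B) : (vanishing B S D).IsClosed where
  iso e hX b hb a := (hX b hb a).of_iso ((D.eval _).mapIso e.symm)
  sigma A X hX b hb a := by
    obtain ⟨i, a⟩ := a
    exact (hX i b hb a).of_iso ((D.resComp (ptAt (A := Cat.of (B × A i)) (b, a))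
      (prodFun B (sigmaIncl A i))).app X)
  lan {A A' f X T} φ hφ hX := by
    have hz := hasZeroObject_st hD h A'
    rw [vanishing_prop_iff hD h] at hX ⊢
    intro b hb
    have h₁ := (isUniv_homToSt_iff (f := prodFun B f) (X := ofDia T)
      (φ ≫ (D.res (prodFun B f)).map (ofDiaValIso T).inv)).2 (hφ.comp_map (ofDiaValIso T).inv)
    exact ((isUniv_id_prod_iff hD f _).1 h₁ b).isZero (hX b hb)
  ran {A A' f X T} φ hφ hX := by
    have hz := hasZeroObject_st hD h A'
    rw [vanishing_prop_iff hD h] at hX ⊢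
    intro b hb
    have h₁ := (isCouniv_homToSt'_iff (f := prodFun B f) (X := ofDia T)
      ((D.res (prodFun B f)).map (ofDiaValIso T).hom ≫ φ)).2 (hφ.map_comp (ofDiaValIso T).hom)
    exact ((isCouniv_id_prod_iff hD f _).1 h₁ b).isZero (hX b hb)

lemma vanishing_isStrict (hD : D.IsStableDerivator) (B : Cat.{w, w}) (S : Set B) :
    (vanishing B S D).IsStrict :=
  (vanishing_isClosed hD.isDerivator hD.pointed B S).isStrict (hD.isDerivator.shift B)

lemma vanishing_isStableDerivator (hD : D.IsStableDerivator) (B : Cat.{w, w}) (S : Set B) :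
    (vanishing B S D).toPre.IsStableDerivator := by
  obtain ⟨Z, hZ⟩ := hasZeroObject_dia hD.isDerivator hD.pointed (Cat.of (B × pt))
  exact (vanishing_isClosed hD.isDerivator hD.pointed B S).isStableDerivator (hD.shift B) Z hZ
    fun _ _ _ => isZero_res hD.isDerivator _ hZ

end Prederivator

/-! ### Kan extensions as morphisms of shifted prederivators -/

namespace CategoryTheory.Cat

lemma isIso_of_isIso_toNatTrans {C E : Cat.{v, u}} {F G : C ⟶ E} (α : F ⟶ G)
    (h : IsIso α.toNatTrans) : IsIso α :=
  ⟨.ofNatTrans (CategoryTheory.inv α.toNatTrans),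
    congrArg Cat.Hom₂.ofNatTrans (IsIso.hom_inv_id α.toNatTrans),
    congrArg Cat.Hom₂.ofNatTrans (IsIso.inv_hom_id α.toNatTrans)⟩

end CategoryTheory.Cat

namespace CategoryTheory.Bicategory

lemma toNatTrans_mateEquiv_symm {C D E F : Cat.{v, u}}
    {G : C ⟶ E} {H : D ⟶ F} {L₁ : C ⟶ D} {R₁ : D ⟶ C} {L₂ : E ⟶ F} {R₂ : F ⟶ E}
    (adj₁ : Bicategory.Adjunction L₁ R₁) (adj₂ : Bicategory.Adjunction L₂ R₂)
    (f : R₁ ≫ G ⟶ H ≫ R₂) :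
    ((Bicategory.mateEquiv adj₁ adj₂).symm f).toNatTrans =
      (CategoryTheory.mateEquiv (Adjunction.ofCat adj₁) (Adjunction.ofCat adj₂)).symm
        f.toNatTrans := by
  refine (CategoryTheory.mateEquiv (Adjunction.ofCat adj₁) (Adjunction.ofCat adj₂)).injective ?_
  exact ((toNatTrans_mateEquiv adj₁ adj₂ _).symm.trans
    (congrArg Cat.Hom₂.toNatTrans (Equiv.apply_symm_apply _ f))).trans
      (Equiv.apply_symm_apply _ _).symm

lemma isIso_mateEquiv_of_toNatTrans {C D E F : Cat.{v, u}}
    {G : C ⟶ E} {H : D ⟶ F} {L₁ : C ⟶ D} {R₁ : D ⟶ C} {L₂ : E ⟶ F} {R₂ : F ⟶ E}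
    (adj₁ : Bicategory.Adjunction L₁ R₁) (adj₂ : Bicategory.Adjunction L₂ R₂)
    (f : G ≫ L₂ ⟶ L₁ ≫ H)
    (h : IsIso (CategoryTheory.mateEquiv (Adjunction.ofCat adj₁) (Adjunction.ofCat adj₂)
      (.mk _ _ _ _ f.toNatTrans)).natTrans) : IsIso (Bicategory.mateEquiv adj₁ adj₂ f) := by
  refine Cat.isIso_of_isIso_toNatTrans _ ?_
  rw [toNatTrans_mateEquiv]
  exact h

lemma isIso_mateEquiv_symm_of_toNatTrans {C D E F : Cat.{v, u}}
    {G : C ⟶ E} {H : D ⟶ F} {L₁ : C ⟶ D} {R₁ : D ⟶ C} {L₂ : E ⟶ F} {R₂ : F ⟶ E}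
    (adj₁ : Bicategory.Adjunction L₁ R₁) (adj₂ : Bicategory.Adjunction L₂ R₂)
    (f : R₁ ≫ G ⟶ H ≫ R₂)
    (h : IsIso ((CategoryTheory.mateEquiv (Adjunction.ofCat adj₁) (Adjunction.ofCat adj₂)).symm
      (.mk _ _ _ _ f.toNatTrans)).natTrans) : IsIso ((Bicategory.mateEquiv adj₁ adj₂).symm f) := by
  refine Cat.isIso_of_isIso_toNatTrans _ ?_
  rw [toNatTrans_mateEquiv_symm]
  exact h

end CategoryTheory.Bicategory

namespace Prederivator

variable {D : Prederivator.{w, v, u}}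

/-- The functors `a ↦ (a, k i)`. -/
def sectLIso (A : Cat.{w, w}) {I J : Cat.{w, w}} (k : I ⥤ J) (i : I) :
    sectL A i ⋙ prodFun A k ≅ sectL A (k.obj i) :=
  NatIso.ofComponents (fun a => Iso.refl (C := A × J) (a, k.obj i)) fun {a a'} g => by
    have h : (sectL A i ⋙ prodFun A k).map g = (sectL A (k.obj i)).map g :=
      Prod.ext rfl (k.map_id i)
    rw [h]
    exact (Category.comp_id _).trans (Category.id_comp ((sectL A (k.obj i)).map g)).symm

/-- The two functors `a ↦ (a, k i)` differ in the value `k.map (𝟙 i)` against `𝟙`, an equality that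
is not definitional; the isomorphism `sectLIso` bridges it. -/
lemma isUniv_sectL_congr {A B I J : Cat.{w, w}} (f : A ⥤ B) (k : I ⥤ J) (i : I)
    {X : D.St (Cat.of (A × J))} {T : D.St (Cat.of (B × J))} (φ : X ⟶ (pb (prodId f J)).obj T) :
    (pb f).IsUniv (T := (pb (sectL B i ⋙ prodFun B k)).obj T)
      ((pb (sectL A i ⋙ prodFun A k)).map φ) ↔
    (pb f).IsUniv (T := (pb (sectL B (k.obj i))).obj T) ((pb (sectL A (k.obj i))).map φ) := by
  have h := isUniv_bc_congr (p := sectL A i ⋙ prodFun A k) (q := f) (f := prodId f J)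
    (g := sectL B i ⋙ prodFun B k) (p' := sectL A (k.obj i)) (g' := sectL B (k.obj i))
    (𝟙 (sectL A i ⋙ prodFun A k ⋙ prodId f J)) (𝟙 (sectL A (k.obj i) ⋙ prodId f J))
    (sectLIso A k i) (sectLIso B k i) (fun x => ?_) φ
  · have h₁ := (congrArg (CategoryStruct.comp (obj := D.St A)
      ((pb (sectL A i ⋙ prodFun A k)).map φ)) (tr_id (sectL A i ⋙ prodFun A k ⋙ prodId f J) T)).trans
        (Category.comp_id _)
    have h₂ := (congrArg (CategoryStruct.comp (obj := D.St A) ((pb (sectL A (k.obj i))).map φ))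
      (tr_id (sectL A (k.obj i) ⋙ prodId f J) T)).trans (Category.comp_id _)
    exact (iff_of_eq (congrArg (Functor.IsUniv (pb f)
      (T := (pb (sectL B i ⋙ prodFun B k)).obj T)) h₁.symm)).trans
      (h.trans (iff_of_eq (congrArg (Functor.IsUniv (pb f)
        (T := (pb (sectL B (k.obj i))).obj T)) h₂)))
  · exact Prod.ext ((Category.id_comp (𝟙 (f.obj x))).trans
      ((f.map_id x).symm.trans (Category.comp_id (f.map (𝟙 x))).symm)) rfl

lemma isCouniv_sectL_congr {A B I J : Cat.{w, w}} (f : A ⥤ B) (k : I ⥤ J) (i : I)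
    {X : D.St (Cat.of (A × J))} {T : D.St (Cat.of (B × J))} (φ : (pb (prodId f J)).obj T ⟶ X) :
    (pb f).IsCouniv (T := (pb (sectL B i ⋙ prodFun B k)).obj T)
      ((pb (sectL A i ⋙ prodFun A k)).map φ) ↔
    (pb f).IsCouniv (T := (pb (sectL B (k.obj i))).obj T) ((pb (sectL A (k.obj i))).map φ) := by
  have h := isCouniv_cobc_congr (p := f) (q := sectL A i ⋙ prodFun A k) (g := prodId f J)
    (f := sectL B i ⋙ prodFun B k) (q' := sectL A (k.obj i)) (f' := sectL B (k.obj i))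
    (𝟙 (sectL A i ⋙ prodFun A k ⋙ prodId f J)) (𝟙 (sectL A (k.obj i) ⋙ prodId f J))
    (sectLIso A k i) (sectLIso B k i) (fun x => ?_) φ
  · have h₁ := (congrArg (fun t => CategoryStruct.comp (obj := D.St A) t
      ((pb (sectL A i ⋙ prodFun A k)).map φ)) (tr_id (sectL A i ⋙ prodFun A k ⋙ prodId f J) T)).trans
        (Category.id_comp _)
    have h₂ := (congrArg (fun t => CategoryStruct.comp (obj := D.St A) t
      ((pb (sectL A (k.obj i))).map φ)) (tr_id (sectL A (k.obj i) ⋙ prodId f J) T)).trans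
        (Category.id_comp _)
    exact (iff_of_eq (congrArg (Functor.IsCouniv (pb f)
      (T := (pb (sectL B i ⋙ prodFun B k)).obj T)) h₁.symm)).trans
      (h.trans (iff_of_eq (congrArg (Functor.IsCouniv (pb f)
        (T := (pb (sectL B (k.obj i))).obj T)) h₂)))
  · exact Prod.ext ((Category.id_comp (f.map (𝟙 x))).trans
      ((f.map_id x).trans (Category.comp_id (𝟙 (f.obj x))).symm)) rfl

/-- The Beck–Chevalley condition for `f × id` against `id × k`: universality along `f × id` is
tested at each parameter, and the base change at `i` is the original arrow at `k i`. -/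
lemma leftExact_prodId (hD : D.IsDerivator) {A B I J : Cat.{w, w}} (f : A ⥤ B) (k : I ⥤ J)
    (X : D.St (Cat.of (A × J))) (T : D.St (Cat.of (B × J))) (φ : X ⟶ (pb (prodId f J)).obj T)
    (hφ : (pb (prodId f J)).IsUniv φ) : (pb (prodId f I)).IsUniv
      (bc (p := prodFun A k) (q := prodId f I) (f := prodId f J) (g := prodFun B k)
        (𝟙 (prodFun A k ⋙ prodId f J)) φ) := by
  refine (isUniv_prod_id_iff hD f (T := (pb (prodFun B k)).obj T) _).2 fun i => ?_
  refine Eq.mp (congrArg (Functor.IsUniv (pb f) (T := (pb (sectL B i)).obj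
      ((pb (prodFun B k)).obj T))) ?_)
    ((isUniv_sectL_congr f k i φ).2 ((isUniv_prod_id_iff hD f φ).1 hφ (k.obj i)))
  have h₁ : bc (p := prodFun A k) (q := prodId f I) (f := prodId f J) (g := prodFun B k)
        (𝟙 (prodFun A k ⋙ prodId f J)) φ = (pb (prodFun A k)).map φ :=
    (congrArg (CategoryStruct.comp (obj := D.St _) ((pb (prodFun A k)).map φ))
      (tr_id (prodFun A k ⋙ prodId f J) T)).trans (Category.comp_id _)
  exact ((congrArg (fun t => (pb (sectL A i)).map t) h₁).trans (pb_pb (sectL A i) (prodFun A k) φ)).symm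

lemma rightExact_prodId (hD : D.IsDerivator) {A B I J : Cat.{w, w}} (f : A ⥤ B) (k : I ⥤ J)
    (X : D.St (Cat.of (A × J))) (T : D.St (Cat.of (B × J))) (φ : (pb (prodId f J)).obj T ⟶ X)
    (hφ : (pb (prodId f J)).IsCouniv φ) : (pb (prodId f I)).IsCouniv
      (cobc (p := prodId f I) (q := prodFun A k) (f := prodFun B k) (g := prodId f J)
        (𝟙 (prodFun A k ⋙ prodId f J)) φ) := by
  refine (isCouniv_prod_id_iff hD f (T := (pb (prodFun B k)).obj T) _).2 fun i => ?_
  refine Eq.mp (congrArg (Functor.IsCouniv (pb f) (T := (pb (sectL B i)).obj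
      ((pb (prodFun B k)).obj T))) ?_)
    ((isCouniv_sectL_congr f k i φ).2 ((isCouniv_prod_id_iff hD f φ).1 hφ (k.obj i)))
  have h₁ : cobc (p := prodId f I) (q := prodFun A k) (f := prodFun B k) (g := prodId f J)
        (𝟙 (prodFun A k ⋙ prodId f J)) φ = (pb (prodFun A k)).map φ :=
    (congrArg (CategoryStruct.comp (obj := D.St _) · ((pb (prodFun A k)).map φ))
      (tr_id (prodFun A k ⋙ prodId f J) T)).trans (Category.id_comp _)
  exact ((congrArg (fun t => (pb (sectL A i)).map t) h₁).trans (pb_pb (sectL A i) (prodFun A k) φ)).symm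

/-- Left adjoints of restriction functors, as 1-cells. -/
noncomputable def lanAdj (hD : D.Der3) {A B : Cat.{w, w}} (f : A ⥤ B) :
    Bicategory.Adjunction ((@Functor.leftAdjoint _ _ _ _ (D.res f) (hD A B f).1).toCatHom)
      (D.map (opHom f)) :=
  (@Adjunction.ofIsRightAdjoint _ _ _ _ (D.res f) (hD A B f).1).toCat

/-- Right adjoints of restriction functors, as 1-cells. -/
noncomputable def ranAdj (hD : D.Der3) {A B : Cat.{w, w}} (f : A ⥤ B) :
    Bicategory.Adjunction (D.map (opHom f))
      ((@Functor.rightAdjoint _ _ _ _ (D.res f) (hD A B f).2).toCatHom) :=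
  (@Adjunction.ofIsLeftAdjoint _ _ _ _ (D.res f) (hD A B f).2).toCat

/-- Left Kan extension along `f`, as a morphism of shifted derivators. -/
lemma exists_lan (hD : D.IsDerivator) {A B : Cat.{w, w}} (f : A ⥤ B) :
    ∃ L : shift A D ⟶ shift B D, Nonempty (Bicategory.Adjunction L (shiftRes f D)) := by
  -- (Der3) gives the components. They form a pseudonatural transformation because the mates of the
  -- constraints are invertible, by `leftExact_prodId`.
  refine ⟨_, ⟨Pseudofunctor.StrongTrans.leftAdjointTransAdj (shiftRes f D) _
    (fun I => lanAdj hD.der3 (prodId f I.unop)) fun {J I} k => ?_⟩⟩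
  refine isIso_mateEquiv_symm_of_toNatTrans _ _ _ ?_
  refine (Functor.isIso_mate_iff _ _ _).2 fun X T φ hφ => ?_
  have h := (leftExact_iff (p := prodFun A k.unop.toFunctor) (q := prodId f I.unop)
    (f := prodId f J.unop) (g := prodFun B k.unop.toFunctor)
    (𝟙 (prodFun A k.unop.toFunctor ⋙ prodId f J.unop))).2
    (leftExact_prodId hD f k.unop.toFunctor) X T φ hφ
  refine Eq.mp (congrArg (Functor.IsUniv (D.res (prodId f I.unop))
    (T := (D.res (prodFun B k.unop.toFunctor)).obj T)) ?_) h
  refine congrArg (CategoryStruct.comp (obj := D.Dia _) _) ?_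
  refine congrArg (CategoryStruct.comp (obj := D.Dia _) _) ?_
  -- The constraint of `shiftRes` is `resSquare` of an identity with the factor `resTrans (𝟙 _)`
  -- left out, and that factor is an identity.
  exact (congrArg (fun t : D.res (prodFun A k.unop.toFunctor ⋙ prodId f J.unop) ⟶
    D.res (prodFun A k.unop.toFunctor ⋙ prodId f J.unop) => CategoryStruct.comp (obj := D.Dia _)
      (t.app T) ((D.resComp (prodId f I.unop) (prodFun B k.unop.toFunctor)).hom.app T))
    (D.resTrans_id _)).trans (Category.id_comp _)

/-- Right Kan extension along `f`, as a morphism of shifted derivators. -/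
lemma exists_ran (hD : D.IsDerivator) {A B : Cat.{w, w}} (f : A ⥤ B) :
    ∃ R : shift A D ⟶ shift B D, Nonempty (Bicategory.Adjunction (shiftRes f D) R) := by
  refine ⟨_, ⟨Pseudofunctor.StrongTrans.rightAdjointTransAdj (shiftRes f D) _
    (fun I => ranAdj hD.der3 (prodId f I.unop)) fun {J I} k => ?_⟩⟩
  refine isIso_mateEquiv_of_toNatTrans _ _ _ ?_
  refine (Functor.isIso_mate_iff' _ _ _).2 fun X T φ hφ => ?_
  have h := (rightExact_iff (p := prodId f I.unop) (q := prodFun A k.unop.toFunctor)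
    (f := prodFun B k.unop.toFunctor) (g := prodId f J.unop)
    (𝟙 (prodFun A k.unop.toFunctor ⋙ prodId f J.unop))).2
    (rightExact_prodId hD f k.unop.toFunctor) X T φ hφ
  refine Eq.mp (congrArg (Functor.IsCouniv (D.res (prodId f I.unop))
    (T := (D.res (prodFun B k.unop.toFunctor)).obj T)) ?_) h
  refine congrArg (CategoryStruct.comp (obj := D.Dia _) · _) ?_
  refine congrArg (CategoryStruct.comp (obj := D.Dia _) _) ?_
  exact (congrArg (fun t : D.res (prodFun A k.unop.toFunctor ⋙ prodId f J.unop) ⟶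
    D.res (prodFun A k.unop.toFunctor ⋙ prodId f J.unop) => CategoryStruct.comp (obj := D.Dia _)
      (t.app T) ((D.resComp (prodFun A k.unop.toFunctor) (prodId f J.unop)).hom.app T))
    (D.resTrans_id _)).trans (Category.id_comp _)

end Prederivator

/-! ### Conditions on diagrams and the 2-functors which they define -/

namespace StableDerivator

set_option linter.checkUnivs false in
/-- A condition on diagrams of shape `A` in stable derivators, which is preserved by exact
morphisms and which is checked parameterwise. -/
structure Cond (A : Cat.{w, w}) where
  /-- the full subprederivators of the diagrams which satisfy the condition -/
  sub (D : StableDerivator.{w, v, u}) : FullSub (shift A D.toPre)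
  map {D E : StableDerivator.{w, v, u}} (F : D ⟶ E) (I : Cat.{w, w})
    (X : (shift A D.toPre).Dia I) (h : (sub D).prop I X) :
    (sub E).prop I (((shiftMap A F.mor).app (op I)).toFunctor.obj X)
  /-- the condition, without parameters -/
  pred (D : StableDerivator.{w, v, u}) (X : D.toPre.St A) : Prop
  pred_iso {D : StableDerivator.{w, v, u}} {X Y : D.toPre.St A} (e : X ≅ Y) (h : pred D X) :
    pred D Y
  prop_iff (D : StableDerivator.{w, v, u}) (I : Cat.{w, w}) (X : D.toPre.Dia (Cat.of (A × I))) :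
    (sub D).prop I X ↔ ∀ i : I, pred D ((pb (sectL A i)).obj (ofDia X))

namespace Cond

variable {A B C : Cat.{w, w}}

section Functor
variable (P : Cond.{w, v, u} A)

/-- The action on exact morphisms. -/
abbrev functorMap {D E : StableDerivator.{w, v, u}} (F : D ⟶ E) :
    (P.sub D).toPre ⟶ (P.sub E).toPre :=
  FullSub.mapOfMem (shiftMap A F.mor) (P.map F)

/-- The action on modifications. -/
abbrev functorMap₂ {D E : StableDerivator.{w, v, u}} {F G : D ⟶ E} (θ : F ⟶ G) :
    P.functorMap F ⟶ P.functorMap G :=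
  FullSub.map₂OfMem (P.map F) (P.map G) (shiftMap₂ A θ)

/-- The 2-functor of the diagrams which satisfy the condition. -/
abbrev functor : Pseudofunctor StableDerivator.{w, v, u} Prederivator.{w, v, u} where
  obj D := (P.sub D).toPre
  map F := P.functorMap F
  map₂ θ := P.functorMap₂ θ
  mapId D := Iso.refl (𝟙 (P.sub D).toPre)
  mapComp F G := Iso.refl (P.functorMap F ≫ P.functorMap G)
  map₂_id _ := rfl
  map₂_comp _ _ := rfl
  map₂_whisker_left F _ _ θ := by
    ext A X; exact ObjectProperty.hom_ext _ (aux_whisker rfl)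
  map₂_whisker_right θ F := by
    ext A X; exact ObjectProperty.hom_ext _ (aux_whisker rfl)
  map₂_associator F G H := by
    ext I X
    exact ObjectProperty.hom_ext _ (aux_five
      (CategoryTheory.Functor.map_id ((shiftMap A H.mor).app I).toFunctor _))
  map₂_left_unitor F := by
    ext I X
    exact ObjectProperty.hom_ext _ (aux_three
      (CategoryTheory.Functor.map_id ((shiftMap A F.mor).app I).toFunctor _))
  map₂_right_unitor F := by
    ext A X
    exact ObjectProperty.hom_ext _ (aux_three rfl)

end Functor

end Cond

lemma naturality_comp_app {D E : Prederivator.{w, v, u}} (F : D ⟶ E) {A B C : Cat.{w, w}}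
    (b : A ⥤ B) (a : B ⥤ C) (X : D.Dia C) :
    (F.naturality (opHom (b ⋙ a))).hom.toNatTrans.app X ≫
      (E.resComp b a).hom.app ((F.app (op C)).toFunctor.obj X) =
    (F.app (op A)).toFunctor.map ((D.resComp b a).hom.app X) ≫
      (F.naturality (opHom b)).hom.toNatTrans.app ((D.res a).obj X) ≫
        (E.res b).map ((F.naturality (opHom a)).hom.toNatTrans.app X) := by
  have h := congrArg (fun t => t.toNatTrans.app X) (F.naturality_comp (opHom a) (opHom b))
  dsimp at h
  simp only [Category.id_comp, Category.comp_id] at h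
  exact h

/-- The chase behind `shiftResNat`: `h₁` and `h₂` are the composition axiom of `F` for the two ways
around one commutative square of functors. -/
lemma natTrans_conj_eq {C₁ : Type*} [Category C₁] {C₂ : Type*} [Category C₂] (F : C₁ ⥤ C₂)
    {P₁ P₂ P₃ : C₁} {p : P₂ ≅ P₁} {q : P₂ ⟶ P₃} {Q₁ Q₂ Q₃ Q₄ Q₅ : C₂} {m : F.obj P₁ ≅ Q₁}
    {m' : Q₁ ⟶ Q₂} {n : F.obj P₂ ⟶ Q₃} {r : Q₃ ≅ Q₂} {s : Q₃ ⟶ Q₄} {t : F.obj P₃ ⟶ Q₅}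
    {t' : Q₅ ≅ Q₄}
    (h₁ : n ≫ r.hom = F.map p.hom ≫ m.hom ≫ m') (h₂ : n ≫ s = F.map q ≫ t ≫ t'.hom) :
    m.inv ≫ 𝟙 _ ≫ F.map (p.inv ≫ q) ≫ 𝟙 _ ≫ t ≫ 𝟙 _ =
      (𝟙 _ ≫ m' ≫ 𝟙 _ ≫ (r.inv ≫ s) ≫ 𝟙 _) ≫ t'.inv := by
  have h₃ : m' = m.inv ≫ F.map p.inv ≫ n ≫ r.hom := by
    rw [h₁, ← Functor.map_comp_assoc]; simp
  simp [h₃, reassoc_of% h₂]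

lemma conj_naturality {C₁ : Type*} [Category C₁] {P Q P' Q' : C₁} {m : P ≅ Q} {m' : P' ≅ Q'}
    {x : P ⟶ P'} {y : Q ⟶ Q'} (h : x ≫ m'.hom = m.hom ≫ y) : y ≫ m'.inv = m.inv ≫ x := by
  rw [Iso.comp_inv_eq, Category.assoc, h, Iso.inv_hom_id_assoc]

lemma comp_id_eq {C₁ : Type*} [Category C₁] {P : C₁} {m : P ⟶ P} (h : m = 𝟙 P) :
    (𝟙 P ≫ 𝟙 P) ≫ 𝟙 P = m ≫ 𝟙 P ≫ 𝟙 P := by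
  simp [h]

lemma comp_ids_eq {C₁ : Type*} [Category C₁] {P Q R : C₁} {m : P ⟶ P} {x : P ⟶ Q} {y : Q ⟶ R}
    (h : m = 𝟙 P) : (((((𝟙 P ≫ x) ≫ 𝟙 Q) ≫ y) ≫ 𝟙 R) ≫ 𝟙 R) =
      m ≫ 𝟙 P ≫ x ≫ 𝟙 Q ≫ y ≫ 𝟙 R := by
  simp [h]

/-- Restriction is natural. -/
def shiftResNat {A B : Cat.{w, w}} (f : A ⥤ B) {D E : Prederivator.{w, v, u}} (F : D ⟶ E) :
    shiftMap B F ≫ shiftRes f E ≅ shiftRes f D ≫ shiftMap A F :=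
  Pseudofunctor.StrongTrans.isoMk (fun I => (F.naturality (opHom (prodId f I.unop))).symm)
    (fun {J I} k => by
      ext X
      exact natTrans_conj_eq (F.app _).toFunctor
        (p := (D.resComp (prodId f I.unop) (prodFun B k.unop.toFunctor)).app X)
        (q := (D.resComp (prodFun A k.unop.toFunctor) (prodId f J.unop)).hom.app X)
        (m := (Cat.Hom.toNatIso (F.naturality (opHom (prodId f I.unop)))).app _)
        (r := (E.resComp (prodId f I.unop) (prodFun B k.unop.toFunctor)).app _)
        (s := (E.resComp (prodFun A k.unop.toFunctor) (prodId f J.unop)).hom.app _)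
        (t' := (E.res (prodFun A k.unop.toFunctor)).mapIso
          ((Cat.Hom.toNatIso (F.naturality (opHom (prodId f J.unop)))).app X))
        (naturality_comp_app F (prodId f I.unop) (prodFun B k.unop.toFunctor) X)
        (naturality_comp_app F (prodFun A k.unop.toFunctor) (prodId f J.unop) X))

namespace Cond

variable {A B : Cat.{w, w}} (P : Cond.{w, v, u} A) (Q : Cond.{w, v, u} B) (f : A ⥤ B)
  (h : ∀ (D : StableDerivator.{w, v, u}) (I : Cat.{w, w}) (X : D.toPre.Dia (Cat.of (B × I))),
    (Q.sub D).prop I X → (P.sub D).prop I ((D.toPre.res (prodId f I)).obj X))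

/-- Restriction, as a transformation of 2-functors. -/
def resTransform : Q.functor ⟶ P.functor where
  app D := FullSub.mapOfMem (shiftRes f D.toPre) (h D)
  naturality {D E} F :=
    { hom := FullSub.map₂OfMem (F := shiftMap B F.mor ≫ shiftRes f E.toPre)
        (G := shiftRes f D.toPre ≫ shiftMap A F.mor)
        (fun I X hX => h E I _ (Q.map F I X hX)) (fun I X hX => P.map F I _ (h D I X hX))
        (shiftResNat f F.mor).hom
      inv := FullSub.map₂OfMem (F := shiftRes f D.toPre ≫ shiftMap A F.mor)
        (G := shiftMap B F.mor ≫ shiftRes f E.toPre)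
        (fun I X hX => P.map F I _ (h D I X hX)) (fun I X hX => h E I _ (Q.map F I X hX))
        (shiftResNat f F.mor).inv
      hom_inv_id := by
        ext I X
        exact ObjectProperty.hom_ext _
          ((Cat.Hom.toNatIso (F.mor.naturality (opHom (prodId f I.unop)))).symm.app _).hom_inv_id
      inv_hom_id := by
        ext I X
        exact ObjectProperty.hom_ext _
          ((Cat.Hom.toNatIso (F.mor.naturality (opHom (prodId f I.unop)))).symm.app _).inv_hom_id }
  naturality_naturality {D E F G} θ := by
    ext I X
    refine ObjectProperty.hom_ext _ ?_
    exact conj_naturality (m := (Cat.Hom.toNatIso (F.mor.naturality (opHom (prodId f I.unop)))).app _)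
      (m' := (Cat.Hom.toNatIso (G.mor.naturality (opHom (prodId f I.unop)))).app _)
      (congrArg (fun t => t.toNatTrans.app X.obj) (θ.as.naturality (opHom (prodId f I.unop))))
  naturality_id D := by
    ext I X
    refine ObjectProperty.hom_ext _ ?_
    exact comp_id_eq (CategoryTheory.Functor.map_id (D.toPre.res (prodId f I.unop)) _)
  naturality_comp {D E K} F G := by
    ext I X
    refine ObjectProperty.hom_ext _ ?_
    exact comp_ids_eq (CategoryTheory.Functor.map_id (K.toPre.res (prodId f I.unop)) _)

end Cond

end StableDerivator

/-! ### Invertible modifications and componentwise adjunctions -/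

namespace Prederivator

lemma comp_ids_eq_comp {C₁ : Type*} [Category C₁] {P Q : C₁} {m : P ⟶ P} {m' : Q ⟶ Q} {x : P ⟶ Q}
    (h : m = 𝟙 P) (h' : m' = 𝟙 Q) :
    𝟙 P ≫ 𝟙 P ≫ m ≫ 𝟙 P ≫ x ≫ 𝟙 Q = (𝟙 P ≫ x ≫ 𝟙 Q ≫ 𝟙 Q ≫ 𝟙 Q) ≫ m' := by
  simp [h, h']

variable {D E : Prederivator.{w, v, u}}

lemma isIso_modification {F G : D ⟶ E} (θ : F ⟶ G)
    (h : ∀ (I : Cat.{w, w}) (X : D.Dia I), IsIso ((θ.as.app (op I)).toNatTrans.app X)) :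
    IsIso θ := by
  have h' (I : Cat.{w, w}ᵒᵖ) : IsIso (θ.as.app I) :=
    Cat.isIso_of_isIso_toNatTrans _ (@NatIso.isIso_of_isIso_app _ _ _ _ _ _ _ (h I.unop))
  exact (Pseudofunctor.StrongTrans.isoMk (fun I => asIso (θ.as.app I))
    (fun k => θ.as.naturality k)).isIso_hom

/-- The components of an adjunction. -/
def adjunctionApp {L : D ⟶ E} {R : E ⟶ D} (adj : Bicategory.Adjunction L R) (I : Cat.{w, w}) :
    (L.app (op I)).toFunctor ⊣ (R.app (op I)).toFunctor :=
  Adjunction.ofCat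
    { unit := adj.unit.as.app (op I)
      counit := adj.counit.as.app (op I)
      left_triangle := congrArg (fun t => t.as.app (op I)) adj.left_triangle
      right_triangle := congrArg (fun t => t.as.app (op I)) adj.right_triangle }

namespace FullSub

variable {P : FullSub D} {Q : FullSub E}

/-- Restrictions of morphisms are compatible with the inclusions. -/
def mapOfMemIncl (F : D ⟶ E)
    (h : ∀ A X, P.prop A X → Q.prop A ((F.app (op A)).toFunctor.obj X)) :
    mapOfMem F h ≫ Q.incl ≅ P.incl ≫ F :=
  Pseudofunctor.StrongTrans.isoMk (fun I => Cat.Hom.isoMk (Iso.refl ((P.prop I.unop).ι ⋙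
    (F.app I).toFunctor))) (fun {J I} k => by
      ext X
      exact comp_ids_eq_comp (CategoryTheory.Functor.map_id (F.app I).toFunctor _)
        (CategoryTheory.Functor.map_id (E.map k).toFunctor _))

/-- Invertibility is only asked on the diagrams in `P`, so that a unit or counit may become
invertible after restriction. -/
lemma isIso_map₂OfMem {F G : D ⟶ E}
    (hF : ∀ A X, P.prop A X → Q.prop A ((F.app (op A)).toFunctor.obj X))
    (hG : ∀ A X, P.prop A X → Q.prop A ((G.app (op A)).toFunctor.obj X)) (θ : F ⟶ G)
    (h : ∀ I X, P.prop I X → IsIso ((θ.as.app (op I)).toNatTrans.app X)) :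
    IsIso (map₂OfMem hF hG θ) :=
  isIso_modification _ fun I X => (isIso_hom_iff _).1 (h I X.obj X.property)

end FullSub

end Prederivator

/-! ### Words of Kan extensions and the equivalences which they realize -/

/-- Concatenation of sequences of restrictions and Kan extensions. -/
def KanWord.append {A B : Cat.{w, w}} : KanWord.{w} A B → {C : Cat.{w, w}} → KanWord.{w} B C →
    KanWord.{w} A C
  | .nil _, _, t => t
  | .cons s r, _, t => .cons s (r.append t)

lemma KanWord.admissible_append {A B C : Cat.{w, w}} {s : KanWord.{w} A B} {t : KanWord.{w} B C}
    (hs : KanWord.Admissible.{w, v, u} s) (ht : KanWord.Admissible.{w, v, u} t) :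
    KanWord.Admissible.{w, v, u} (s.append t) := by
  induction s with
  | nil => exact ht
  | cons s r ih => exact ⟨hs.1, ih hs.2 ht⟩

lemma KanWord.IsRealizedBy.of_iso {D : Prederivator.{w, v, u}} {A B : Cat.{w, w}}
    {s : KanWord.{w} A B} {F F' : shift A D ⟶ shift B D} (h : s.IsRealizedBy D F) (e : F' ≅ F) :
    s.IsRealizedBy D F' := by
  cases s with
  | nil => exact h.map (e ≪≫ ·)
  | cons s r =>
    obtain ⟨G, H, hG, hH, ⟨i⟩⟩ := h
    exact ⟨G, H, hG, hH, ⟨e ≪≫ i⟩⟩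

lemma KanWord.isRealizedBy_append {D : Prederivator.{w, v, u}} {A B C : Cat.{w, w}}
    {s : KanWord.{w} A B} {t : KanWord.{w} B C} {F : shift A D ⟶ shift B D}
    {G : shift B D ⟶ shift C D} (hs : s.IsRealizedBy D F) (ht : t.IsRealizedBy D G) :
    (s.append t).IsRealizedBy D (F ≫ G) := by
  induction s with
  | nil => 
    obtain ⟨i⟩ := hs
    exact ht.of_iso (whiskerRightIso i G ≪≫ λ_ G)
  | cons s r ih =>
    obtain ⟨F₁, F₂, h₁, h₂, ⟨i⟩⟩ := hs
    exact ⟨F₁, F₂ ≫ G, h₁, ih h₂ ht, ⟨whiskerRightIso i G ≪≫ α_ F₁ F₂ G⟩⟩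

lemma KanStep.isRealizedBy_single {D : Prederivator.{w, v, u}} {A B : Cat.{w, w}}
    {s : KanStep.{w} A B} {F : shift A D ⟶ shift B D} (h : s.IsRealizedBy D F) :
    (KanWord.cons s (.nil B)).IsRealizedBy D F :=
  ⟨F, 𝟙 _, h, ⟨Iso.refl _⟩, ⟨(ρ_ F).symm⟩⟩

namespace StableDerivator

namespace Cond

variable {A B C : Cat.{w, w}} {P : Cond.{w, v, u} A} {Q : Cond.{w, v, u} B} {R : Cond.{w, v, u} C}

/-- There is an equivalence between the diagrams which satisfy `P` and the diagrams which satisfy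
`Q`, natural with respect to exact morphisms, which is given by finite sequences of restrictions
and Kan extensions. -/
def WordEquiv (P : Cond.{w, v, u} A) (Q : Cond.{w, v, u} B) : Prop :=
  ∃ (e : Bicategory.Equivalence P.functor Q.functor) (s : KanWord.{w} A B) (t : KanWord.{w} B A),
    KanWord.Admissible.{w, v, u} s ∧ KanWord.Admissible.{w, v, u} t ∧
    ∀ D : StableDerivator.{w, v, u},
      ∃ (F : shift A D.toPre ⟶ shift B D.toPre) (G : shift B D.toPre ⟶ shift A D.toPre),
        s.IsRealizedBy D.toPre F ∧ t.IsRealizedBy D.toPre G ∧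
        Nonempty (e.hom.app D ≫ (Q.sub D).incl ≅ (P.sub D).incl ≫ F) ∧
        Nonempty (e.inv.app D ≫ (P.sub D).incl ≅ (Q.sub D).incl ≫ G)

lemma WordEquiv.symm (h : WordEquiv P Q) : WordEquiv Q P := by
  obtain ⟨e, s, t, hs, ht, h⟩ := h
  refine ⟨e.symm', t, s, ht, hs, fun D => ?_⟩
  obtain ⟨F, G, hF, hG, i, j⟩ := h D
  exact ⟨G, F, hG, hF, j, i⟩

/-- Pasting of squares which commute up to isomorphism. -/
def pasteIso {K : Type*} [Bicategory K] {a b c a' b' c' : K} {f : a ⟶ b} {g : b ⟶ c} {f' : a' ⟶ b'}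
    {g' : b' ⟶ c'} {x : a ⟶ a'} {y : b ⟶ b'} {z : c ⟶ c'} (i : f ≫ y ≅ x ≫ f')
    (j : g ≫ z ≅ y ≫ g') : (f ≫ g) ≫ z ≅ x ≫ f' ≫ g' :=
  α_ _ _ _ ≪≫ whiskerLeftIso f j ≪≫ (α_ _ _ _).symm ≪≫ whiskerRightIso i g' ≪≫ α_ _ _ _

/-- Words concatenate, those of the inverses in the opposite order, and the squares with the
inclusions are pasted. -/
lemma WordEquiv.trans (h : WordEquiv P Q) (h' : WordEquiv Q R) : WordEquiv P R := by
  obtain ⟨e, s, t, hs, ht, h⟩ := h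
  obtain ⟨e', s', t', hs', ht', h'⟩ := h'
  refine ⟨e.trans' e', s.append s', t'.append t, KanWord.admissible_append hs hs',
    KanWord.admissible_append ht' ht, fun D => ?_⟩
  obtain ⟨F, G, hF, hG, ⟨i⟩, ⟨j⟩⟩ := h D
  obtain ⟨F', G', hF', hG', ⟨i'⟩, ⟨j'⟩⟩ := h' D
  exact ⟨F ≫ F', G' ≫ G, KanWord.isRealizedBy_append hF hF', KanWord.isRealizedBy_append hG' hG,
    ⟨pasteIso i i'⟩, ⟨pasteIso j' j⟩⟩

end Cond

end StableDerivator

/-! ### Kan extensions along fully faithful functors, as equivalences -/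

namespace Prederivator

variable {D : Prederivator.{w, v, u}}

/-- Isomorphisms of formal restrictions. -/
def stMk {J : Cat.{w, w}} {X Y : D.St J} (e : X.val ≅ Y.val) : X ≅ Y where
  hom := e.hom
  inv := e.inv
  hom_inv_id := e.hom_inv_id
  inv_hom_id := e.inv_hom_id

/-- Isomorphic diagrams are isomorphic as formal restrictions. -/
def ofDiaIso {J : Cat.{w, w}} {X Y : D.Dia J} (e : X ≅ Y) : ofDia X ≅ ofDia Y :=
  stMk (ofDiaValIso X ≪≫ e ≪≫ (ofDiaValIso Y).symm)

/-- A restriction, as a formal restriction. -/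
def ofDiaRes {K J : Cat.{w, w}} (f : K ⥤ J) (X : D.Dia J) :
    ofDia ((D.res f).obj X) ≅ (pb f).obj (ofDia X) :=
  stMk (ofDiaValIso _ ≪≫ (D.res f).mapIso (ofDiaValIso X).symm ≪≫ (pbValIso f (ofDia X)).symm)

lemma isIso_of_isUniv_res (hD : D.IsDerivator) {A B : Cat.{w, w}} (f : A ⥤ B) [f.Full] [f.Faithful]
    {X : D.Dia A} {T : D.Dia B} {φ : X ⟶ (D.res f).obj T} (h : (D.res f).IsUniv φ) : IsIso φ := by
  have h₁ := (isUniv_homToSt_iff (X := ofDia T) _).2 (h.comp_map (ofDiaValIso T).inv)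
  have h₂ := (isIso_st_iff _).1 (IsUniv.isIso_of_fullyFaithful hD f h₁)
  have h₃ := (isIso_comp_left_iff (C := D.Dia A) _ _).1 h₂
  have h₄ := (isIso_comp_right_iff (C := D.Dia A) _ _).1 h₃
  exact (isIso_comp_right_iff (C := D.Dia A) _ _).1 h₄

lemma isIso_of_isCouniv_res (hD : D.IsDerivator) {A B : Cat.{w, w}} (f : A ⥤ B) [f.Full] [f.Faithful]
    {X : D.Dia A} {T : D.Dia B} {φ : (D.res f).obj T ⟶ X} (h : (D.res f).IsCouniv φ) : IsIso φ := by
  have h₁ := (isCouniv_homToSt'_iff (X := ofDia T) _).2 (h.map_comp (ofDiaValIso T).hom)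
  have h₂ := (isIso_st_iff _).1 (IsCouniv.isIso_of_fullyFaithful hD f h₁)
  have h₃ := (isIso_comp_left_iff (C := D.Dia A) _ _).1 h₂
  have h₄ := (isIso_comp_right_iff (C := D.Dia A) _ _).1 h₃
  exact (isIso_comp_left_iff (C := D.Dia A) _ _).1 h₄

lemma faithful_prodId {A B : Cat.{w, w}} (f : A ⥤ B) [f.Faithful] (I : Cat.{w, w}) :
    (prodId f I).Faithful where
  map_injective e :=
    Prod.ext (f.map_injective (congrArg (fun t => t.1) e)) (congrArg (fun t => t.2) e)

lemma full_prodId {A B : Cat.{w, w}} (f : A ⥤ B) [f.Full] (I : Cat.{w, w}) :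
    (prodId f I).Full where
  map_surjective g :=
    ⟨⟨f.preimage g.1, g.2⟩, Prod.ext (f.map_preimage g.1) rfl⟩

lemma essImLan_prodId_iff (hD : D.IsDerivator) {A B : Cat.{w, w}} (f : A ⥤ B)
    [f.Full] [f.Faithful] (I : Cat.{w, w}) (X : D.Dia (Cat.of (B × I))) :
    D.EssImLan (prodId f I) X ↔
      ∀ i : I, (pb f).IsUniv (𝟙 ((pb f).obj ((pb (sectL B i)).obj (ofDia X)))) := by
  have := faithful_prodId f I
  have := full_prodId f I
  rw [← essImLan_congr (prodId f I) (ofDiaValIso X), essImLan_iff hD]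
  refine (isUniv_prod_id_iff hD f (T := ofDia X) _).trans (forall_congr' fun i => ?_)
  exact iff_of_eq (congrArg _ (CategoryTheory.Functor.map_id (pb (sectL A i)) _))

lemma essImRan_prodId_iff (hD : D.IsDerivator) {A B : Cat.{w, w}} (f : A ⥤ B)
    [f.Full] [f.Faithful] (I : Cat.{w, w}) (X : D.Dia (Cat.of (B × I))) :
    D.EssImRan (prodId f I) X ↔
      ∀ i : I, (pb f).IsCouniv (𝟙 ((pb f).obj ((pb (sectL B i)).obj (ofDia X)))) := by
  have := faithful_prodId f I
  have := full_prodId f I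
  rw [← essImRan_congr (prodId f I) (ofDiaValIso X), essImRan_iff hD]
  refine (isCouniv_prod_id_iff hD f (T := ofDia X) _).trans (forall_congr' fun i => ?_)
  exact iff_of_eq (congrArg _ (CategoryTheory.Functor.map_id (pb (sectL A i)) _))

/-- By a triangle identity, the unit at `f^* X` followed by the restricted counit is the identity of
`f^* X`, which is universal as `X` is in the essential image. So the counit compares two universal
arrows. -/
lemma isIso_counit_of_essImLan (hD : D.IsDerivator) {A B : Cat.{w, w}} {f : A ⥤ B}
    [f.Full] [f.Faithful] {L : D.Dia A ⥤ D.Dia B} (adj : L ⊣ D.res f) {X : D.Dia B}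
    (h : D.EssImLan f X) : IsIso (adj.counit.app X) := by
  rw [essImLan_iff_id hD] at h
  refine (Functor.isUniv_unit adj ((D.res f).obj X)).isIso ?_
  exact Eq.mp (congrArg _ (adj.right_triangle_components X).symm) h

lemma isIso_unit_of_essImRan (hD : D.IsDerivator) {A B : Cat.{w, w}} {f : A ⥤ B}
    [f.Full] [f.Faithful] {R : D.Dia A ⥤ D.Dia B} (adj : D.res f ⊣ R) {X : D.Dia B}
    (h : D.EssImRan f X) : IsIso (adj.unit.app X) := by
  rw [essImRan_iff_id hD] at h
  refine (Functor.isCouniv_counit adj ((D.res f).obj X)).isIso ?_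
  exact Eq.mp (congrArg _ (adj.left_triangle_components X).symm) h

end Prederivator

namespace StableDerivator

namespace Cond

variable {A B : Cat.{w, w}} {P : Cond.{w, v, u} A} {Q : Cond.{w, v, u} B} {D : StableDerivator.{w, v, u}}

lemma prop_of_iso {I : Cat.{w, w}} {X Y : D.toPre.Dia (Cat.of (A × I))}
    (e : X ≅ Y) (h : (P.sub D).prop I X) : (P.sub D).prop I Y :=
  (P.prop_iff D I Y).2 fun i =>
    P.pred_iso ((pb (sectL A i)).mapIso (ofDiaIso e)) ((P.prop_iff D I X).1 h i)

lemma prop_res_iff (f : A ⥤ B) {I : Cat.{w, w}} (X : D.toPre.Dia (Cat.of (B × I))) :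
    (P.sub D).prop I ((D.toPre.res (prodId f I)).obj X) ↔
      ∀ i : I, P.pred D ((pb f).obj ((pb (sectL B i)).obj (ofDia X))) := by
  refine (P.prop_iff D I _).trans (forall_congr' fun i => ?_)
  exact ⟨P.pred_iso ((pb (sectL A i)).mapIso (ofDiaRes (prodId f I) X)),
    P.pred_iso ((pb (sectL A i)).mapIso (ofDiaRes (prodId f I) X).symm)⟩

section
variable (f : A ⥤ B) [f.Full] [f.Faithful]

/-- Membership and being a Kan extension are both tested at each parameter `i`, so the hypothesis
without parameters suffices. -/
lemma prop_iff_lan (h : ∀ (D : StableDerivator.{w, v, u}) (X : D.toPre.St B),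
      Q.pred D X ↔ (pb f).IsUniv (𝟙 ((pb f).obj X)) ∧ P.pred D ((pb f).obj X))
    {I : Cat.{w, w}} (X : D.toPre.Dia (Cat.of (B × I))) : (Q.sub D).prop I X ↔
      D.toPre.EssImLan (prodId f I) X ∧ (P.sub D).prop I ((D.toPre.res (prodId f I)).obj X) := by
  rw [prop_res_iff, essImLan_prodId_iff D.isStable.isDerivator, Q.prop_iff, ← forall_and]
  exact forall_congr' fun i => h D _

lemma prop_iff_ran (h : ∀ (D : StableDerivator.{w, v, u}) (X : D.toPre.St B),
      Q.pred D X ↔ (pb f).IsCouniv (𝟙 ((pb f).obj X)) ∧ P.pred D ((pb f).obj X))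
    {I : Cat.{w, w}} (X : D.toPre.Dia (Cat.of (B × I))) : (Q.sub D).prop I X ↔
      D.toPre.EssImRan (prodId f I) X ∧ (P.sub D).prop I ((D.toPre.res (prodId f I)).obj X) := by
  rw [prop_res_iff, essImRan_prodId_iff D.isStable.isDerivator, Q.prop_iff, ← forall_and]
  exact forall_congr' fun i => h D _

/-- Left Kan extension along a fully faithful functor is an equivalence onto its essential image. -/
lemma wordEquiv_of_lan (h : ∀ (D : StableDerivator.{w, v, u}) (X : D.toPre.St B),
      Q.pred D X ↔ (pb f).IsUniv (𝟙 ((pb f).obj X)) ∧ P.pred D ((pb f).obj X)) :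
    WordEquiv Q P := by
  choose K hK using fun D : StableDerivator.{w, v, u} => exists_lan D.isStable.isDerivator f
  let adj D := (hK D).some
  let adjA D (I : Cat.{w, w}) : ((K D).app (op I)).toFunctor ⊣ D.toPre.res (prodId f I) :=
    adjunctionApp (adj D) I
  have hI (I : Cat.{w, w}) : (prodId f I).Full ∧ (prodId f I).Faithful :=
    ⟨full_prodId f I, faithful_prodId f I⟩
  have hres (D : StableDerivator.{w, v, u}) (I : Cat.{w, w}) (X : D.toPre.Dia (Cat.of (B × I)))
      (hX : (Q.sub D).prop I X) : (P.sub D).prop I ((D.toPre.res (prodId f I)).obj X) :=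
    ((prop_iff_lan f h X).1 hX).2
  -- The unit is invertible on all diagrams because `f` is fully faithful; the counit will be so
  -- only on the diagrams satisfying `Q`.
  have hunit (D : StableDerivator.{w, v, u}) (I : Cat.{w, w}) (X : D.toPre.Dia (Cat.of (A × I))) :
      IsIso ((adjA D I).unit.app X) := by
    obtain ⟨_, _⟩ := hI I
    exact isIso_of_isUniv_res D.isStable.isDerivator _ (Functor.isUniv_unit (adjA D I) X)
  have hext (D : StableDerivator.{w, v, u}) (I : Cat.{w, w}) (X : D.toPre.Dia (Cat.of (A × I)))
      (hX : (P.sub D).prop I X) : (Q.sub D).prop I (((K D).app (op I)).toFunctor.obj X) := by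
    have := hunit D I X
    exact (prop_iff_lan f h _).2 ⟨⟨_, ⟨adjA D I⟩, Functor.obj_mem_essImage _ X⟩,
      prop_of_iso (asIso ((adjA D I).unit.app X)) hX⟩
  have hcounit (D : StableDerivator.{w, v, u}) (I : Cat.{w, w}) (X : D.toPre.Dia (Cat.of (B × I)))
      (hX : (Q.sub D).prop I X) : IsIso ((adjA D I).counit.app X) := by
    obtain ⟨_, _⟩ := hI I
    exact isIso_counit_of_essImLan D.isStable.isDerivator (adjA D I) ((prop_iff_lan f h X).1 hX).1
  let unit₁ D := FullSub.map₂OfMem (P := P.sub D) (Q := P.sub D) (F := 𝟙 _) (fun _ _ h => h)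
    (fun I X hX => hres D I _ (hext D I X hX)) (adj D).unit
  let counit₁ D := FullSub.map₂OfMem (P := Q.sub D) (Q := Q.sub D) (G := 𝟙 _)
    (fun I X hX => hext D I _ (hres D I X hX)) (fun _ _ h => h) (adj D).counit
  have hη D : IsIso (unit₁ D) := FullSub.isIso_map₂OfMem _ _ _ fun I X _ => hunit D I X
  have hε D : IsIso (counit₁ D) := FullSub.isIso_map₂OfMem _ _ _ fun I X hX => hcounit D I X hX
  -- Restriction is taken as the transformation of 2-functors since it commutes with every morphism;
  -- the Kan extension becomes natural as its inverse. The equivalence runs from `Q` to `P`, so the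
  -- inverse of the counit serves as its unit.
  refine ⟨Pseudofunctor.StrongTrans.equivOfApp (resTransform P Q f hres)
    (fun D => FullSub.mapOfMem (K D) (hext D)) (fun D => (@asIso _ _ _ _ (counit₁ D) (hε D)).symm)
    (fun D => (@asIso _ _ _ _ (unit₁ D) (hη D)).symm), .cons (.restr f) (.nil _),
    .cons (.lan f) (.nil _), ⟨Or.inl ⟨inferInstance, inferInstance⟩, trivial⟩,
    ⟨Or.inl ⟨inferInstance, inferInstance⟩, trivial⟩, fun D => ⟨shiftRes f D.toPre, K D,
      KanStep.isRealizedBy_single ⟨Iso.refl _⟩, KanStep.isRealizedBy_single (hK D),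
      ⟨FullSub.mapOfMemIncl _ (hres D)⟩, ⟨FullSub.mapOfMemIncl _ (hext D)⟩⟩⟩

/-- Right Kan extension along a fully faithful functor is an equivalence onto its essential
image. -/
lemma wordEquiv_of_ran (h : ∀ (D : StableDerivator.{w, v, u}) (X : D.toPre.St B),
      Q.pred D X ↔ (pb f).IsCouniv (𝟙 ((pb f).obj X)) ∧ P.pred D ((pb f).obj X)) :
    WordEquiv Q P := by
  choose K hK using fun D : StableDerivator.{w, v, u} => exists_ran D.isStable.isDerivator f
  let adj D := (hK D).some
  let adjA D (I : Cat.{w, w}) : D.toPre.res (prodId f I) ⊣ ((K D).app (op I)).toFunctor :=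
    adjunctionApp (adj D) I
  have hI (I : Cat.{w, w}) : (prodId f I).Full ∧ (prodId f I).Faithful :=
    ⟨full_prodId f I, faithful_prodId f I⟩
  have hres (D : StableDerivator.{w, v, u}) (I : Cat.{w, w}) (X : D.toPre.Dia (Cat.of (B × I)))
      (hX : (Q.sub D).prop I X) : (P.sub D).prop I ((D.toPre.res (prodId f I)).obj X) :=
    ((prop_iff_ran f h X).1 hX).2
  have hcounit (D : StableDerivator.{w, v, u}) (I : Cat.{w, w}) (X : D.toPre.Dia (Cat.of (A × I))) :
      IsIso ((adjA D I).counit.app X) := by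
    obtain ⟨_, _⟩ := hI I
    exact isIso_of_isCouniv_res D.isStable.isDerivator _ (Functor.isCouniv_counit (adjA D I) X)
  have hext (D : StableDerivator.{w, v, u}) (I : Cat.{w, w}) (X : D.toPre.Dia (Cat.of (A × I)))
      (hX : (P.sub D).prop I X) : (Q.sub D).prop I (((K D).app (op I)).toFunctor.obj X) := by
    have := hcounit D I X
    exact (prop_iff_ran f h _).2 ⟨⟨_, ⟨adjA D I⟩, Functor.obj_mem_essImage _ X⟩,
      prop_of_iso (asIso ((adjA D I).counit.app X)).symm hX⟩
  have hunit (D : StableDerivator.{w, v, u}) (I : Cat.{w, w}) (X : D.toPre.Dia (Cat.of (B × I)))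
      (hX : (Q.sub D).prop I X) : IsIso ((adjA D I).unit.app X) := by
    obtain ⟨_, _⟩ := hI I
    exact isIso_unit_of_essImRan D.isStable.isDerivator (adjA D I) ((prop_iff_ran f h X).1 hX).1
  let unit₁ D := FullSub.map₂OfMem (P := Q.sub D) (Q := Q.sub D) (F := 𝟙 _) (fun _ _ h => h)
    (fun I X hX => hext D I _ (hres D I X hX)) (adj D).unit
  let counit₁ D := FullSub.map₂OfMem (P := P.sub D) (Q := P.sub D) (G := 𝟙 _)
    (fun I X hX => hres D I _ (hext D I X hX)) (fun _ _ h => h) (adj D).counit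
  have hη D : IsIso (unit₁ D) := FullSub.isIso_map₂OfMem _ _ _ fun I X hX => hunit D I X hX
  have hε D : IsIso (counit₁ D) := FullSub.isIso_map₂OfMem _ _ _ fun I X _ => hcounit D I X
  refine ⟨Pseudofunctor.StrongTrans.equivOfApp (resTransform P Q f hres)
    (fun D => FullSub.mapOfMem (K D) (hext D)) (fun D => @asIso _ _ _ _ (unit₁ D) (hη D))
    (fun D => @asIso _ _ _ _ (counit₁ D) (hε D)), .cons (.restr f) (.nil _),
    .cons (.ran f) (.nil _), ⟨Or.inl ⟨inferInstance, inferInstance⟩, trivial⟩,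
    ⟨Or.inl ⟨inferInstance, inferInstance⟩, trivial⟩, fun D => ⟨shiftRes f D.toPre, K D,
      KanStep.isRealizedBy_single ⟨Iso.refl _⟩, KanStep.isRealizedBy_single (hK D),
      ⟨FullSub.mapOfMemIncl _ (hres D)⟩, ⟨FullSub.mapOfMemIncl _ (hext D)⟩⟩⟩

end

end Cond

end StableDerivator

/-! ### Vanishing and cocartesianness conditions -/

namespace Prederivator

variable {D : Prederivator.{w, v, u}}

/-- The shape of squares. -/
abbrev square : Cat.{w, w} := poset.{w} (Fin 2 × Fin 2)

/-- Evaluating at `(a, i)` means evaluating at `i` and at `a`. -/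
lemma isZero_pb_sectL_iff {A I : Cat.{w, w}} (a : A) (i : I) (X : D.Dia (Cat.of (A × I))) :
    Limits.IsZero ((pb (ptAt a)).obj ((pb (sectL A i)).obj (ofDia X))) ↔
      Limits.IsZero ((D.eval (A := Cat.of (A × I)) (a, i)).obj X) :=
  isZero_pb_ofDia_iff (ptAt (A := Cat.of (A × I)) (a, i)) X

/-- Isomorphic formal restrictions have isomorphic values. -/
def valIso {J : Cat.{w, w}} {X Y : D.St J} (e : X ≅ Y) : X.val ≅ Y.val where
  hom := e.hom
  inv := e.inv
  hom_inv_id := e.hom_inv_id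
  inv_hom_id := e.inv_hom_id

/-- Restrictions along isomorphic functors are isomorphic. -/
def trIso {K J : Cat.{w, w}} {h h' : K ⥤ J} (α : h ≅ h') (X : D.St J) :
    (pb h).obj X ≅ (pb h').obj X where
  hom := tr α.hom X
  inv := tr α.inv X
  hom_inv_id := by rw [← tr_comp, Iso.hom_inv_id, tr_id]
  inv_hom_id := by rw [← tr_comp, Iso.inv_hom_id, tr_id]

/-- The full subprederivator of `𝒟^A` of the diagrams which vanish at the objects in `S` and in
which the given squares are cocartesian. -/
def squares (A : Cat.{w, w}) (S : Set A) {ι : Type} (q : ι → (square.{w} ⥤ A))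
    (D : Prederivator.{w, v, u}) : FullSub (shift A D) where
  prop I X := (vanishing A S D).prop I X ∧
    ∀ (j : ι) (i : I), D.IsCocartesian ((D.res (q j ⋙ sectL A i)).obj X)
  res_mem {I J} f X hX := by
    refine ⟨(vanishing A S D).res_mem f X hX.1, fun j i => ?_⟩
    -- The square of the restricted diagram at the parameter `i` is, up to isomorphism, the square
    -- of `X` at `f i`.
    refine (essImLan_congr inclLL ?_).1 (hX.2 j (f.obj i))
    exact (valIso (trIso (Functor.isoWhiskerLeft (q j) (sectLIso A f i)) (ofDia X))).symm ≪≫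
      (D.resComp (q j ⋙ sectL A i) (prodFun A f)).app X

end Prederivator

namespace StableDerivator

namespace Cond

variable {A B : Cat.{w, w}}

/-- Vanishing conditions. -/
def vanishing (A : Cat.{w, w}) (S : Set A) : Cond.{w, v, u} A where
  sub D := Prederivator.vanishing A S D.toPre
  map F I X h := vanishing_map F.isExact.right (isStable _).pointed A S I X h
  pred _ X := ∀ a ∈ S, Limits.IsZero ((pb (ptAt a)).obj X)
  pred_iso e h a ha := (h a ha).of_iso ((pb (ptAt a)).mapIso e).symm
  prop_iff _ _ X :=
    ⟨fun h i a ha => (isZero_pb_sectL_iff a i X).2 (h a ha i),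
      fun h a ha i => (isZero_pb_sectL_iff a i X).1 (h i a ha)⟩

/-- Vanishing conditions together with the condition that certain squares are cocartesian. -/
def squares (A : Cat.{w, w}) (S : Set A) {ι : Type} (q : ι → (square.{w} ⥤ A)) :
    Cond.{w, v, u} A where
  sub D := Prederivator.squares A S q D.toPre
  map {D E} F I X h := by
    refine ⟨vanishing_map F.isExact.right E.isStable.pointed A S I X h.1, fun j i => ?_⟩
    -- Evaluation at a square commutes with `F` up to isomorphism, and `F` preserves pushouts.
    refine (essImLan_congr inclLL ?_).1 (F.isExact.right.pushout _ (h.2 j i))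
    exact ((Cat.Hom.toNatIso (F.mor.naturality (Prederivator.opHom (q j ⋙ sectL A i)))).app X)
  pred D X := (vanishing A S).pred D X ∧ ∀ j, D.toPre.IsCocartesian ((pb (q j)).obj X).val
  pred_iso e h := ⟨(vanishing A S).pred_iso e h.1,
    fun j => (essImLan_congr inclLL (valIso ((pb (q j)).mapIso e))).1 (h.2 j)⟩
  prop_iff D I X := by
    have h := (vanishing A S).prop_iff D I X
    exact ⟨fun hX i => ⟨h.1 hX.1 i, fun j => hX.2 j i⟩,
      fun hX => ⟨h.2 fun i => (hX i).1, fun j i => (hX i).2 j⟩⟩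

end Cond

end StableDerivator

/-! ### Pointwise Kan extensions for posets -/

namespace Prederivator

variable {D : Prederivator.{w, v, u}}

section Thin

variable {α β κ : Type} [Preorder α] [Preorder β] [Preorder κ]

/-- An element of a poset, as an object of the corresponding category. -/
abbrev ofElt (a : α) : poset.{w} α := AsSmall.up.obj a

/-- Natural transformations between functors to posets. -/
def posetTrans {K : Cat.{w, w}} {F G : K ⥤ poset.{w} β}
    (h : ∀ k, AsSmall.down.obj (F.obj k) ≤ AsSmall.down.obj (G.obj k)) : F ⟶ G where
  app k := AsSmall.up.map (homOfLE (h k))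
  naturality _ _ _ := (subsingleton_poset_hom _ _).elim _ _

/-- Natural isomorphisms between functors to posets. -/
def posetIso {K : Cat.{w, w}} {F G : K ⥤ poset.{w} β} (h : ∀ k, F.obj k = G.obj k) : F ≅ G :=
  NatIso.ofComponents (fun k => eqToIso (h k)) fun _ => (subsingleton_poset_hom _ _).elim _ _

lemma le_of_poset_hom {a b : poset.{w} α} (f : a ⟶ b) : AsSmall.down.obj a ≤ AsSmall.down.obj b :=
  leOfHom (AsSmall.down.map f)

/-- All diagrams in a poset commute, so finality only asks that each `a` in the slice lie below a
least `q k`. -/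
lemma isFinalAt_poset (f : α →o β) (c : β) (q : κ →o α)
    (h : ∀ a, f a ≤ c → ∃ k, a ≤ q k ∧ ∀ k', a ≤ q k' → k ≤ k')
    (γ : posetFunctor.{w} q ⋙ posetFunctor f ⟶ toPt _ ⋙ ptAt (ofElt c)) :
    IsFinalAt (posetFunctor f) (ofElt c) (posetFunctor q) γ := by
  intro a g
  obtain ⟨k, hk, hk'⟩ := h _ (le_of_poset_hom g)
  refine ⟨ofElt k, AsSmall.up.map (homOfLE hk), (subsingleton_poset_hom _ _).elim _ _,
    fun k' e' _ => ⟨AsSmall.up.map (homOfLE (hk' _ (le_of_poset_hom e'))),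
      (subsingleton_poset_hom _ _).elim _ _, fun _ _ => (subsingleton_poset_hom _ _).elim _ _⟩⟩

lemma isInitialAt_poset (f : α →o β) (c : β) (q : κ →o α)
    (h : ∀ a, c ≤ f a → ∃ k, q k ≤ a ∧ ∀ k', q k' ≤ a → k' ≤ k)
    (γ : toPt _ ⋙ ptAt (ofElt c) ⟶ posetFunctor.{w} q ⋙ posetFunctor f) :
    IsInitialAt (posetFunctor f) (ofElt c) (posetFunctor q) γ := by
  intro a g
  obtain ⟨k, hk, hk'⟩ := h _ (le_of_poset_hom g)
  refine ⟨ofElt k, AsSmall.up.map (homOfLE hk), (subsingleton_poset_hom _ _).elim _ _,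
    fun k' e' _ => ⟨AsSmall.up.map (homOfLE (hk' _ (le_of_poset_hom e'))),
      (subsingleton_poset_hom _ _).elim _ _, fun _ _ => (subsingleton_poset_hom _ _).elim _ _⟩⟩

end Thin

section Tr

variable {X₀ A B C : Cat.{w, w}}

lemma bc_id {p : X₀ ⥤ A} {q : X₀ ⥤ B} {f : A ⥤ C} {g : B ⥤ C} (α : p ⋙ f ⟶ q ⋙ g)
    (X : D.St C) : bc α (𝟙 ((pb f).obj X)) = tr α X :=
  (congrArg (CategoryStruct.comp (obj := D.St X₀) · (tr α X)) ((pb p).map_id _)).trans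
    (Category.id_comp (tr α X))

lemma cobc_id {p : X₀ ⥤ A} {q : X₀ ⥤ B} {f : A ⥤ C} {g : B ⥤ C} (α : p ⋙ f ⟶ q ⋙ g)
    (X : D.St C) : cobc α (𝟙 ((pb g).obj X)) = tr α X :=
  (congrArg (CategoryStruct.comp (obj := D.St X₀) (tr α X)) ((pb q).map_id _)).trans
    (Category.comp_id (tr α X))

lemma isUniv_tr_congr {p p' : X₀ ⥤ C} {q : X₀ ⥤ B} {g g' : B ⥤ C} (α : p ⟶ q ⋙ g)
    (α' : p' ⟶ q ⋙ g') (e : p ≅ p') (e' : g ≅ g')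
    (h : ∀ x, α.app x ≫ e'.hom.app (q.obj x) = e.hom.app x ≫ α'.app x) (X : D.St C) :
    (pb q).IsUniv (T := (pb g).obj X) (tr α X) ↔ (pb q).IsUniv (T := (pb g').obj X) (tr α' X) := by
  have h₁ := isUniv_bc_congr (f := 𝟭 C) (p := p) (p' := p') α α' e e' h (𝟙 ((pb (𝟭 C)).obj X))
  exact (iff_of_eq (congrArg (Functor.IsUniv (pb q) (T := (pb g).obj X))
    (bc_id (p := p) (f := 𝟭 C) α X).symm)).trans (h₁.trans (iff_of_eq (congrArg
      (Functor.IsUniv (pb q) (T := (pb g').obj X)) (bc_id (p := p') (f := 𝟭 C) α' X))))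

lemma isCouniv_tr_congr {p : X₀ ⥤ A} {q q' : X₀ ⥤ C} {f f' : A ⥤ C} (α : p ⋙ f ⟶ q)
    (α' : p ⋙ f' ⟶ q') (e : q ≅ q') (e' : f ≅ f')
    (h : ∀ x, α.app x ≫ e.hom.app x = e'.hom.app (p.obj x) ≫ α'.app x) (X : D.St C) :
    (pb p).IsCouniv (T := (pb f).obj X) (tr α X) ↔
      (pb p).IsCouniv (T := (pb f').obj X) (tr α' X) := by
  have h₁ := isCouniv_cobc_congr (g := 𝟭 C) (q := q) (q' := q') α α' e e' h (𝟙 ((pb (𝟭 C)).obj X))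
  exact (iff_of_eq (congrArg (Functor.IsCouniv (pb p) (T := (pb f).obj X))
    (cobc_id (q := q) (g := 𝟭 C) α X).symm)).trans (h₁.trans (iff_of_eq (congrArg
      (Functor.IsCouniv (pb p) (T := (pb f').obj X)) (cobc_id (q := q') (g := 𝟭 C) α' X))))

end Tr

section Points

variable {α β κ : Type} [Preorder α] [Preorder β] [Preorder κ]

lemma isUnivAt_poset_iff {f : α →o β} {c : β} {q : κ →o α}
    (h : ∀ a, f a ≤ c → ∃ k, a ≤ q k ∧ ∀ k', a ≤ q k' → k ≤ k')
    (γ : posetFunctor.{w} q ⋙ posetFunctor f ⟶ toPt _ ⋙ ptAt (ofElt c)) (X : D.St (poset.{w} β)) :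
    IsUnivAt (posetFunctor f) (ofElt c) (𝟙 ((pb (posetFunctor f)).obj X)) ↔
      (pb (toPt (poset κ))).IsUniv (T := (pb (ptAt (ofElt c))).obj X) (tr γ X) :=
  (isUnivAt_iff (isFinalAt_poset f c q h γ) _).trans (iff_of_eq (congrArg
    (Functor.IsUniv (pb (toPt (poset κ))) (T := (pb (ptAt (ofElt c))).obj X)) (bc_id γ X)))

lemma isCounivAt_poset_iff {f : α →o β} {c : β} {q : κ →o α}
    (h : ∀ a, c ≤ f a → ∃ k, q k ≤ a ∧ ∀ k', q k' ≤ a → k' ≤ k)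
    (γ : toPt _ ⋙ ptAt (ofElt c) ⟶ posetFunctor.{w} q ⋙ posetFunctor f) (X : D.St (poset.{w} β)) :
    IsCounivAt (posetFunctor f) (ofElt c) (𝟙 ((pb (posetFunctor f)).obj X)) ↔
      (pb (toPt (poset κ))).IsCouniv (T := (pb (ptAt (ofElt c))).obj X) (tr γ X) :=
  (isCounivAt_iff (isInitialAt_poset f c q h γ) _).trans (iff_of_eq (congrArg
    (Functor.IsCouniv (pb (toPt (poset κ))) (T := (pb (ptAt (ofElt c))).obj X)) (cobc_id γ X)))

/-- A left Kan extension vanishes at `c` if the diagram vanishes at the elements of a final part of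
the slice over `c`. -/
lemma isUnivAt_iff_isZero (hD : D.IsStableDerivator) {f : α →o β} {c : β} {q : κ →o α} (hq : ∀ k, f (q k) ≤ c)
    (h : ∀ a, f a ≤ c → ∃ k, a ≤ q k ∧ ∀ k', a ≤ q k' → k ≤ k') (X : D.St (poset.{w} β))
    (h₀ : ∀ k, Limits.IsZero ((pb (ptAt (ofElt (f (q k))))).obj X)) :
    IsUnivAt (posetFunctor f) (ofElt c) (𝟙 ((pb (posetFunctor f)).obj X)) ↔
      Limits.IsZero ((pb (ptAt (ofElt c))).obj X) := by
  rw [isUnivAt_poset_iff h (posetTrans fun k => hq _)]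
  have h₁ : Limits.IsZero ((pb (posetFunctor.{w} q ⋙ posetFunctor f)).obj X) := by
    rw [isZero_iff_eval hD.isDerivator hD.pointed]
    intro k
    exact (h₀ (AsSmall.down.obj k)).of_iso (trIso (h := ptAt k ⋙ posetFunctor q ⋙ posetFunctor f)
      (h' := ptAt (ofElt (f (q (AsSmall.down.obj k))))) (posetIso fun _ => rfl) X)
  have := hasZeroObject_st hD.isDerivator hD.pointed pt
  exact ⟨fun h => h.isZero h₁, fun h => Functor.isUniv_of_isZero _ h₁ h⟩

/-- A right Kan extension vanishes at `c` if the diagram vanishes at the elements of an initial part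
of the slice under `c`. -/
lemma isCounivAt_iff_isZero (hD : D.IsStableDerivator) {f : α →o β} {c : β} {q : κ →o α} (hq : ∀ k, c ≤ f (q k))
    (h : ∀ a, c ≤ f a → ∃ k, q k ≤ a ∧ ∀ k', q k' ≤ a → k' ≤ k) (X : D.St (poset.{w} β))
    (h₀ : ∀ k, Limits.IsZero ((pb (ptAt (ofElt (f (q k))))).obj X)) :
    IsCounivAt (posetFunctor f) (ofElt c) (𝟙 ((pb (posetFunctor f)).obj X)) ↔
      Limits.IsZero ((pb (ptAt (ofElt c))).obj X) := by
  rw [isCounivAt_poset_iff h (posetTrans fun k => hq _)]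
  have h₁ : Limits.IsZero ((pb (posetFunctor.{w} q ⋙ posetFunctor f)).obj X) := by
    rw [isZero_iff_eval hD.isDerivator hD.pointed]
    intro k
    exact (h₀ (AsSmall.down.obj k)).of_iso (trIso (h := ptAt k ⋙ posetFunctor q ⋙ posetFunctor f)
      (h' := ptAt (ofElt (f (q (AsSmall.down.obj k))))) (posetIso fun _ => rfl) X)
  have := hasZeroObject_st hD.isDerivator hD.pointed pt
  exact ⟨fun h => h.isZero h₁, fun h => Functor.isCouniv_of_isZero _ h₁ h⟩

lemma isUniv_poset_iff (hD : D.IsDerivator) (f : α →o β) (hf : ∀ x y, f x ≤ f y → x ≤ y)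
    (X : D.St (poset.{w} β)) :
    (pb (posetFunctor f)).IsUniv (𝟙 ((pb (posetFunctor f)).obj X)) ↔ ∀ c ∉ Set.range f,
      IsUnivAt (posetFunctor f) (ofElt c) (𝟙 ((pb (posetFunctor f)).obj X)) := by
  have := full_posetFunctor.{w} f hf
  have := faithful_posetFunctor.{w} f
  refine (isUniv_iff_of_fullyFaithful hD _ _).trans
    ⟨fun h c hc => h.2 _ fun ⟨a, ha⟩ => hc ⟨AsSmall.down.obj a, congrArg AsSmall.down.obj ha⟩,
      fun h => ⟨inferInstance, fun c hc => h (AsSmall.down.obj c) fun ⟨a, ha⟩ =>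
        hc ⟨ofElt a, congrArg ofElt ha⟩⟩⟩

lemma isCouniv_poset_iff (hD : D.IsDerivator) (f : α →o β) (hf : ∀ x y, f x ≤ f y → x ≤ y)
    (X : D.St (poset.{w} β)) :
    (pb (posetFunctor f)).IsCouniv (𝟙 ((pb (posetFunctor f)).obj X)) ↔ ∀ c ∉ Set.range f,
      IsCounivAt (posetFunctor f) (ofElt c) (𝟙 ((pb (posetFunctor f)).obj X)) := by
  have := full_posetFunctor.{w} f hf
  have := faithful_posetFunctor.{w} f
  refine (isCouniv_iff_of_fullyFaithful hD _ _).trans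
    ⟨fun h c hc => h.2 _ fun ⟨a, ha⟩ => hc ⟨AsSmall.down.obj a, congrArg AsSmall.down.obj ha⟩,
      fun h => ⟨inferInstance, fun c hc => h (AsSmall.down.obj c) fun ⟨a, ha⟩ =>
        hc ⟨ofElt a, congrArg ofElt ha⟩⟩⟩

/-- Only the vertex `(1, 1)` is missing from the span, and the slice over it is the entire span. -/
lemma isCocartesian_iff (hD : D.IsDerivator) {C : Cat.{w, w}} (s : square.{w} ⥤ C) (X : D.St C) :
    D.IsCocartesian ((pb s).obj X).val ↔
      (pb (toPt _)).IsUniv (T := (pb (ptAt (ofElt (1, 1)) ⋙ s)).obj X)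
        (tr (Functor.whiskerRight (posetTrans.{w} (F := inclLL)
          (G := toPt _ ⋙ ptAt (ofElt (1, 1))) fun _ => ⟨Fin.le_last _, Fin.le_last _⟩) s) X) := by
  refine (essImLan_iff hD inclLL ((pb s).obj X)).trans
    ((isUniv_poset_iff hD _ (fun _ _ h => h) _).trans ?_)
  refine Iff.trans ⟨fun h => h (1, 1) fun ⟨a, ha⟩ => a.2 ha, fun h c hc => ?_⟩
    (isUnivAt_poset_iff (q := OrderHom.id)
      (fun a _ => ⟨a, le_rfl, fun _ h => h⟩) _ _)
  have : c = (1, 1) := by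
    by_contra h'
    exact hc ⟨⟨c, h'⟩, rfl⟩
  rwa [this]

lemma isCartesian_iff (hD : D.IsDerivator) {C : Cat.{w, w}} (s : square.{w} ⥤ C) (X : D.St C) :
    D.IsCartesian ((pb s).obj X).val ↔
      (pb (toPt _)).IsCouniv (T := (pb (ptAt (ofElt (0, 0)) ⋙ s)).obj X)
        (tr (Functor.whiskerRight (posetTrans.{w} (G := inclUR)
          (F := toPt _ ⋙ ptAt (ofElt (0, 0))) fun _ => ⟨Fin.zero_le _, Fin.zero_le _⟩) s) X) := by
  refine (essImRan_iff hD inclUR ((pb s).obj X)).trans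
    ((isCouniv_poset_iff hD _ (fun _ _ h => h) _).trans ?_)
  refine Iff.trans ⟨fun h => h (0, 0) fun ⟨a, ha⟩ => a.2 ha, fun h c hc => ?_⟩
    (isCounivAt_poset_iff (q := OrderHom.id)
      (fun a _ => ⟨a, le_rfl, fun _ h => h⟩) _ _)
  have : c = (0, 0) := by
    by_contra h'
    exact hc ⟨⟨c, h'⟩, rfl⟩
  rwa [this]

/-- A left Kan extension is given by a pushout at `c` if a span is final in the slice over `c`. -/
lemma isUnivAt_iff_isCocartesian (hD : D.IsDerivator) {f : α →o β} (s : Fin 2 × Fin 2 →o β)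
    {q : {p : Fin 2 × Fin 2 // p ≠ (1, 1)} →o α} (hq : ∀ k, f (q k) = s k)
    (h : ∀ a, f a ≤ s (1, 1) → ∃ k, a ≤ q k ∧ ∀ k', a ≤ q k' → k ≤ k') (X : D.St (poset.{w} β)) :
    IsUnivAt (posetFunctor f) (ofElt (s (1, 1))) (𝟙 ((pb (posetFunctor f)).obj X)) ↔
      D.IsCocartesian ((pb (posetFunctor s)).obj X).val := by
  rw [isCocartesian_iff hD]
  refine (isUnivAt_poset_iff h (posetTrans fun k => ?_) X).trans
    (isUniv_tr_congr _ _ (posetIso fun k => congrArg ofElt (hq _)) (posetIso fun _ => rfl)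
      (fun _ => (subsingleton_poset_hom _ _).elim _ _) X)
  exact (hq _).trans_le (s.monotone ⟨Fin.le_last _, Fin.le_last _⟩)

/-- A right Kan extension is given by a pullback at `c` if a cospan is initial in the slice under
`c`. -/
lemma isCounivAt_iff_isCartesian (hD : D.IsDerivator) {f : α →o β} (s : Fin 2 × Fin 2 →o β)
    {q : {p : Fin 2 × Fin 2 // p ≠ (0, 0)} →o α} (hq : ∀ k, f (q k) = s k)
    (h : ∀ a, s (0, 0) ≤ f a → ∃ k, q k ≤ a ∧ ∀ k', q k' ≤ a → k' ≤ k) (X : D.St (poset.{w} β)) :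
    IsCounivAt (posetFunctor f) (ofElt (s (0, 0))) (𝟙 ((pb (posetFunctor f)).obj X)) ↔
      D.IsCartesian ((pb (posetFunctor s)).obj X).val := by
  rw [isCartesian_iff hD]
  refine (isCounivAt_poset_iff h (posetTrans fun k => ?_) X).trans
    (isCouniv_tr_congr _ _ (posetIso fun k => congrArg ofElt (hq _)) (posetIso fun _ => rfl)
      (fun _ => (subsingleton_poset_hom _ _).elim _ _) X)
  exact (s.monotone ⟨Fin.zero_le _, Fin.zero_le _⟩).trans_eq (hq _).symm

end Points

end Prederivator

/-! ### Elementary equivalences for posets: extension by zero, by pushouts and by pullbacks -/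

namespace StableDerivator

namespace Cond

variable {α β : Type} [Preorder α] [Preorder β]

/-- Vanishing conditions for diagrams of the shape of a poset. -/
abbrev posetVanishing (S : Set α) : Cond.{w, v, u} (poset.{w} α) :=
  vanishing (poset α) {x | AsSmall.down.obj x ∈ S}

/-- Vanishing conditions for diagrams of the shape of a poset, together with the condition that
certain squares are cocartesian. -/
abbrev posetSquares (S : Set α) {ι : Type} (s : ι → (Fin 2 × Fin 2 →o α)) :
    Cond.{w, v, u} (poset.{w} α) :=
  squares (poset α) {x | AsSmall.down.obj x ∈ S} fun j => posetFunctor (s j)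

variable {D : StableDerivator.{w, v, u}} {f : α →o β} {S : Set α} {T : Set β}

lemma pred_posetVanishing_iff (X : D.toPre.St (poset.{w} α)) :
    (posetVanishing S).pred D X ↔ ∀ a ∈ S, Limits.IsZero ((pb (ptAt (ofElt a))).obj X) :=
  ⟨fun h a ha => h (ofElt a) ha, fun h a ha => h (AsSmall.down.obj a) ha⟩

lemma pred_posetVanishing_pb_iff (X : D.toPre.St (poset.{w} β)) :
    (posetVanishing S).pred D ((pb (posetFunctor f)).obj X) ↔
      ∀ a ∈ S, Limits.IsZero ((pb (ptAt (ofElt (f a)))).obj X) :=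
  (pred_posetVanishing_iff _).trans (forall_congr' fun a => forall_congr' fun _ =>
    (trIso (h := ptAt (ofElt a) ⋙ posetFunctor f) (h' := ptAt (ofElt (f a)))
      (posetIso fun _ => rfl) X).isZero_iff)

/-- Vanishing at positions in the range of `f` is a condition on the restriction, so only the
positions outside the range remain to be imposed. -/
lemma pred_posetVanishing_of_pb (hST : ∀ a, f a ∈ T ↔ a ∈ S) (X : D.toPre.St (poset.{w} β)) :
    (posetVanishing T).pred D X ↔ (∀ c ∉ Set.range f, c ∈ T →
      Limits.IsZero ((pb (ptAt (ofElt c))).obj X)) ∧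
        (posetVanishing S).pred D ((pb (posetFunctor f)).obj X) := by
  rw [pred_posetVanishing_iff, pred_posetVanishing_pb_iff]
  refine ⟨fun h => ⟨fun c _ hc => h c hc, fun a ha => h _ ((hST a).2 ha)⟩, fun h c hc => ?_⟩
  by_cases hc' : c ∈ Set.range f
  · obtain ⟨a, rfl⟩ := hc'
    exact h.2 a ((hST a).1 hc)
  · exact h.1 c hc' hc

/-- Extension by zero to an ideal. -/
lemma wordEquiv_of_forall_not_le (hf : ∀ x y, f x ≤ f y → x ≤ y) (hST : ∀ a, f a ∈ T ↔ a ∈ S)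
    (h : ∀ c ∉ Set.range f, c ∈ T ∧ ∀ a, ¬ f a ≤ c) :
    WordEquiv (posetVanishing.{w, v, u} T) (posetVanishing.{w, v, u} S) := by
  have := full_posetFunctor.{w} f hf
  have := faithful_posetFunctor.{w} f
  refine wordEquiv_of_lan (posetFunctor f) fun D X => ?_
  rw [pred_posetVanishing_of_pb hST, isUniv_poset_iff D.isStable.isDerivator f hf]
  refine and_congr_left fun _ => forall_congr' fun c => forall_congr' fun hc => ?_
  -- The slice over `c` is empty, and an empty colimit is zero.
  rw [isUnivAt_iff_isZero D.isStable (κ := PEmpty) (q := ⟨PEmpty.elim, fun k => k.elim⟩)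
    (fun k => k.elim) (fun a ha => ((h c hc).2 a ha).elim) X fun k => k.elim]
  exact forall_prop_of_true (h c hc).1

/-- Extension by zero to elements such that the elements above them in the smaller poset are the
elements above an element at which the diagrams vanish. -/
lemma wordEquiv_of_isLeast (hf : ∀ x y, f x ≤ f y → x ≤ y) (hST : ∀ a, f a ∈ T ↔ a ∈ S)
    (h : ∀ c ∉ Set.range f, c ∈ T ∧ ∃ a ∈ S, IsLeast {a | c ≤ f a} a) :
    WordEquiv (posetVanishing.{w, v, u} T) (posetVanishing.{w, v, u} S) := by
  have := full_posetFunctor.{w} f hf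
  have := faithful_posetFunctor.{w} f
  refine wordEquiv_of_ran (posetFunctor f) fun D X => ?_
  rw [pred_posetVanishing_of_pb hST, isCouniv_poset_iff D.isStable.isDerivator f hf]
  refine and_congr_left fun hX => forall_congr' fun c => forall_congr' fun hc => ?_
  obtain ⟨hcT, a, haS, ha⟩ := h c hc
  rw [pred_posetVanishing_pb_iff] at hX
  -- The slice under `c` has the least element `a`, so the limit is the value at `a`, which
  -- vanishes.
  rw [isCounivAt_iff_isZero D.isStable (κ := PUnit) (q := OrderHom.const _ a)
    (fun _ => ha.1) (fun b hb => ⟨⟨⟩, ha.2 hb, fun _ _ => le_rfl⟩) X fun _ => hX a haS]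
  exact forall_prop_of_true hcT

/-- Diagrams on isomorphic posets are equivalent. -/
lemma wordEquiv_of_surjective (hf : ∀ x y, f x ≤ f y → x ≤ y) (hST : ∀ a, f a ∈ T ↔ a ∈ S)
    (h : Function.Surjective f) :
    WordEquiv (posetVanishing.{w, v, u} T) (posetVanishing.{w, v, u} S) :=
  wordEquiv_of_forall_not_le hf hST fun c hc => (hc (h c)).elim

lemma pred_posetSquares_iff {ι : Type} (s : ι → (Fin 2 × Fin 2 →o α)) (X : D.toPre.St (poset.{w} α)) :
    (posetSquares S s).pred D X ↔ (posetVanishing S).pred D X ∧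
      ∀ j, D.toPre.IsCocartesian ((pb (posetFunctor (s j))).obj X).val :=
  Iff.rfl

/-- Extension by pushouts. -/
lemma wordEquiv_of_isCocartesian (hf : ∀ x y, f x ≤ f y → x ≤ y) (hST : ∀ a, f a ∈ T ↔ a ∈ S)
    (hT : ∀ c ∈ T, c ∈ Set.range f) {ι : Type} (s : ι → (Fin 2 × Fin 2 →o β))
    (hs : ∀ c ∉ Set.range f, ∃ j, s j (1, 1) = c)
    (hs' : ∀ j, s j (1, 1) ∉ Set.range f)
    (q : ι → ({p : Fin 2 × Fin 2 // p ≠ (1, 1)} →o α)) (hq : ∀ j k, f (q j k) = s j k)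
    (h : ∀ j a, f a ≤ s j (1, 1) → ∃ k, a ≤ q j k ∧ ∀ k', a ≤ q j k' → k ≤ k') :
    WordEquiv (posetSquares.{w, v, u} T s) (posetVanishing.{w, v, u} S) := by
  have := full_posetFunctor.{w} f hf
  have := faithful_posetFunctor.{w} f
  refine wordEquiv_of_lan (posetFunctor f) fun D X => ?_
  rw [pred_posetSquares_iff, pred_posetVanishing_of_pb hST,
    isUniv_poset_iff D.isStable.isDerivator f hf, and_comm,
    and_iff_right (fun c hc hc' => (hc (hT c hc')).elim)]
  -- The elements outside the range of `f` are exactly the terminal corners of the squares, by `hs`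
  -- and `hs'`.
  refine and_congr_left fun _ => ⟨fun hX c hc => ?_, fun hX j => ?_⟩
  · obtain ⟨j, rfl⟩ := hs c hc
    exact (isUnivAt_iff_isCocartesian D.isStable.isDerivator (s j) (hq j) (h j) X).2 (hX j)
  · exact (isUnivAt_iff_isCocartesian D.isStable.isDerivator (s j) (hq j) (h j) X).1 (hX _ (hs' j))

/-- Extension by pullbacks. -/
lemma wordEquiv_of_isCartesian (hf : ∀ x y, f x ≤ f y → x ≤ y) (hST : ∀ a, f a ∈ T ↔ a ∈ S)
    (hT : ∀ c ∈ T, c ∈ Set.range f) {ι : Type} (s : ι → (Fin 2 × Fin 2 →o β))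
    (hs : ∀ c ∉ Set.range f, ∃ j, s j (0, 0) = c)
    (hs' : ∀ j, s j (0, 0) ∉ Set.range f)
    (q : ι → ({p : Fin 2 × Fin 2 // p ≠ (0, 0)} →o α)) (hq : ∀ j k, f (q j k) = s j k)
    (h : ∀ j a, s j (0, 0) ≤ f a → ∃ k, q j k ≤ a ∧ ∀ k', q j k' ≤ a → k' ≤ k) :
    WordEquiv (posetSquares.{w, v, u} T s) (posetVanishing.{w, v, u} S) := by
  have := full_posetFunctor.{w} f hf
  have := faithful_posetFunctor.{w} f
  refine wordEquiv_of_ran (posetFunctor f) fun D X => ?_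
  rw [pred_posetSquares_iff, pred_posetVanishing_of_pb hST,
    isCouniv_poset_iff D.isStable.isDerivator f hf, and_comm,
    and_iff_right (fun c hc hc' => (hc (hT c hc')).elim)]
  refine and_congr_left fun _ => ⟨fun hX c hc => ?_, fun hX j => ?_⟩
  · obtain ⟨j, rfl⟩ := hs c hc
    -- Stability enters here: the condition asks for cocartesian squares, the right Kan extension
    -- for cartesian ones.
    exact (isCounivAt_iff_isCartesian D.isStable.isDerivator (s j) (hq j) (h j) X).2
      ((D.isStable.cocartesian_iff _).1 (hX j))
  · exact (D.isStable.cocartesian_iff _).2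
      ((isCounivAt_iff_isCartesian D.isStable.isDerivator (s j) (hq j) (h j) X).1 (hX _ (hs' j)))

end Cond

end StableDerivator

/-! ### Combinatorics of one stage: staircases and the squares between them -/

namespace StableDerivator

namespace Staircase

/-- The poset with elements `(i + 1, i)` for `0 ≤ i < n` and `(i, i + 1)` for `m < i < n - 1`. -/
def InStairs (n m : ℕ) (p : ℕ × ℕ) : Prop :=
  (p.1 = p.2 + 1 ∧ p.2 < n) ∨ (p.2 = p.1 + 1 ∧ m < p.1 ∧ p.2 < n)

/-- The positions `(i, i + 1)`. -/
def stairsZeros (n m : ℕ) : Set {p // InStairs n m p} := {p | p.1.2 = p.1.1 + 1}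

/-- The initial corners of the squares. -/
def IsSource (m : ℕ) (t : ℕ × ℕ × ℕ) : Prop := t.1 ≤ m ∧ t.2.1 = 0 ∧ t.2.2 = 0

/-- The common corner of the squares. -/
def IsApex (m : ℕ) (t : ℕ × ℕ × ℕ) : Prop := t.1 = m + 1 ∧ t.2.1 = 0 ∧ t.2.2 = 0

/-- The corners of the squares at which the diagrams vanish. -/
def IsZeroCorner (m : ℕ) (t : ℕ × ℕ × ℕ) : Prop := t.1 ≤ m ∧ t.2.1 = t.1 ∧ t.2.2 = 1

/-- The terminal corners of the squares. -/
def IsTarget (m : ℕ) (t : ℕ × ℕ × ℕ) : Prop := t.1 = m + 1 ∧ t.2.1 ≤ m ∧ t.2.2 = 1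

/-- The part of the staircase above the squares. -/
def IsUpper (n m : ℕ) (t : ℕ × ℕ × ℕ) : Prop :=
  m + 2 ≤ t.2.2 ∧ ((t.2.2 < n ∧ t.1 = t.2.2 + 1 ∧ t.2.1 = t.2.2) ∨
    (t.2.2 + 1 < n ∧ t.1 = t.2.2 ∧ t.2.1 = t.2.2 + 1))

/-- The poset without the terminal corners of the squares. -/
def InLower (n m : ℕ) (t : ℕ × ℕ × ℕ) : Prop :=
  IsSource m t ∨ IsApex m t ∨ IsZeroCorner m t ∨ IsUpper n m t

/-- The poset without the initial corners of the squares. -/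
def InHigher (n m : ℕ) (t : ℕ × ℕ × ℕ) : Prop :=
  IsApex m t ∨ IsZeroCorner m t ∨ IsTarget m t ∨ IsUpper n m t

/-- The poset which contains all corners of the squares. -/
def InRoof (n m : ℕ) (t : ℕ × ℕ × ℕ) : Prop :=
  IsSource m t ∨ IsApex m t ∨ IsZeroCorner m t ∨ IsTarget m t ∨ IsUpper n m t

/-- The positions at which the diagrams vanish. -/
def zeros (P : ℕ × ℕ × ℕ → Prop) : Set {t // P t} :=
  {t | (t.1.2.1 = t.1.1 ∧ t.1.2.2 = 1) ∨ t.1.2.1 = t.1.1 + 1}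

variable (n m : ℕ)

/-- The inclusion of the lower poset into the poset of all corners. -/
def lowerToRoof : {t // InLower n m t} →o {t // InRoof n m t} where
  toFun t := ⟨t.1, by
    have := t.2
    simp only [InLower, InRoof] at this ⊢
    tauto⟩
  monotone' _ _ h := h

/-- The inclusion of the higher poset into the poset of all corners. -/
def higherToRoof : {t // InHigher n m t} →o {t // InRoof n m t} where
  toFun t := ⟨t.1, by
    have := t.2
    simp only [InHigher, InRoof] at this ⊢
    tauto⟩
  monotone' _ _ h := h

/-- The coordinates of the corners of the squares. -/
def corner (c : ℕ) (p : Fin 2 × Fin 2) : ℕ × ℕ × ℕ :=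
  -- The square reads x_c → x_{m+1} on top of 0 → C_c. The last coordinate separates the two rows;
  -- without it the source and the zero corner would coincide for c = 0.
  (if p.1 = 0 then c else m + 1, if p.2 = 0 then 0 else c, if p.2 = 0 then 0 else 1)

lemma corner_le_corner_iff {m c : ℕ} (hc : c ≤ m) {p q : Fin 2 × Fin 2} :
    corner m c p ≤ corner m c q ↔ p ≤ q := by
  obtain ⟨i, j⟩ := p
  obtain ⟨i', j'⟩ := q
  fin_cases i <;> fin_cases j <;> fin_cases i' <;> fin_cases j' <;>
    simp [corner, Prod.le_def] <;> omega

/-- The squares. -/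
def roofSquare (c : Fin (m + 1)) : Fin 2 × Fin 2 →o {t // InRoof n m t} where
  toFun p := ⟨corner m c p, by
    have := c.2
    simp only [InRoof, corner, IsSource, IsApex, IsZeroCorner, IsTarget, IsUpper]
    split_ifs <;> simp <;> omega⟩
  monotone' _ _ h := (corner_le_corner_iff (Nat.lt_succ_iff.1 c.2)).2 h

/-- The span in the square. -/
def lowerSpan (c : Fin (m + 1)) : {p : Fin 2 × Fin 2 // p ≠ (1, 1)} →o {t // InLower n m t} where
  toFun p := ⟨corner m c p, by
    have := c.2
    obtain ⟨⟨i, j⟩, hp⟩ := p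
    fin_cases i <;> fin_cases j <;>
      simp [InLower, corner, IsSource, IsApex, IsZeroCorner, IsUpper] at hp ⊢ <;> omega⟩
  monotone' _ _ h := (corner_le_corner_iff (Nat.lt_succ_iff.1 c.2)).2 h

/-- The cospan in the square. -/
def higherCospan (c : Fin (m + 1)) : {p : Fin 2 × Fin 2 // p ≠ (0, 0)} →o {t // InHigher n m t} where
  toFun p := ⟨corner m c p, by
    have := c.2
    obtain ⟨⟨i, j⟩, hp⟩ := p
    fin_cases i <;> fin_cases j <;>
      simp [InHigher, corner, IsTarget, IsApex, IsZeroCorner, IsUpper] at hp ⊢ <;> omega⟩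
  monotone' _ _ h := (corner_le_corner_iff (Nat.lt_succ_iff.1 c.2)).2 h

/-- Below the terminal corner of the square `c`, a source with index at most `c` is below the
initial vertex of the span, a later source or the apex only below `(1, 0)`, and a zero corner only
below `(0, 1)`. So each has a least vertex above it. -/
lemma lowerSpan_final (c : Fin (m + 1)) (a : {t // InLower n m t})
    (h : lowerToRoof n m a ≤ roofSquare n m c (1, 1)) :
    ∃ k, a ≤ lowerSpan n m c k ∧ ∀ k', a ≤ lowerSpan n m c k' → k ≤ k' := by
  obtain ⟨⟨a₁, a₂, a₃⟩, ha⟩ := a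
  have hc := c.2
  replace h : (a₁, a₂, a₃) ≤ corner m c (1, 1) := h
  suffices H : ∃ k : {p : Fin 2 × Fin 2 // p ≠ (1, 1)}, (a₁, a₂, a₃) ≤ corner m c k ∧
    ∀ k' : {p : Fin 2 × Fin 2 // p ≠ (1, 1)}, (a₁, a₂, a₃) ≤ corner m c k' → k.1 ≤ k'.1 from H
  simp [corner, Prod.le_def] at h
  simp only [InLower, IsSource, IsApex, IsZeroCorner, IsUpper] at ha
  by_cases h₃ : a₃ = 0
  · by_cases h₁ : a₁ ≤ c
    · refine ⟨⟨(0, 0), by decide⟩, ?_, fun k' _ => ⟨Fin.zero_le _, Fin.zero_le _⟩⟩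
      simp [corner, Prod.le_def]; omega
    · refine ⟨⟨(1, 0), by decide⟩, ?_, ?_⟩
      · simp [corner, Prod.le_def]; omega
      · rintro ⟨⟨i, j⟩, hk⟩
        fin_cases i <;> fin_cases j <;> simp [corner, Prod.le_def] at hk ⊢ <;> omega
  · refine ⟨⟨(0, 1), by decide⟩, ?_, ?_⟩
    · simp [corner, Prod.le_def]; omega
    · rintro ⟨⟨i, j⟩, hk⟩
      fin_cases i <;> fin_cases j <;> simp [corner, Prod.le_def] at hk ⊢ <;> omega

/-- Above the source of the square `c`, a zero corner lies only over `(0, 1)`, the apex and the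
targets with index less than `c` only over `(1, 0)`, and the remaining targets and the upper part
over `(1, 1)`. So each has a greatest vertex below it. -/
lemma higherCospan_initial (c : Fin (m + 1)) (a : {t // InHigher n m t})
    (h : roofSquare n m c (0, 0) ≤ higherToRoof n m a) :
    ∃ k, higherCospan n m c k ≤ a ∧ ∀ k', higherCospan n m c k' ≤ a → k' ≤ k := by
  obtain ⟨⟨a₁, a₂, a₃⟩, ha⟩ := a
  have hc := c.2
  replace h : corner m c (0, 0) ≤ (a₁, a₂, a₃) := h
  suffices H : ∃ k : {p : Fin 2 × Fin 2 // p ≠ (0, 0)}, corner m c k ≤ (a₁, a₂, a₃) ∧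
    ∀ k' : {p : Fin 2 × Fin 2 // p ≠ (0, 0)}, corner m c k' ≤ (a₁, a₂, a₃) → k'.1 ≤ k.1 from H
  simp [corner, Prod.le_def] at h
  simp only [InHigher, IsTarget, IsApex, IsZeroCorner, IsUpper] at ha
  by_cases h₁ : a₁ ≤ m
  · refine ⟨⟨(0, 1), by decide⟩, ?_, ?_⟩
    · simp [corner, Prod.le_def]; omega
    · rintro ⟨⟨i, j⟩, hk⟩
      fin_cases i <;> fin_cases j <;> simp [corner, Prod.le_def] at hk ⊢ <;> omega
  · by_cases h₂ : c ≤ a₂ ∧ 1 ≤ a₃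
    · refine ⟨⟨(1, 1), by decide⟩, ?_, fun k' _ => ⟨Fin.le_last _, Fin.le_last _⟩⟩
      simp [corner, Prod.le_def]; omega
    · refine ⟨⟨(1, 0), by decide⟩, ?_, ?_⟩
      · simp [corner, Prod.le_def]; omega
      · rintro ⟨⟨i, j⟩, hk⟩
        fin_cases i <;> fin_cases j <;> simp [corner, Prod.le_def] at hk ⊢ <;> omega

/-- The staircase, as a part of the lower poset. -/
def lowerCoord (p : ℕ × ℕ) : ℕ × ℕ × ℕ :=
  -- The chain elements `(i + 1, i)` with `i ≤ m + 1` become the sources and the apex, the first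
  -- zero `(m + 1, m + 2)` becomes the last zero corner, and the rest is kept with the minimum as
  -- third coordinate.
  if p.1 ≤ m + 2 ∧ p.2 ≤ m + 1 then (p.1 - 1, 0, 0)
  else if p.2 = m + 2 ∧ p.1 = m + 1 then (m, m, 1) else (p.1, p.2, min p.1 p.2)

lemma lowerCoord_le_iff {n m : ℕ} {p q : ℕ × ℕ} (hp : InStairs n m p) (hq : InStairs n m q) :
    lowerCoord m p ≤ lowerCoord m q ↔ p ≤ q := by
  simp only [InStairs] at hp hq
  simp only [lowerCoord]
  split_ifs <;> simp [Prod.le_def] <;> omega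

/-- The staircase, as a part of the higher poset. -/
def higherCoord (p : ℕ × ℕ) : ℕ × ℕ × ℕ :=
  -- In the next staircase `(1, 0)` is the apex and `(c + 2, c + 1)` is the target of index `c` for
  -- `c ≤ m`; truncated subtraction and `min p.2 1` cover both cases.
  if p.1 ≤ m + 2 ∧ p.2 ≤ m + 1 then (m + 1, p.2 - 1, min p.2 1) else (p.1, p.2, min p.1 p.2)

lemma higherCoord_le_iff {n m : ℕ} {p q : ℕ × ℕ} (hp : InStairs n (m + 1) p)
    (hq : InStairs n (m + 1) q) : higherCoord m p ≤ higherCoord m q ↔ p ≤ q := by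
  simp only [InStairs] at hp hq
  simp only [higherCoord]
  split_ifs <;> simp [Prod.le_def] <;> omega

/-- The inclusion of a staircase into the lower poset. -/
def stairsToLower : {p // InStairs n m p} →o {t // InLower n m t} where
  toFun p := ⟨lowerCoord m p.1, by
    have h := p.2
    simp only [InStairs] at h
    simp only [InLower, IsSource, IsApex, IsZeroCorner, IsUpper, lowerCoord]
    split_ifs <;> simp <;> omega⟩
  monotone' p q h := (lowerCoord_le_iff p.2 q.2).2 h

/-- The inclusion of a staircase into the higher poset. -/
def stairsToHigher : {p // InStairs n (m + 1) p} →o {t // InHigher n m t} where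
  toFun p := ⟨higherCoord m p.1, by
    have h := p.2
    simp only [InStairs] at h
    simp only [InHigher, IsTarget, IsApex, IsZeroCorner, IsUpper, higherCoord]
    split_ifs <;> simp <;> omega⟩
  monotone' p q h := (higherCoord_le_iff p.2 q.2).2 h

end Staircase

end StableDerivator

/-! ### Removing the zeros one by one -/

namespace StableDerivator

namespace Staircase

variable (n m : ℕ)

/-- The bound `m + 3 ≤ n` makes `(m + 1, m + 2)` a position of the staircase; it supplies the zero
corner of index `m`. -/
lemma mem_range_stairsToLower (hn : m + 3 ≤ n) (t : {t // InLower n m t})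
    (ht : ¬(IsZeroCorner m t.1 ∧ t.1.1 ≠ m)) : t ∈ Set.range (stairsToLower n m) := by
  obtain ⟨⟨a, b, c⟩, h⟩ := t
  simp only [InLower, IsSource, IsApex, IsZeroCorner, IsUpper] at h ht
  have key (p : ℕ × ℕ) (hp : InStairs n m p) (e : lowerCoord m p = (a, b, c)) :
      (⟨(a, b, c), h⟩ : {t // InLower n m t}) ∈ Set.range (stairsToLower n m) :=
    ⟨⟨p, hp⟩, Subtype.ext e⟩
  by_cases h₀ : c = 0
  · exact key (a + 1, a) (Or.inl ⟨rfl, by dsimp; omega⟩)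
      (by simp only [lowerCoord]; rw [if_pos (by omega)]; simp; omega)
  · by_cases h₁ : c = 1
    · exact key (m + 1, m + 2) (Or.inr ⟨rfl, Nat.lt_succ_self m, by dsimp; omega⟩)
        (by simp [lowerCoord]; omega)
    · exact key (a, b) (by simp only [InStairs]; omega)
        (by simp only [lowerCoord]; rw [if_neg (by omega), if_neg (by omega)]; simp; omega)

lemma mem_range_stairsToHigher (t : {t // InHigher n m t})
    (hn : m + 3 ≤ n) (ht : ¬IsZeroCorner m t.1) : t ∈ Set.range (stairsToHigher n m) := by
  obtain ⟨⟨a, b, c⟩, h⟩ := t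
  simp only [InHigher, IsTarget, IsApex, IsZeroCorner, IsUpper] at h ht
  have key (p : ℕ × ℕ) (hp : InStairs n (m + 1) p) (e : higherCoord m p = (a, b, c)) :
      (⟨(a, b, c), h⟩ : {t // InHigher n m t}) ∈ Set.range (stairsToHigher n m) :=
    ⟨⟨p, hp⟩, Subtype.ext e⟩
  by_cases h₁ : c ≤ 1
  · exact key (b + c + 1, b + c) (Or.inl ⟨rfl, by dsimp; omega⟩)
      (by simp only [higherCoord]; rw [if_pos (by omega)]; simp; omega)
  · exact key (a, b) (by simp only [InStairs]; omega)
      (by simp only [higherCoord]; rw [if_neg (by omega)]; simp; omega)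

lemma stairsToLower_mem_zeros_iff (p : {p // InStairs n m p}) :
    stairsToLower n m p ∈ zeros (InLower n m) ↔ p ∈ stairsZeros n m := by
  obtain ⟨⟨a, b⟩, h⟩ := p
  simp only [InStairs] at h
  change ((lowerCoord m (a, b)).2.1 = (lowerCoord m (a, b)).1 ∧ (lowerCoord m (a, b)).2.2 = 1) ∨
    (lowerCoord m (a, b)).2.1 = (lowerCoord m (a, b)).1 + 1 ↔ b = a + 1
  simp only [lowerCoord]
  split_ifs <;> simp <;> omega

lemma stairsToHigher_mem_zeros_iff (p : {p // InStairs n (m + 1) p}) :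
    stairsToHigher n m p ∈ zeros (InHigher n m) ↔ p ∈ stairsZeros n (m + 1) := by
  obtain ⟨⟨a, b⟩, h⟩ := p
  simp only [InStairs] at h
  change ((higherCoord m (a, b)).2.1 = (higherCoord m (a, b)).1 ∧ (higherCoord m (a, b)).2.2 = 1) ∨
    (higherCoord m (a, b)).2.1 = (higherCoord m (a, b)).1 + 1 ↔ b = a + 1
  simp only [higherCoord]
  split_ifs <;> simp <;> omega

lemma mem_range_lowerToRoof {t : {t // InRoof n m t}} :
    t ∈ Set.range (lowerToRoof n m) ↔ ¬IsTarget m t.1 := by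
  constructor
  · rintro ⟨⟨t, h⟩, rfl⟩
    change ¬IsTarget m t
    simp only [InLower, IsTarget, IsSource, IsApex, IsZeroCorner, IsUpper] at h ⊢
    omega
  · intro h
    have h' := t.2
    refine ⟨⟨t.1, ?_⟩, rfl⟩
    simp only [InRoof, InLower] at h' ⊢
    tauto

lemma mem_range_higherToRoof {t : {t // InRoof n m t}} :
    t ∈ Set.range (higherToRoof n m) ↔ ¬IsSource m t.1 := by
  constructor
  · rintro ⟨⟨t, h⟩, rfl⟩
    change ¬IsSource m t
    simp only [InHigher, IsTarget, IsSource, IsApex, IsZeroCorner, IsUpper] at h ⊢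
    omega
  · intro h
    have h' := t.2
    refine ⟨⟨t.1, ?_⟩, rfl⟩
    simp only [InRoof, InHigher] at h' ⊢
    tauto

lemma mem_range_of_mem_zeros {t : {t // InRoof n m t}} (ht : t ∈ zeros (InRoof n m)) :
    ¬IsTarget m t.1 ∧ ¬IsSource m t.1 := by
  replace ht : (t.1.2.1 = t.1.1 ∧ t.1.2.2 = 1) ∨ t.1.2.1 = t.1.1 + 1 := ht
  simp only [IsTarget, IsSource]
  omega

open Cond

/-- Left Kan extension adds the targets, as the cofibres C_c of x_c → x_{m+1}. -/
lemma wordEquiv_roof_lower : WordEquiv.{w, v, u}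
    (posetSquares (zeros (InRoof n m)) (roofSquare n m)) (posetVanishing (zeros (InLower n m))) := by
  refine wordEquiv_of_isCocartesian (f := lowerToRoof n m) (fun _ _ h => h) (fun _ => Iff.rfl)
    (fun c hc => (mem_range_lowerToRoof n m).2 (mem_range_of_mem_zeros n m hc).1) _
    (fun c hc => ?_) (fun j => ?_) (lowerSpan n m) (fun _ _ => rfl) (lowerSpan_final n m)
  · rw [mem_range_lowerToRoof, not_not] at hc
    exact ⟨⟨c.1.2.1, Nat.lt_succ_of_le hc.2.1⟩, Subtype.ext (Prod.ext hc.1.symm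
      (Prod.ext rfl hc.2.2.symm))⟩
  · rw [mem_range_lowerToRoof, not_not]
    exact ⟨rfl, Nat.le_of_lt_succ j.2, rfl⟩

/-- Right Kan extension recovers each x_c as the fibre of x_{m+1} → C_c. -/
lemma wordEquiv_roof_higher : WordEquiv.{w, v, u}
    (posetSquares (zeros (InRoof n m)) (roofSquare n m)) (posetVanishing (zeros (InHigher n m))) := by
  refine wordEquiv_of_isCartesian (f := higherToRoof n m) (fun _ _ h => h) (fun _ => Iff.rfl)
    (fun c hc => (mem_range_higherToRoof n m).2 (mem_range_of_mem_zeros n m hc).2) _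
    (fun c hc => ?_) (fun j => ?_) (higherCospan n m) (fun _ _ => rfl) (higherCospan_initial n m)
  · rw [mem_range_higherToRoof, not_not] at hc
    exact ⟨⟨c.1.1, Nat.lt_succ_of_le hc.1⟩, Subtype.ext (Prod.ext rfl
      (Prod.ext hc.2.1.symm hc.2.2.symm))⟩
  · rw [mem_range_higherToRoof, not_not]
    exact ⟨Nat.le_of_lt_succ j.2, rfl, rfl⟩

/-- Whatever in the staircase lies above a zero corner of index less than `m` lies above the zero
`(m + 1, m + 2)`, so right Kan extension inserts zeros at these corners. -/
lemma wordEquiv_lower_stairs (hn : m + 3 ≤ n) : WordEquiv.{w, v, u}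
    (posetVanishing (zeros (InLower n m))) (posetVanishing (stairsZeros n m)) := by
  refine wordEquiv_of_isLeast (f := stairsToLower n m) (fun p q h => (lowerCoord_le_iff p.2 q.2).1 h)
    (stairsToLower_mem_zeros_iff n m) fun c hc => ?_
  have hc' : IsZeroCorner m c.1 ∧ c.1.1 ≠ m := by
    by_contra h
    exact hc (mem_range_stairsToLower n m hn c h)
  obtain ⟨⟨c₁, c₂, c₃⟩, hc₀⟩ := c
  simp only [IsZeroCorner] at hc'
  refine ⟨Or.inl hc'.1.2, ⟨(m + 1, m + 2), Or.inr ⟨rfl, by omega, by omega⟩⟩, rfl, ?_, ?_⟩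
  · change (c₁, c₂, c₃) ≤ lowerCoord m (m + 1, m + 2)
    simp [lowerCoord, Prod.le_def]
    omega
  · rintro ⟨⟨a, b⟩, h⟩ hp
    replace hp : (c₁, c₂, c₃) ≤ lowerCoord m (a, b) := hp
    change (m + 1, m + 2) ≤ (a, b)
    simp only [InStairs] at h
    simp only [lowerCoord] at hp
    split_ifs at hp <;> simp [Prod.le_def] at hp ⊢ <;> omega

/-- Once the sources are gone nothing in the staircase lies below a zero corner, so left Kan
extension inserts zeros there. -/
lemma wordEquiv_higher_stairs (hn : m + 3 ≤ n) : WordEquiv.{w, v, u}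
    (posetVanishing (zeros (InHigher n m))) (posetVanishing (stairsZeros n (m + 1))) := by
  refine wordEquiv_of_forall_not_le (f := stairsToHigher n m)
    (fun p q h => (higherCoord_le_iff p.2 q.2).1 h) (stairsToHigher_mem_zeros_iff n m) fun c hc => ?_
  have hc' : IsZeroCorner m c.1 := by
    by_contra h
    exact hc (mem_range_stairsToHigher n m c hn h)
  obtain ⟨⟨c₁, c₂, c₃⟩, hc₀⟩ := c
  simp only [IsZeroCorner] at hc'
  refine ⟨Or.inl hc'.2, ?_⟩
  rintro ⟨⟨a, b⟩, h⟩ hp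
  replace hp : higherCoord m (a, b) ≤ (c₁, c₂, c₃) := hp
  simp only [InStairs] at h
  simp only [higherCoord] at hp
  split_ifs at hp <;> simp [Prod.le_def] at hp <;> omega

/-- The zigzag of one stage. Its net effect is to replace x_0 → … → x_{m+1} by x_{m+1} → C_0 → … →
C_m and to discard the zero `(m + 1, m + 2)`. -/
lemma wordEquiv_stairs_succ (hn : m + 3 ≤ n) : WordEquiv.{w, v, u}
    (posetVanishing (stairsZeros n m)) (posetVanishing (stairsZeros n (m + 1))) :=
  (wordEquiv_lower_stairs n m hn).symm.trans ((wordEquiv_roof_lower n m).symm.trans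
    ((wordEquiv_roof_higher n m).trans (wordEquiv_higher_stairs n m hn)))

lemma wordEquiv_stairs (k : ℕ) (hk : k + 3 ≤ n) : WordEquiv.{w, v, u}
    (posetVanishing (stairsZeros n 0)) (posetVanishing (stairsZeros n (k + 1))) := by
  induction k with
  | zero => exact wordEquiv_stairs_succ n 0 hk
  | succ k ih => exact (ih (by omega)).trans (wordEquiv_stairs_succ n (k + 1) hk)

/-- The isomorphism of `Ã(n,2)` with a staircase. -/
def stairsToATilde (hn : 3 ≤ n) : {p // InStairs n 0 p} →o {p // InATilde n p} where
  -- Both coordinates are lowered by one; the truncations at 0 and at `n - 2` send the ends `(1, 0)`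
  -- and `(n, n - 1)` to `(0, 0)` and `(n - 2, n - 2)`.
  toFun p := ⟨(min (p.1.1 - 1) (n - 2), p.1.2 - 1), by
    obtain ⟨⟨a, b⟩, h⟩ := p
    simp only [InStairs] at h
    by_cases h₀ : b = 0
    · exact Or.inl (Prod.ext (by simp; omega) (by simp; omega))
    · by_cases h₁ : b + 1 = n ∧ a = n
      · exact Or.inr (Or.inl (by simp; omega))
      · refine Or.inr (Or.inr ⟨min a b - 1, by omega, ?_⟩)
        rcases h with h | h
        · exact Or.inr (Prod.ext (by simp; omega) (by simp; omega))
        · exact Or.inl (Prod.ext (by simp; omega) (by simp; omega))⟩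
  monotone' p q h := ⟨by have := h.1; simp; omega, by have := h.2; simp; omega⟩

lemma wordEquiv_aTilde_stairs (hn : 3 ≤ n) : WordEquiv.{w, v, u}
    (vanishing (aTilde n) (aTildeZeros n)) (posetVanishing (stairsZeros n 0)) := by
  refine wordEquiv_of_surjective (f := stairsToATilde n hn)
    (T := {p | ∃ i : ℕ, p.1 = (i, i + 1)}) ?_ ?_ ?_
  · rintro ⟨⟨a, b⟩, h⟩ ⟨⟨a', b'⟩, h'⟩ ⟨h₁, h₂⟩
    simp only [InStairs] at h h'
    replace h₁ : min (a - 1) (n - 2) ≤ min (a' - 1) (n - 2) := h₁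
    replace h₂ : b - 1 ≤ b' - 1 := h₂
    exact ⟨by simp; omega, by simp; omega⟩
  · rintro ⟨⟨a, b⟩, h⟩
    simp only [InStairs] at h
    change (∃ i, (min (a - 1) (n - 2), b - 1) = (i, i + 1)) ↔ b = a + 1
    simp
    omega
  · rintro ⟨⟨a, b⟩, h⟩
    have key (p : ℕ × ℕ) (hp : InStairs n 0 p) (e : (min (p.1 - 1) (n - 2), p.2 - 1) = (a, b)) :
        ∃ x, stairsToATilde n hn x = ⟨(a, b), h⟩ := ⟨⟨p, hp⟩, Subtype.ext e⟩
    rcases h with h | h | ⟨i, hi, h | h⟩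
    · simp at h
      exact key (1, 0) (by simp [InStairs]; omega) (by simp; omega)
    · simp at h
      exact key (n, n - 1) (by simp [InStairs]; omega) (by simp; omega)
    · simp at h
      exact key (i + 1, i + 2) (by simp [InStairs]; omega) (by simp; omega)
    · simp at h
      exact key (i + 2, i + 1) (by simp [InStairs]; omega) (by simp; omega)

/-- The isomorphism of `A_n` with a staircase. -/
def aLinToStairs : Fin n →o {p // InStairs n (n - 2) p} where
  toFun i := ⟨(i + 1, i), Or.inl ⟨rfl, i.2⟩⟩
  monotone' _ _ h := ⟨Nat.succ_le_succ h, h⟩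

/-- A zero `(i, i + 1)` at stage `n - 2` would need `n - 2 < i` and `i + 1 < n`; only the chain is
left. -/
lemma wordEquiv_stairs_aLin (hn : 3 ≤ n) : WordEquiv.{w, v, u}
    (posetVanishing (stairsZeros n (n - 2))) (posetVanishing (∅ : Set (Fin n))) := by
  refine wordEquiv_of_surjective (f := aLinToStairs n) (fun _ _ h => h.2) (fun i => ?_) ?_
  · exact iff_of_false (show ¬(i : ℕ) = i + 1 + 1 by omega) id
  · rintro ⟨⟨a, b⟩, h⟩
    simp only [InStairs] at h
    exact ⟨⟨b, by omega⟩, Subtype.ext (Prod.ext (show b + 1 = a by omega) rfl)⟩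

/-- The equivalence between diagrams of shape `Ã(n,2)` with vanishing conditions and diagrams of
shape `A_n`. -/
lemma wordEquiv_aTilde_aLin (hn : 3 ≤ n) : WordEquiv.{w, v, u}
    (vanishing (aTilde n) (aTildeZeros n)) (posetVanishing (∅ : Set (Fin n))) := by
  refine (wordEquiv_aTilde_stairs n hn).trans (WordEquiv.trans ?_ (wordEquiv_stairs_aLin n hn))
  obtain ⟨k, rfl⟩ := Nat.exists_eq_add_of_le' hn
  exact wordEquiv_stairs _ k le_rfl

end Staircase

end StableDerivator

/-! ### Vacuous conditions -/

namespace Prederivator.FullSub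

lemma ids_eq_ids_comp {C₁ : Type*} [Category C₁] {X : C₁} {m : X ⟶ X} (h : m = 𝟙 X) :
    𝟙 X ≫ 𝟙 X ≫ 𝟙 X ≫ 𝟙 X ≫ 𝟙 X ≫ 𝟙 X = (𝟙 X ≫ 𝟙 X) ≫ m := by
  simp [h]

lemma ids_eq_comp_ids {C₁ : Type*} [Category C₁] {X : C₁} {m : X ⟶ X} (h : m = 𝟙 X) :
    𝟙 X ≫ 𝟙 X ≫ 𝟙 X = (𝟙 X ≫ 𝟙 X ≫ 𝟙 X ≫ 𝟙 X ≫ 𝟙 X) ≫ m := by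
  simp [h]

lemma ids_eq_ids_comp_ids {C₁ : Type*} [Category C₁] {X : C₁} {m : X ⟶ X} (h : m = 𝟙 X) :
    𝟙 X ≫ 𝟙 X = 𝟙 X ≫ 𝟙 X ≫ 𝟙 X ≫ 𝟙 X ≫ m ≫ 𝟙 X := by
  simp [h]

variable {D : Prederivator.{w, v, u}} (P : FullSub D) (h : ∀ A X, P.prop A X)

/-- The inverse of the inclusion of a full subprederivator which contains all diagrams. -/
def ofForall : D ⟶ P.toPre where
  app A := Cat.Hom.ofFunctor ((P.prop A.unop).lift (𝟭 (D.Dia A.unop)) (h A.unop))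
  naturality {A B} f := Cat.Hom.isoMk (Iso.refl
    ((P.prop B.unop).lift (D.res f.unop.toFunctor) fun X => h B.unop _))
  naturality_naturality α := by
    ext X
    exact ObjectProperty.hom_ext _ ((Category.comp_id _).trans (Category.id_comp _).symm)
  naturality_id A := by
    ext X
    exact ObjectProperty.hom_ext _ ((Category.id_comp _).trans
      ((congrArg _ (Category.comp_id _)).trans (Category.comp_id _)).symm)
  naturality_comp {A B C} f g := by
    ext X
    have h : (D.map g).toFunctor.map (𝟙 ((D.map f).toFunctor.obj X)) = 𝟙 _ :=
      CategoryTheory.Functor.map_id _ _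
    exact ObjectProperty.hom_ext _ (aux_six ((D.mapComp f g).hom.toNatTrans.app X) h)

/-- Including and coming back is the identity. -/
def inclOfForall : 𝟙 P.toPre ≅ P.incl ≫ P.ofForall h :=
  Pseudofunctor.StrongTrans.isoMk
    (fun A => Cat.Hom.isoMk (Iso.refl (𝟭 (P.prop A.unop).FullSubcategory)))
    (fun {A B} f => by
      ext X
      exact ObjectProperty.hom_ext _ (ids_eq_ids_comp
        (CategoryTheory.Functor.map_id (D.map f).toFunctor _)))

/-- Regarding a diagram as a member of the full subprederivator does not change it. -/
def ofForallIncl : P.ofForall h ≫ P.incl ≅ 𝟙 D :=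
  Pseudofunctor.StrongTrans.isoMk
    (fun A => Cat.Hom.isoMk (Iso.refl (𝟭 (D.Dia A.unop))))
    (fun {A B} f => by
      ext X
      exact ids_eq_comp_ids (CategoryTheory.Functor.map_id (D.map f).toFunctor _))

end Prederivator.FullSub

namespace StableDerivator

namespace Cond

variable {A : Cat.{w, w}} (P : Cond.{w, v, u} A)

/-- The inclusions, as a transformation of 2-functors. -/
def inclTransform : P.functor ⟶ shiftFunctor A where
  app D := (P.sub D).incl
  naturality {D E} F := FullSub.mapOfMemIncl (shiftMap A F.mor) (P.map F)
  naturality_naturality θ := by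
    ext I X
    exact (Category.comp_id _).trans (Category.id_comp _).symm
  naturality_id D := by
    ext I X
    exact congrArg (CategoryStruct.comp (𝟙 X.obj)) (Category.id_comp (𝟙 X.obj)).symm
  naturality_comp {D E K} F G := by
    ext I X
    exact FullSub.ids_eq_ids_comp_ids (CategoryTheory.Functor.map_id ((shiftMap A G.mor).app I).toFunctor _)

/-- A condition which is always satisfied may be omitted. -/
noncomputable def inclEquivalence (h : ∀ D I X, (P.sub D).prop I X) :
    Bicategory.Equivalence P.functor (shiftFunctor A) :=
  Pseudofunctor.StrongTrans.equivOfApp P.inclTransform (fun D => (P.sub D).ofForall (h D))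
    (fun D => (P.sub D).inclOfForall (h D)) (fun D => (P.sub D).ofForallIncl (h D))

end Cond

end StableDerivator

theorem theorem5p1 (n : ℕ) (hn : 3 ≤ n) :
    (∀ D : StableDerivator.{w, v, u},
      (aTwo n D.toPre).IsStrict ∧ (aTwo n D.toPre).toPre.IsStableDerivator ∧
        (shift (aLin n) D.toPre).IsStableDerivator) ∧
    ∃ e : Bicategory.Equivalence (aTwoFunctor.{w, v, u} n) (aLinFunctor.{w, v, u} n),
      ∃ (s : KanWord.{w} (aTilde n) (aLin n)) (t : KanWord.{w} (aLin n) (aTilde n)),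
        KanWord.Admissible.{w, v, u} s ∧ KanWord.Admissible.{w, v, u} t ∧
        ∀ D : StableDerivator.{w, v, u},
          ∃ (F : shift (aTilde n) D.toPre ⟶ shift (aLin n) D.toPre)
            (G : shift (aLin n) D.toPre ⟶ shift (aTilde n) D.toPre),
            s.IsRealizedBy D.toPre F ∧ t.IsRealizedBy D.toPre G ∧
            Nonempty (iComp e D ≅ (aTwo n D.toPre).incl ≫ F) ∧
            Nonempty (gComp e D ≫ (aTwo n D.toPre).incl ≅ G) := by
  refine ⟨fun D => ⟨vanishing_isStrict D.isStable _ _, vanishing_isStableDerivator D.isStable _ _,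
    D.isStable.shift _⟩, ?_⟩
  obtain ⟨e, s, t, hs, ht, h⟩ := StableDerivator.Staircase.wordEquiv_aTilde_aLin.{w, v, u} n hn
  -- Diagrams subject to no vanishing condition form a 2-functor which is equivalent, but not equal,
  -- to `aLinFunctor n`; the inclusion is therefore composed with the word equivalence.
  let Q : StableDerivator.Cond.{w, v, u} (aLin n) :=
    StableDerivator.Cond.posetVanishing (∅ : Set (Fin n))
  have hQ (D : StableDerivator.{w, v, u}) (I X) : (Q.sub D).prop I X := fun _ h => h.elim
  refine ⟨e.trans' (Q.inclEquivalence hQ), s, t, hs, ht, fun D => ?_⟩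
  obtain ⟨F, G, hF, hG, ⟨i⟩, ⟨j⟩⟩ := h D
  refine ⟨F, G, hF, hG, ⟨i⟩, ⟨?_⟩⟩
  -- The inverse first regards a diagram as a member of `Q` and then applies `G` to its inclusion;
  -- this passage into `Q` and back is the identity.
  exact α_ _ _ _ ≪≫ whiskerLeftIso ((Q.sub D).ofForall (hQ D)) j ≪≫ (α_ _ _ _).symm ≪≫
    whiskerRightIso ((Q.sub D).ofForallIncl (hQ D)) G ≪≫ λ_ G
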